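/- Let $n\ge 1$. A cube is a closed axis-parallel cube of positive side length, and for a function $g\ge 0$ put $Mg(x)=\sup_{Q\ni x}\frac1{|Q|}\int_Q g$, the supremum being over all cubes containing $x$. A weight is a nonnegative measurable function $w$ on $\mathbb R^n$. It belongs to $A_\infty=\bigcup_{s>1}A_s$ if for some $1<s<\infty$ $$\sup_Q\Big(\frac1{|Q|}\int_Q w\Big)\Big(\frac1{|Q|}\int_Q w^{1-s'}\Big)^{s-1}<\infty,\qquad s'=\frac{s}{s-1},$$ and its Wilson constant is $$[w]_{A_\infty}=\sup_Q\frac1{w(Q)}\int_Q M(w\chi_Q).$$ A Calderón–Zygmund operator is a bounded linear operator $T$ on $L^2(\mathbb R^n)$ for which there are a kernel $K$ and constants $C$, $0<\varepsilon\le 1$ with $|K(x,y)|\le C|x-y|^{-n}$ for $x\ne y$, with $$|K(x,y)-K(x',y)|+|K(y,x)-K(y,x')|\le C\,\frac{|x-x'|^{\varepsilon}}{|x-y|^{n+\varepsilon}}\qquad\text{whenever } x\neq y,\ 2|x-x'|\le|x-y|,$$ and with $Tf(x)=\int K(x,y)f(y)\,dy$ for every compactly supported $f\in L^2$ and almost every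 $x\notin\operatorname{supp} f$. For $f\in L^1$, $Tf$ is defined by extension from $L^1\cap L^2$: it is the limit in measure of $Tu_k$, where $u_k\in L^1\cap L^2$ and $u_k\to f$ in $L^1$. For a sequence $f=\{f_j\}_{j\in\mathbb N}$ put $|f|_q=\big(\sum_j|f_j|^q\big)^{1/q}$ and $\overline Tf=\{Tf_j\}_{j\in\mathbb N}$. **Theorem (C–Z operators, vector-valued extensions).** Let $T$ be a Calderón–Zygmund operator on $\mathbb R^n$ and let $1<q<\infty$. Then there is a constant $c=c_{n,T,q}$, depending only on $n$, $T$ and $q$, such that for every weight $w\in A_\infty$, every $0<p<\infty$ and every sequence $f=\{f_j\}_{j\in\mathbb N}$ of compactly supported integrable functions, $$\Big(\int_{\mathbb R^n}|\overline Tf|_q^{\,p}\,w\,dx\Big)^{1/p}\le c\,\max\{1,p\}\,[w]_{A_\infty}\Big(\int_{\mathbb R^n}\big(M(|f|_q)\big)^{p}\,w\,dx\Big)^{1/p}.$$ -/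

import Mathlib

open MeasureTheory Filter Topology
open scoped ENNReal NNReal

namespace VectorCZ

/-- The closed axis-parallel cube in `ℝⁿ` with centre `a` and side length `2 * r`. -/
def cube {n : ℕ} (a : EuclideanSpace ℝ (Fin n)) (r : ℝ) : Set (EuclideanSpace ℝ (Fin n)) :=
  {x | ∀ i, |x i - a i| ≤ r}

/-- The average of a nonnegative function over the cube with centre `a` and side length `2 * r`. -/
noncomputable def cubeAvg {n : ℕ} (g : EuclideanSpace ℝ (Fin n) → ℝ≥0∞)
    (a : EuclideanSpace ℝ (Fin n)) (r : ℝ) : ℝ≥0∞ :=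
  (∫⁻ y in cube a r, g y) / volume (cube a r)

/-- The (uncentred) Hardy-Littlewood maximal function over cubes, of a nonnegative function:
`M g (x) = sup_{Q ∋ x} |Q|⁻¹ ∫_Q g`. -/
noncomputable def maximal {n : ℕ} (g : EuclideanSpace ℝ (Fin n) → ℝ≥0∞)
    (x : EuclideanSpace ℝ (Fin n)) : ℝ≥0∞ :=
  ⨆ (a : EuclideanSpace ℝ (Fin n)) (r : ℝ) (_ : 0 < r) (_ : x ∈ cube a r), cubeAvg g a r

/-- The `A_s` constant of a weight, `1 < s < ∞`:
`sup_Q (|Q|⁻¹ ∫_Q w) (|Q|⁻¹ ∫_Q w ^ (1 - s')) ^ (s - 1)` with `s' = s / (s - 1)`. The powers are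
taken in `[0, ∞]`, where `0` to a negative power is `∞`. -/
noncomputable def apConst {n : ℕ} (s : ℝ) (w : EuclideanSpace ℝ (Fin n) → ℝ≥0) : ℝ≥0∞ :=
  ⨆ (a : EuclideanSpace ℝ (Fin n)) (r : ℝ) (_ : 0 < r),
    cubeAvg (fun y => (w y : ℝ≥0∞)) a r *
      cubeAvg (fun y => (w y : ℝ≥0∞) ^ (1 - s / (s - 1))) a r ^ (s - 1)

/-- The Muckenhoupt class `A_∞ = ⋃_{s > 1} A_s`. -/
def MemAInfty {n : ℕ} (w : EuclideanSpace ℝ (Fin n) → ℝ≥0) : Prop :=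
  Measurable w ∧ ∃ s : ℝ, 1 < s ∧ apConst s w < ∞

/-- Wilson's constant `[w]_{A_∞} = sup_Q w(Q)⁻¹ ∫_Q M(w χ_Q)`. -/
noncomputable def wilsonConst {n : ℕ} (w : EuclideanSpace ℝ (Fin n) → ℝ≥0) : ℝ≥0∞ :=
  ⨆ (a : EuclideanSpace ℝ (Fin n)) (r : ℝ) (_ : 0 < r),
    (∫⁻ x in cube a r, maximal ((cube a r).indicator fun y => (w y : ℝ≥0∞)) x) /
      ∫⁻ x in cube a r, (w x : ℝ≥0∞)

/-- The (quasi-)norm of `L^p(w)` of a nonnegative function: `(∫ F ^ p w dx) ^ (1 / p)`. -/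
noncomputable def weightedNorm {n : ℕ} (p : ℝ) (w : EuclideanSpace ℝ (Fin n) → ℝ≥0)
    (F : EuclideanSpace ℝ (Fin n) → ℝ≥0∞) : ℝ≥0∞ :=
  (∫⁻ x, F x ^ p * (w x : ℝ≥0∞)) ^ (1 / p)

/-- The pointwise `ℓ^q` norm `|f|_q (x) = (∑_j |f_j(x)| ^ q) ^ (1 / q)`, with values in `[0, ∞]`. -/
noncomputable def lqNorm {n : ℕ} {𝕜 : Type*} [RCLike 𝕜] (q : ℝ)
    (f : ℕ → EuclideanSpace ℝ (Fin n) → 𝕜) (x : EuclideanSpace ℝ (Fin n)) : ℝ≥0∞ :=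
  (∑' j, ‖f j x‖ₑ ^ q) ^ (1 / q)

/-- `K` is a standard kernel on `ℝⁿ × ℝⁿ` off the diagonal, with Hölder exponent `ε` and
constant `C`. -/
structure IsStandardKernel {n : ℕ} {𝕜 : Type*} [RCLike 𝕜] (ε C : ℝ)
    (K : EuclideanSpace ℝ (Fin n) → EuclideanSpace ℝ (Fin n) → 𝕜) : Prop where
  size : ∀ x y, x ≠ y → ‖K x y‖ ≤ C / ‖x - y‖ ^ n
  regularity : ∀ x x' y, x ≠ y → 2 * ‖x - x'‖ ≤ ‖x - y‖ →
    ‖K x y - K x' y‖ + ‖K y x - K y x'‖ ≤ C * ‖x - x'‖ ^ ε / ‖x - y‖ ^ ((n : ℝ) + ε)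

/-- `T` is a Calderón-Zygmund operator: a bounded linear operator on `L²(ℝⁿ)` which is associated
with a standard kernel, that is, `T f (x) = ∫ K(x, y) f(y) dy` for compactly supported `f ∈ L²` and
almost every `x` outside the support of `f`. -/
def IsCalderonZygmund {n : ℕ} {𝕜 : Type*} [RCLike 𝕜]
    (T : Lp 𝕜 2 (volume : Measure (EuclideanSpace ℝ (Fin n))) →L[𝕜]
      Lp 𝕜 2 (volume : Measure (EuclideanSpace ℝ (Fin n)))) : Prop :=
  ∃ (ε C : ℝ) (K : EuclideanSpace ℝ (Fin n) → EuclideanSpace ℝ (Fin n) → 𝕜),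
    0 < ε ∧ ε ≤ 1 ∧ IsStandardKernel ε C K ∧
    ∀ (f : EuclideanSpace ℝ (Fin n) → 𝕜) (hf : MemLp f 2 volume), HasCompactSupport f →
      ∀ᵐ x, x ∉ tsupport f → T (hf.toLp f) x = ∫ y, K x y * f y

/-- `g = T f` for an integrable function `f`, where `T` is extended from `L¹ ∩ L²` to `L¹` by
continuity from `L¹` to convergence in measure (for a Calderón-Zygmund operator this is the
extension given by the weak type `(1, 1)` bound): `g` is the limit in measure of `T u_k` for some
`u_k ∈ L¹ ∩ L²` which tend to `f` in `L¹`. -/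
def IsValue {n : ℕ} {𝕜 : Type*} [RCLike 𝕜]
    (T : Lp 𝕜 2 (volume : Measure (EuclideanSpace ℝ (Fin n))) →L[𝕜]
      Lp 𝕜 2 (volume : Measure (EuclideanSpace ℝ (Fin n))))
    (f g : EuclideanSpace ℝ (Fin n) → 𝕜) : Prop :=
  ∃ u : ℕ → Lp 𝕜 2 (volume : Measure (EuclideanSpace ℝ (Fin n))),
    (∀ k, Integrable (u k) volume) ∧
    Tendsto (fun k => ∫⁻ x, ‖u k x - f x‖ₑ) atTop (𝓝 0) ∧
    TendstoInMeasure volume (fun k => (T (u k) : EuclideanSpace ℝ (Fin n) → 𝕜)) atTop g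

/-- On `L¹ ∩ L²` the extension agrees with `T` itself. -/
theorem isValue_toLp {n : ℕ} {𝕜 : Type*} [RCLike 𝕜]
    (T : Lp 𝕜 2 (volume : Measure (EuclideanSpace ℝ (Fin n))) →L[𝕜]
      Lp 𝕜 2 (volume : Measure (EuclideanSpace ℝ (Fin n))))
    (f : EuclideanSpace ℝ (Fin n) → 𝕜) (hf : MemLp f 2 volume) (hf1 : Integrable f volume) :
    IsValue T f (T (hf.toLp f)) := by
  refine ⟨fun _ => hf.toLp f, fun _ => hf1.congr hf.coeFn_toLp.symm, ?_, ?_⟩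
  · have h : ∫⁻ x, ‖hf.toLp f x - f x‖ₑ = 0 := by
      rw [lintegral_congr_ae (g := fun _ => 0), lintegral_zero]
      filter_upwards [hf.coeFn_toLp] with x hx
      simp [hx]
    simp [h]
  · intro ε hε
    simp [hε.not_ge]

end VectorCZ

/-!
# Weighted estimates for vector-valued Calderón–Zygmund operators

The theorem is reduced to an estimate for one singular integral operator with values in a Banach
space `V`, `IsSIO.weightedNorm_le`, which is used twice. The operator is given on bounded, boundedly
supported functions (`Nice`); `IsSIO` records that it is bounded on a single `L^q` and has a scalar
standard kernel.

*The estimate for one operator.* The Calderón–Zygmund decomposition gives the weak type `(1, 1)`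
inequality (`IsSIO.weak_type`). Splitting the argument into a part near a cube `Q` and a part away
from it shows that a value `g` of the operator at `f` is within `a Q` of a constant vector `v Q` on
`Q`, up to a set of measure at most `2 ^ (-n - 2) |Q|`, where `a Q` is a multiple of
`∑ m, 2 ^ (-ε m) ⨍_{2^m Q*} ‖f‖` for a fixed dilate `Q*` of `Q`
(`IsSIO.oscillation_of_approximable`). Selecting the maximal dyadic
subcubes in which the exceptional set has large density, and iterating, yields a tree of cubes in
which the children cover at most half of their parent. At a point which leaves the tree after
finitely many generations, which is almost every point, the differences `v P - v Q` along the tree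
telescope and `‖g - v Q‖ ≤ 2 ∑ a P`, the sum being over the cubes `P ∋ x` of the tree
(`exists_isSparse_dominating`). On large cubes the weak type inequality also controls `v Q`.

Let `ν = w dx`. Since at least half of each cube `P ⊆ R` is not covered by its children, `ν(P)` is at
most twice the integral of `M(w χ_R)` over the uncovered part, so the sum of `ν(P)` over
the tree below `R` is at most `2 [w]_{A_∞} ν(R)`: the tree satisfies the Carleson condition
(`IsSparse.treeSum_withDensity_le`). The Carleson embedding in the form
`lintegral_treeFun_rpow_le` then bounds the `L^p(ν)` norm of the sum of the `a P`, which are at most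
`c M‖f‖` on `P`, by `max 1 p` times the Carleson constant times the norm of `M‖f‖`, with no loss as
`p` tends to `0`: for `p ≤ 1` by Hölder's inequality with the factor `(M‖f‖) ^ (p - 1)`, and for
`p ≥ 1` by comparing the increments of `u ↦ u ^ p` along the tree with its derivative.

*The two applications.* With `V = 𝕜`, boundedness on `L²`, the weight `1` and the exponent `q`, the
estimate and the maximal theorem show that `T` is bounded on `L^q` (`IsSIO.change_exponent`). Hence
the componentwise extension of `T` to `ℓ^q`-sequences of length `N` is bounded on `L^q` with a bound
independent of `N` (`IsSIO.vecOp`), and the estimate applies to it. Monotone convergence gives the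
result for infinite sequences. The class `A_∞` enters only through the local integrability of `w`
and Wilson's constant.
-/

namespace VectorCZ

/-! ### Half-open cubes and dyadic subdivision -/

/-- The half-open cube `∏ [c i, c i + s)` with corner `c` and side length `s`; it is empty for
`s = 0` when `0 < n`, which serves as a dummy value in families of cubes. -/
def icube {n : ℕ} (c : EuclideanSpace ℝ (Fin n)) (s : ℝ) : Set (EuclideanSpace ℝ (Fin n)) :=
  {x | ∀ i, c i ≤ x i ∧ x i < c i + s}

/-- The centre of `icube c s`. -/
noncomputable def icenter {n : ℕ} (c : EuclideanSpace ℝ (Fin n)) (s : ℝ) :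
    EuclideanSpace ℝ (Fin n) :=
  WithLp.toLp 2 fun i => c i + s / 2

lemma icenter_apply {n : ℕ} (c : EuclideanSpace ℝ (Fin n)) (s : ℝ) (i : Fin n) :
    icenter c s i = c i + s / 2 := rfl

lemma icube_zero {n : ℕ} (hn : 0 < n) (c : EuclideanSpace ℝ (Fin n)) : icube c 0 = ∅ := by
  ext x
  simp only [icube, Set.mem_ofPred_eq, Set.mem_empty_iff_false, iff_false, not_forall]
  exact ⟨⟨0, hn⟩, by intro h; linarith [h.1, h.2]⟩

lemma icube_subset_cube {n : ℕ} (c : EuclideanSpace ℝ (Fin n)) (s : ℝ) :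
    icube c s ⊆ cube (icenter c s) (s / 2) := by
  intro x hx i
  have := hx i
  rw [icenter_apply, abs_le]
  constructor <;> linarith

lemma icube_eq_preimage {n : ℕ} (c : EuclideanSpace ℝ (Fin n)) (s : ℝ) :
    icube c s = (WithLp.ofLp : EuclideanSpace ℝ (Fin n) → (Fin n → ℝ)) ⁻¹'
      (Set.univ.pi fun i => Set.Ico (c i) (c i + s)) := by
  ext x
  simp [icube, Set.mem_pi]

lemma cube_eq_preimage {n : ℕ} (a : EuclideanSpace ℝ (Fin n)) (r : ℝ) :
    cube a r = (WithLp.ofLp : EuclideanSpace ℝ (Fin n) → (Fin n → ℝ)) ⁻¹'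
      (Set.Icc (fun i => a i - r) (fun i => a i + r)) := by
  ext x
  simp only [cube, Set.mem_ofPred_eq, Set.mem_preimage, Set.mem_Icc, Pi.le_def, abs_le]
  constructor
  · intro h
    exact ⟨fun i => by linarith [(h i).1], fun i => by linarith [(h i).2]⟩
  · intro h i
    exact ⟨by linarith [h.1 i], by linarith [h.2 i]⟩

lemma measurableSet_icube {n : ℕ} (c : EuclideanSpace ℝ (Fin n)) (s : ℝ) :
    MeasurableSet (icube c s) := by
  rw [icube_eq_preimage]
  exact (PiLp.volume_preserving_ofLp (Fin n)).measurable
    (MeasurableSet.univ_pi fun i => measurableSet_Ico)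

lemma isClosed_cube {n : ℕ} (a : EuclideanSpace ℝ (Fin n)) (r : ℝ) : IsClosed (cube a r) := by
  rw [cube_eq_preimage]
  exact isClosed_Icc.preimage (PiLp.continuous_ofLp 2 _)

lemma measurableSet_cube {n : ℕ} (a : EuclideanSpace ℝ (Fin n)) (r : ℝ) :
    MeasurableSet (cube a r) := (isClosed_cube a r).measurableSet

lemma volume_icube {n : ℕ} (c : EuclideanSpace ℝ (Fin n)) (s : ℝ) :
    volume (icube c s) = ENNReal.ofReal s ^ n := by
  rw [icube_eq_preimage, (PiLp.volume_preserving_ofLp (Fin n)).measure_preimage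
    (MeasurableSet.univ_pi fun i => measurableSet_Ico).nullMeasurableSet, Real.volume_pi_Ico]
  simp

lemma volume_cube {n : ℕ} (a : EuclideanSpace ℝ (Fin n)) (r : ℝ) :
    volume (cube a r) = ENNReal.ofReal (2 * r) ^ n := by
  rw [cube_eq_preimage, (PiLp.volume_preserving_ofLp (Fin n)).measure_preimage
    measurableSet_Icc.nullMeasurableSet, Real.volume_Icc_pi]
  simp [← two_mul]

lemma icube_ae_eq_cube {n : ℕ} (c : EuclideanSpace ℝ (Fin n)) (s : ℝ) :
    icube c s =ᵐ[volume] cube (icenter c s) (s / 2) := by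
  refine ae_eq_of_subset_of_measure_ge (icube_subset_cube c s) ?_
    (measurableSet_icube c s).nullMeasurableSet ?_
  · rw [volume_cube, volume_icube]
    ring_nf; rfl
  · rw [volume_cube]
    exact ENNReal.pow_ne_top ENNReal.ofReal_ne_top

lemma volume_cube_ne_top {n : ℕ} (a : EuclideanSpace ℝ (Fin n)) (r : ℝ) :
    volume (cube a r) ≠ ∞ := by
  rw [volume_cube]; exact ENNReal.pow_ne_top ENNReal.ofReal_ne_top

lemma volume_cube_ne_zero {n : ℕ} (a : EuclideanSpace ℝ (Fin n)) {r : ℝ} (hr : 0 < r) :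
    volume (cube a r) ≠ 0 := by
  rw [volume_cube]; exact pow_ne_zero _ (by simpa using hr)

lemma volume_icube_ne_top {n : ℕ} (a : EuclideanSpace ℝ (Fin n)) (r : ℝ) :
    volume (icube a r) ≠ ∞ := by
  rw [volume_icube]; exact ENNReal.pow_ne_top ENNReal.ofReal_ne_top

lemma volume_icube_ne_zero {n : ℕ} (a : EuclideanSpace ℝ (Fin n)) {r : ℝ} (hr : 0 < r) :
    volume (icube a r) ≠ 0 := by
  rw [volume_icube]; exact pow_ne_zero _ (by simpa using hr)

lemma cube_subset_closedBall {n : ℕ} (a : EuclideanSpace ℝ (Fin n)) {r : ℝ} (hr : 0 ≤ r) :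
    cube a r ⊆ Metric.closedBall a (n * r) := by
  intro x hx
  rw [mem_closedBall_iff_norm, EuclideanSpace.norm_eq]
  apply Real.sqrt_le_iff.2 ⟨by positivity, ?_⟩
  calc ∑ i, ‖(x - a) i‖ ^ 2 ≤ ∑ _i : Fin n, r ^ 2 := by
        apply Finset.sum_le_sum
        intro i _
        have := hx i
        simp only [PiLp.sub_apply, Real.norm_eq_abs]
        gcongr
    _ = n * r ^ 2 := by simp
    _ ≤ (n * r) ^ 2 := by
        rw [mul_pow]
        gcongr
        exact_mod_cast Nat.le_self_pow two_ne_zero n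

lemma closedBall_subset_cube {n : ℕ} (a : EuclideanSpace ℝ (Fin n)) (r : ℝ) :
    Metric.closedBall a r ⊆ cube a r := by
  intro x hx i
  rw [mem_closedBall_iff_norm] at hx
  have := PiLp.norm_apply_le (x - a) i
  simp only [PiLp.sub_apply, Real.norm_eq_abs] at this
  linarith

lemma ball_subset_interior_cube {n : ℕ} (a : EuclideanSpace ℝ (Fin n)) (r : ℝ) :
    Metric.ball a r ⊆ interior (cube a r) :=
  interior_maximal (Metric.ball_subset_closedBall.trans (closedBall_subset_cube a r))
    Metric.isOpen_ball

/-- The index of the dyadic subcube of generation `k` of `icube c s` that contains `x`. -/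
noncomputable def dindex {n : ℕ} (c : EuclideanSpace ℝ (Fin n)) (s : ℝ) (k : ℕ)
    (x : EuclideanSpace ℝ (Fin n)) : Fin n → ℤ :=
  fun i => ⌊2 ^ k * ((x i - c i) / s)⌋

/-- The corner of the dyadic subcube of `icube c s` of generation `k` and index `m`. -/
noncomputable def dcorner {n : ℕ} (c : EuclideanSpace ℝ (Fin n)) (s : ℝ) (k : ℕ)
    (m : Fin n → ℤ) : EuclideanSpace ℝ (Fin n) :=
  WithLp.toLp 2 fun i => c i + s / 2 ^ k * m i

lemma mem_dyadic {n : ℕ} (c : EuclideanSpace ℝ (Fin n)) {s : ℝ} (hs : 0 < s) (k : ℕ)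
    (m : Fin n → ℤ) (x : EuclideanSpace ℝ (Fin n)) :
    x ∈ icube (dcorner c s k m) (s / 2 ^ k) ↔ dindex c s k x = m := by
  rw [funext_iff]
  refine forall_congr' fun i => ?_
  have h2 : (0 : ℝ) < 2 ^ k := by positivity
  have e : 2 ^ k * ((x i - c i) / s) = (x i - c i) / (s / 2 ^ k) := by field_simp
  have hp : 0 < s / 2 ^ k := by positivity
  simp only [dindex, dcorner]
  rw [Int.floor_eq_iff, e, le_div_iff₀ hp, div_lt_iff₀ hp]
  constructor
  · rintro ⟨h1, h2⟩
    constructor <;> nlinarith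
  · rintro ⟨h1, h2⟩
    constructor <;> nlinarith

lemma dindex_succ {n : ℕ} (c : EuclideanSpace ℝ (Fin n)) (s : ℝ) (k : ℕ)
    (x : EuclideanSpace ℝ (Fin n)) (i : Fin n) :
    dindex c s k x i = dindex c s (k + 1) x i / 2 := by
  have := Int.floor_div_natCast (2 ^ (k + 1) * ((x i - c i) / s)) 2
  simp only [dindex]
  rw [show (2 : ℤ) = ((2 : ℕ) : ℤ) by rfl, ← this]
  congr 1
  push_cast
  ring

lemma dindex_eq_of_le {n : ℕ} (c : EuclideanSpace ℝ (Fin n)) (s : ℝ) {k l : ℕ} (hkl : k ≤ l)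
    {x y : EuclideanSpace ℝ (Fin n)} (h : dindex c s l x = dindex c s l y) :
    dindex c s k x = dindex c s k y := by
  induction l, hkl using Nat.le_induction with
  | base => exact h
  | succ l _ ih =>
    apply ih
    ext i
    rw [dindex_succ, dindex_succ _ _ _ y, h]

lemma dindex_zero {n : ℕ} (c : EuclideanSpace ℝ (Fin n)) {s : ℝ} (hs : 0 < s)
    (x : EuclideanSpace ℝ (Fin n)) : dindex c s 0 x = 0 ↔ x ∈ icube c s := by
  rw [← mem_dyadic c hs 0 0 x]
  have : dcorner c s 0 0 = c := by ext i; simp [dcorner]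
  rw [this]; simp

/-- The dyadic subcube of generation `k` around a given point. -/
noncomputable def dcube {n : ℕ} (c : EuclideanSpace ℝ (Fin n)) (s : ℝ) (k : ℕ)
    (x : EuclideanSpace ℝ (Fin n)) : Set (EuclideanSpace ℝ (Fin n)) :=
  icube (dcorner c s k (dindex c s k x)) (s / 2 ^ k)

lemma mem_dcube {n : ℕ} (c : EuclideanSpace ℝ (Fin n)) {s : ℝ} (hs : 0 < s) (k : ℕ)
    (x y : EuclideanSpace ℝ (Fin n)) : y ∈ dcube c s k x ↔ dindex c s k y = dindex c s k x :=
  mem_dyadic c hs k _ y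

lemma volume_dcube_succ {n : ℕ} (c : EuclideanSpace ℝ (Fin n)) (s : ℝ) (k : ℕ)
    (x y : EuclideanSpace ℝ (Fin n)) :
    volume (dcube c s k x) = 2 ^ n * volume (dcube c s (k + 1) y) := by
  rw [dcube, dcube, volume_icube, volume_icube, ← mul_pow]
  congr 1
  rw [show (2 : ℝ≥0∞) = ENNReal.ofReal 2 by simp, ← ENNReal.ofReal_mul (by norm_num)]
  congr 1
  field_simp
  ring

/-- The Lebesgue differentiation theorem along dyadic cubes. -/
lemma ae_tendsto_dcube_average {n : ℕ} (c : EuclideanSpace ℝ (Fin n)) {s : ℝ} (hs : 0 < s)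
    {h : EuclideanSpace ℝ (Fin n) → ℝ≥0∞} (hm : Measurable h) (hi : ∫⁻ x, h x ≠ ∞) :
    ∀ᵐ x, Tendsto (fun k => (∫⁻ y in dcube c s k x, h y) / volume (dcube c s k x)) atTop
      (𝓝 (h x)) := by
  classical
  -- A closed cube of side `σ` has a fixed proportion of any ball of radius comparable to `σ`.
  let C : ℝ≥0 := (12 * n) ^ n + 3 ^ n
  have hball : ∀ (x : EuclideanSpace ℝ (Fin n)) (r : ℝ), 0 < r →
      volume (Metric.closedBall x (3 * r)) ≤ C * volume (Metric.closedBall x r) := by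
    intro x r hr
    rw [Measure.addHaar_closedBall_mul _ _ (by norm_num) hr.le,
      Measure.addHaar_closedBall_center _ x]
    gcongr
    simp only [finrank_euclideanSpace, Fintype.card_fin, C]
    rw [ENNReal.ofReal_pow (by norm_num)]
    push_cast
    simp
  let v := Vitali.vitaliFamily (volume : Measure (EuclideanSpace ℝ (Fin n))) C (fun x =>
    Eventually.frequently (by filter_upwards [self_mem_nhdsWithin] with r hr using hball x r hr))
  filter_upwards [v.ae_tendsto_lintegral_div hm.aemeasurable hi] with x hx
  let a : ℕ → Set (EuclideanSpace ℝ (Fin n)) := fun k =>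
    cube (icenter (dcorner c s k (dindex c s k x)) (s / 2 ^ k)) (s / 2 ^ k / 2)
  have hxa : ∀ k, x ∈ a k := fun k => icube_subset_cube _ _ ((mem_dcube c hs k x x).2 rfl)
  have hsub : ∀ k, a k ⊆ Metric.closedBall x (2 * n * (s / 2 ^ k)) := by
    intro k y hy
    have hp : 0 ≤ s / 2 ^ k / 2 := by positivity
    have h1 := cube_subset_closedBall _ hp hy
    have h2 := cube_subset_closedBall _ hp (hxa k)
    rw [Metric.mem_closedBall] at *
    have := dist_triangle_right y x (icenter (dcorner c s k (dindex c s k x)) (s / 2 ^ k))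
    have h3 : 0 ≤ (n : ℝ) * (s / 2 ^ k) := by positivity
    nlinarith
  have hta : Tendsto a atTop (v.filterAt x) := by
    rw [VitaliFamily.tendsto_filterAt_iff]
    constructor
    · refine Eventually.of_forall fun k => ⟨isClosed_cube _ _, ?_, 2 * n * (s / 2 ^ k), hsub k, ?_⟩
      · exact (Metric.nonempty_ball.2 (by positivity)).mono (ball_subset_interior_cube _ _)
      · refine (measure_mono (closedBall_subset_cube _ _)).trans ?_
        rw [volume_cube, volume_cube]
        have hp : 0 < s / 2 ^ k := by positivity
        rw [show 2 * (3 * (2 * n * (s / 2 ^ k))) = (12 * n) * (s / 2 ^ k) by ring,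
          show 2 * (s / 2 ^ k / 2) = s / 2 ^ k by ring, ENNReal.ofReal_mul (by positivity), mul_pow]
        gcongr
        simp only [C]
        rw [ENNReal.ofReal_mul (by norm_num)]
        push_cast
        simp
    · intro ε hε
      have : Tendsto (fun k : ℕ => 2 * n * (s / 2 ^ k)) atTop (𝓝 0) := by
        have := (tendsto_pow_atTop_nhds_zero_of_lt_one (r := (1 / 2 : ℝ)) (by norm_num)
          (by norm_num)).const_mul (2 * n * s)
        rw [mul_zero] at this
        refine this.congr fun k => ?_
        rw [one_div, inv_pow]; ring
      filter_upwards [this.eventually (ge_mem_nhds hε)] with k hk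
      exact (hsub k).trans (Metric.closedBall_subset_closedBall hk)
  refine (hx.comp hta).congr fun k => ?_
  simp only [Function.comp, dcube]
  rw [setLIntegral_congr (icube_ae_eq_cube _ _), measure_congr (icube_ae_eq_cube _ _)]

/-- **Calderón–Zygmund stopping cubes.** If the average of `h` over a cube is at most `t`, then the
maximal dyadic subcubes on which the average exceeds `t` are disjoint, the averages over them are
at most `2 ^ n * t`, and `h ≤ t` almost everywhere off them. -/
lemma exists_stopping {n : ℕ} (hn : 0 < n) (c : EuclideanSpace ℝ (Fin n)) {s : ℝ} (hs : 0 ≤ s)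
    {h : EuclideanSpace ℝ (Fin n) → ℝ≥0∞} (hm : Measurable h) (hi : ∫⁻ x in icube c s, h x ≠ ∞)
    (t : ℝ≥0∞) (ht : ∫⁻ x in icube c s, h x ≤ t * volume (icube c s)) :
    ∃ P : ℕ × (Fin n → ℤ) → EuclideanSpace ℝ (Fin n) × ℝ,
      (∀ j, 0 ≤ (P j).2) ∧ (∀ j, icube (P j).1 (P j).2 ⊆ icube c s) ∧
      Pairwise (Function.onFun Disjoint fun j => icube (P j).1 (P j).2) ∧
      (∀ j, t * volume (icube (P j).1 (P j).2) ≤ ∫⁻ x in icube (P j).1 (P j).2, h x) ∧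
      (∀ j, ∫⁻ x in icube (P j).1 (P j).2, h x ≤ 2 ^ n * t * volume (icube (P j).1 (P j).2)) ∧
      ∀ᵐ x, x ∈ icube c s → (∀ j, x ∉ icube (P j).1 (P j).2) → h x ≤ t := by
  classical
  rcases hs.eq_or_lt with rfl | hs
  · refine ⟨fun _ => (c, 0), ?_⟩
    simp [icube_zero hn, Pairwise]
  let IsStop : ℕ → EuclideanSpace ℝ (Fin n) → Prop := fun k x =>
    t * volume (dcube c s k x) < ∫⁻ y in dcube c s k x, h y
  have hdc : ∀ {k x y}, dindex c s k x = dindex c s k y → dcube c s k x = dcube c s k y := by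
    intro k x y hxy; simp only [dcube, hxy]
  -- the dyadic cube `j` is selected if it is the first stopping cube of one of its points;
  -- indices that are not selected are sent to an empty cube
  let sel : ℕ × (Fin n → ℤ) → Prop := fun j =>
    ∃ x ∈ icube c s, dindex c s j.1 x = j.2 ∧ IsStop j.1 x ∧ ∀ k < j.1, ¬ IsStop k x
  let P : ℕ × (Fin n → ℤ) → EuclideanSpace ℝ (Fin n) × ℝ := fun j =>
    if sel j then (dcorner c s j.1 j.2, s / 2 ^ j.1) else (c, 0)
  have hP0 : ∀ j, ¬ sel j → icube (P j).1 (P j).2 = ∅ := by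
    intro j hj; simp only [P, if_neg hj]; exact icube_zero hn c
  have hP1 : ∀ j x, sel j → dindex c s j.1 x = j.2 →
      icube (P j).1 (P j).2 = dcube c s j.1 x := by
    intro j x hj hx; simp only [P, if_pos hj, dcube, hx]
  have hroot : ∀ k x, x ∈ icube c s → dcube c s k x ⊆ icube c s := by
    intro k x hx y hy
    rw [← dindex_zero c hs] at hx ⊢
    rw [← hx]
    exact dindex_eq_of_le c s (Nat.zero_le k) ((mem_dcube c hs k x y).1 hy)
  refine ⟨P, ?_, ?_, ?_, ?_, ?_, ?_⟩
  · intro j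
    simp only [P]
    split_ifs
    · positivity
    · exact le_rfl
  · intro j
    by_cases hj : sel j
    · obtain ⟨x, hx, hxj, -, -⟩ := id hj
      rw [hP1 j x hj hxj]; exact hroot _ _ hx
    · rw [hP0 j hj]; exact Set.empty_subset _
  · -- two selected cubes with a common point are the first stopping cubes of that point
    intro j l hjl
    simp only [Function.onFun]
    by_cases hj : sel j
    swap
    · rw [hP0 j hj]; exact Set.empty_disjoint _
    by_cases hl : sel l
    swap
    · rw [hP0 l hl]; exact Set.disjoint_empty _
    rw [Set.disjoint_left]
    intro z hzj hzl
    apply hjl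
    have key : ∀ j, sel j → z ∈ icube (P j).1 (P j).2 →
        dindex c s j.1 z = j.2 ∧ IsStop j.1 z ∧ ∀ k < j.1, ¬ IsStop k z := by
      intro j hj hz
      obtain ⟨x, hx, hxj, h1, h2⟩ := id hj
      rw [hP1 j x hj hxj, mem_dcube c hs] at hz
      refine ⟨hz.trans hxj, ?_, fun k hk => ?_⟩
      · simp only [IsStop, hdc hz]; exact h1
      · simp only [IsStop, hdc (dindex_eq_of_le c s hk.le hz)]; exact h2 k hk
    obtain ⟨a1, a2, a3⟩ := key j hj hzj
    obtain ⟨b1, b2, b3⟩ := key l hl hzl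
    have e : j.1 = l.1 := by
      rcases lt_trichotomy j.1 l.1 with h | h | h
      · exact absurd a2 (b3 _ h)
      · exact h
      · exact absurd b2 (a3 _ h)
    refine Prod.ext e ?_
    rw [← a1, ← b1, e]
  · intro j
    by_cases hj : sel j
    · obtain ⟨x, hx, hxj, h1, -⟩ := id hj
      rw [hP1 j x hj hxj]; exact h1.le
    · rw [hP0 j hj]; simp
  · intro j
    by_cases hj : sel j
    · obtain ⟨x, hx, hxj, h1, h2⟩ := id hj
      rw [hP1 j x hj hxj]
      rcases hk : j.1 with _ | k
      · exfalso
        rw [hk] at h1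
        have : dcube c s 0 x = icube c s := by
          ext y
          rw [mem_dcube c hs, (dindex_zero c hs x).2 hx, dindex_zero c hs]
        simp only [IsStop, this] at h1
        exact absurd ht (not_le.2 h1)
      · have h3 := h2 k (by omega)
        simp only [IsStop, not_lt] at h3
        rw [volume_dcube_succ c s k x x] at h3
        calc ∫⁻ y in dcube c s (k + 1) x, h y ≤ ∫⁻ y in dcube c s k x, h y := by
              apply lintegral_mono_set
              intro y hy
              rw [mem_dcube c hs] at hy ⊢
              exact dindex_eq_of_le c s (Nat.le_succ k) hy
          _ ≤ _ := h3
          _ = _ := by ring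
    · rw [hP0 j hj]; simp
  · have := ae_tendsto_dcube_average c hs (hm.indicator (measurableSet_icube c s))
      (by rwa [lintegral_indicator (measurableSet_icube c s)])
    filter_upwards [this] with x hx hxQ hxP
    rw [Set.indicator_of_mem hxQ] at hx
    refine le_of_tendsto hx (Eventually.of_forall fun k => ?_)
    have hns : ¬ IsStop k x := by
      intro hk
      have hex : ∃ k, IsStop k x := ⟨k, hk⟩
      have hsel : sel (Nat.find hex, dindex c s (Nat.find hex) x) :=
        ⟨x, hxQ, rfl, Nat.find_spec hex, fun k hk => Nat.find_min hex hk⟩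
      apply hxP _
      · rw [hP1 _ x hsel rfl, mem_dcube c hs]
    simp only [IsStop, not_lt] at hns
    refine ENNReal.div_le_of_le_mul ?_
    refine le_trans (lintegral_mono fun y => ?_) hns
    exact Set.indicator_le_self _ _ _

/-! ### Sums over trees of sets and the Carleson embedding -/

/-- The sum of `φ` over the nodes of depth at most `d` below `a`, in the tree in which the node `a`
has the children `ch a j`. -/
noncomputable def treeSum {α ι : Type*} (ch : α → ι → α) (φ : α → ℝ≥0∞) : ℕ → α → ℝ≥0∞
  | 0, a => φ a
  | d + 1, a => φ a + ∑' j, treeSum ch φ d (ch a j)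

/-- `φ a' ≤ b` on the set of each node `a'` of depth at most `d` below `a`. -/
def TreeLE {α ι X : Type*} (ch : α → ι → α) (S : α → Set X) (φ : α → ℝ≥0∞) (b : X → ℝ≥0∞) :
    ℕ → α → Prop
  | 0, a => ∀ x ∈ S a, φ a ≤ b x
  | d + 1, a => (∀ x ∈ S a, φ a ≤ b x) ∧ ∀ j, TreeLE ch S φ b d (ch a j)

section Tree

variable {α ι X : Type*} {ch : α → ι → α}

lemma treeSum_mono {φ ψ : α → ℝ≥0∞} (h : ∀ a, φ a ≤ ψ a) (d : ℕ) (a : α) :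
    treeSum ch φ d a ≤ treeSum ch ψ d a := by
  induction d generalizing a with
  | zero => exact h a
  | succ d ih => exact add_le_add (h a) (ENNReal.tsum_le_tsum fun j => ih _)

lemma treeSum_add (φ ψ : α → ℝ≥0∞) (d : ℕ) (a : α) :
    treeSum ch (fun a => φ a + ψ a) d a = treeSum ch φ d a + treeSum ch ψ d a := by
  induction d generalizing a with
  | zero => rfl
  | succ d ih =>
    simp only [treeSum, ih, ENNReal.tsum_add]
    ring

lemma treeSum_const_mul (c : ℝ≥0∞) (φ : α → ℝ≥0∞) (d : ℕ) (a : α) :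
    treeSum ch (fun a => c * φ a) d a = c * treeSum ch φ d a := by
  induction d generalizing a with
  | zero => rfl
  | succ d ih => simp only [treeSum, ih, ENNReal.tsum_mul_left, mul_add]

lemma treeSum_mono_depth (φ : α → ℝ≥0∞) (d : ℕ) (a : α) :
    treeSum ch φ d a ≤ treeSum ch φ (d + 1) a := by
  induction d generalizing a with
  | zero => exact le_self_add
  | succ d ih => exact add_le_add le_rfl (ENNReal.tsum_le_tsum fun j => ih _)

lemma measurable_treeSum [Countable ι] [MeasurableSpace X] {F : α → X → ℝ≥0∞}
    (hF : ∀ a, Measurable (F a)) (d : ℕ) (a : α) :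
    Measurable fun x => treeSum ch (fun a => F a x) d a := by
  induction d generalizing a with
  | zero => exact hF a
  | succ d ih => exact (hF a).add (Measurable.tsum fun j => ih _)

lemma lintegral_treeSum [Countable ι] [MeasurableSpace X] {ν : Measure X} {F : α → X → ℝ≥0∞}
    (hF : ∀ a, Measurable (F a)) (d : ℕ) (a : α) :
    ∫⁻ x, treeSum ch (fun a => F a x) d a ∂ν = treeSum ch (fun a => ∫⁻ x, F a x ∂ν) d a := by
  induction d generalizing a with
  | zero => rfl
  | succ d ih =>
    simp only [treeSum]
    rw [lintegral_add_left (hF a), lintegral_tsum fun j => (measurable_treeSum hF d _).aemeasurable]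
    simp only [ih]

variable {S : α → Set X}

lemma treeSum_eq_zero_of_notMem (hsub : ∀ a j, S (ch a j) ⊆ S a) {F : α → X → ℝ≥0∞}
    (hF : ∀ a, ∀ x ∉ S a, F a x = 0) (d : ℕ) (a : α) {x : X} (hx : x ∉ S a) :
    treeSum ch (fun a => F a x) d a = 0 := by
  induction d generalizing a with
  | zero => exact hF a x hx
  | succ d ih =>
    simp only [treeSum, hF a x hx, zero_add, ENNReal.tsum_eq_zero]
    exact fun j => ih _ fun h => hx (hsub a j h)

/-- At a given point at most one child contributes to a sum over a tree of disjoint sets. -/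
lemma treeSum_succ_cases (hsub : ∀ a j, S (ch a j) ⊆ S a)
    (hdis : ∀ a, Pairwise (Function.onFun Disjoint fun j => S (ch a j))) {F : α → X → ℝ≥0∞}
    (hF : ∀ a, ∀ x ∉ S a, F a x = 0) (d : ℕ) (a : α) (x : X) :
    treeSum ch (fun a => F a x) (d + 1) a = F a x ∨
      ∃ j, x ∈ S (ch a j) ∧ treeSum ch (fun a => F a x) (d + 1) a =
        F a x + treeSum ch (fun a => F a x) d (ch a j) := by
  by_cases h : ∃ j, x ∈ S (ch a j)
  · obtain ⟨j, hj⟩ := h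
    right
    refine ⟨j, hj, ?_⟩
    simp only [treeSum]
    rw [tsum_eq_single j]
    intro i hij
    exact treeSum_eq_zero_of_notMem hsub hF d _
      fun hi => Set.disjoint_left.1 (hdis a hij) hi hj
  · left
    push Not at h
    simp only [treeSum]
    rw [ENNReal.tsum_eq_zero.2 fun j => treeSum_eq_zero_of_notMem hsub hF d _ (h j), add_zero]

lemma treeLE_of_forall {φ : α → ℝ≥0∞} {b : X → ℝ≥0∞} (h : ∀ a, ∀ x ∈ S a, φ a ≤ b x) (d : ℕ)
    (a : α) : TreeLE ch S φ b d a := by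
  induction d generalizing a with
  | zero => exact h a
  | succ d ih => exact ⟨h a, fun j => ih _⟩

lemma tsub_le_tsub_add_tsub_max (u v w : ℝ≥0∞) : w - v ≤ (u - v) + (w - max v u) := by
  rw [tsub_le_iff_right]
  calc w ≤ (w - max v u) + max v u := le_tsub_add
    _ ≤ (w - max v u) + ((u - v) + v) := by
        gcongr
        exact max_le le_add_self le_tsub_add
    _ = _ := by ring

lemma tsub_add_tsub_max_le {u b : ℝ≥0∞} (v : ℝ≥0∞) (h : u ≤ b) :
    (u - v) + (b - max v u) ≤ b - v := by
  rcases le_total v u with hv | hv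
  · rw [max_eq_right hv]
    rcases eq_or_ne v ∞ with rfl | hv'
    · have hu : u = ∞ := top_le_iff.1 hv
      simp [hu]
    refine ENNReal.le_sub_of_add_le_left hv' ?_
    rw [← add_assoc, add_tsub_cancel_of_le hv, add_tsub_cancel_of_le h]
  · rw [max_eq_left hv, tsub_eq_zero_of_le hv, zero_add]

/-- **Carleson embedding theorem**, in truncated form: the truncation level `v` makes an induction
on the depth possible. -/
lemma treeSum_tsub_le [Countable ι] [MeasurableSpace X] {ν : Measure X} {Λ : ℝ≥0∞}
    (hS : ∀ a, MeasurableSet (S a)) (hsub : ∀ a j, S (ch a j) ⊆ S a)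
    (hdis : ∀ a, Pairwise (Function.onFun Disjoint fun j => S (ch a j)))
    (hC : ∀ d a, treeSum ch (fun a => ν (S a)) d a ≤ Λ * ν (S a))
    {φ : α → ℝ≥0∞} {b : X → ℝ≥0∞} (d : ℕ) (a : α) (v : ℝ≥0∞) (hb : TreeLE ch S φ b d a) :
    treeSum ch (fun a => (φ a - v) * ν (S a)) d a ≤ Λ * ∫⁻ x in S a, (b x - v) ∂ν := by
  induction d generalizing a v with
  | zero =>
    calc (φ a - v) * ν (S a) ≤ (φ a - v) * (Λ * ν (S a)) := by gcongr; exact hC 0 a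
      _ = Λ * ∫⁻ x in S a, (φ a - v) ∂ν := by rw [setLIntegral_const]; ring
      _ ≤ _ := by
        gcongr 1
        exact setLIntegral_mono' (hS a) fun x hx => tsub_le_tsub_right (hb x hx) v
  | succ d ih =>
    -- the part of `φ` between the levels `v` and `φ a` is paid for by the Carleson condition at
    -- `a`; what exceeds `m` is left to the children
    set m := max v (φ a) with hm
    calc treeSum ch (fun a => (φ a - v) * ν (S a)) (d + 1) a
        ≤ (φ a - v) * treeSum ch (fun a => ν (S a)) (d + 1) a +
          ∑' j, treeSum ch (fun a => (φ a - m) * ν (S a)) d (ch a j) := by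
          simp only [treeSum]
          rw [mul_add, add_assoc]
          gcongr
          rw [← ENNReal.tsum_mul_left, ← ENNReal.tsum_add]
          refine ENNReal.tsum_le_tsum fun j => ?_
          rw [← treeSum_const_mul, ← treeSum_add]
          refine treeSum_mono (fun a' => ?_) d _
          rw [← add_mul]
          gcongr
          exact tsub_le_tsub_add_tsub_max _ _ _
      _ ≤ (φ a - v) * (Λ * ν (S a)) + ∑' j, Λ * ∫⁻ x in S (ch a j), (b x - m) ∂ν := by
          gcongr with j
          · exact hC _ _
          · exact ih _ _ (hb.2 j)
      _ = Λ * (∫⁻ x in S a, (φ a - v) ∂ν + ∫⁻ x in ⋃ j, S (ch a j), (b x - m) ∂ν) := by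
          rw [ENNReal.tsum_mul_left, lintegral_iUnion (fun j => hS _) (hdis a),
            setLIntegral_const]
          ring
      _ ≤ Λ * (∫⁻ x in S a, (φ a - v) ∂ν + ∫⁻ x in S a, (b x - m) ∂ν) := by
          gcongr
          exact Set.iUnion_subset (hsub a)
      _ = Λ * ∫⁻ x in S a, ((φ a - v) + (b x - m)) ∂ν := by
          rw [lintegral_add_left measurable_const]
      _ ≤ _ := by
          gcongr 1
          exact setLIntegral_mono' (hS a) fun x hx => tsub_add_tsub_max_le v (hb.1 x hx)

lemma treeSum_mul_measure_le [Countable ι] [MeasurableSpace X] {ν : Measure X} {Λ : ℝ≥0∞}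
    (hS : ∀ a, MeasurableSet (S a)) (hsub : ∀ a j, S (ch a j) ⊆ S a)
    (hdis : ∀ a, Pairwise (Function.onFun Disjoint fun j => S (ch a j)))
    (hC : ∀ d a, treeSum ch (fun a => ν (S a)) d a ≤ Λ * ν (S a))
    {φ : α → ℝ≥0∞} {b : X → ℝ≥0∞} (d : ℕ) (a : α) (hb : TreeLE ch S φ b d a) :
    treeSum ch (fun a => φ a * ν (S a)) d a ≤ Λ * ∫⁻ x in S a, b x ∂ν := by
  simpa using treeSum_tsub_le hS hsub hdis hC d a 0 hb

/-- The sum of `φ a'` over the nodes `a'` of depth at most `d` below `a` whose set contains `x`. -/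
noncomputable def treeFun (ch : α → ι → α) (S : α → Set X) (φ : α → ℝ≥0∞) (d : ℕ) (a : α)
    (x : X) : ℝ≥0∞ :=
  treeSum ch (fun a => (S a).indicator (fun _ => φ a) x) d a

lemma measurable_treeFun [Countable ι] [MeasurableSpace X] (hS : ∀ a, MeasurableSet (S a))
    (φ : α → ℝ≥0∞) (d : ℕ) (a : α) : Measurable (treeFun ch S φ d a) :=
  measurable_treeSum (F := fun a => (S a).indicator fun _ => φ a)
    (fun a => measurable_const.indicator (hS a)) d a

lemma treeFun_succ_cases (hsub : ∀ a j, S (ch a j) ⊆ S a)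
    (hdis : ∀ a, Pairwise (Function.onFun Disjoint fun j => S (ch a j))) (φ : α → ℝ≥0∞)
    (d : ℕ) (a : α) {x : X} (hx : x ∈ S a) :
    treeFun ch S φ (d + 1) a x = φ a ∨
      ∃ j, x ∈ S (ch a j) ∧ treeFun ch S φ (d + 1) a x = φ a + treeFun ch S φ d (ch a j) x := by
  have := treeSum_succ_cases hsub hdis (F := fun a => (S a).indicator fun _ => φ a)
    (fun a x hx => Set.indicator_of_notMem hx _) d a x
  rw [Set.indicator_of_mem hx] at this
  exact this

lemma treeFun_of_mem_child (hsub : ∀ a j, S (ch a j) ⊆ S a)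
    (φ : α → ℝ≥0∞) (d : ℕ) (a : α) {x : X} {j : ι} (hj : x ∈ S (ch a j)) :
    φ a + treeFun ch S φ d (ch a j) x ≤ treeFun ch S φ (d + 1) a x := by
  simp only [treeFun, treeSum]
  rw [Set.indicator_of_mem (hsub a j hj)]
  gcongr
  exact ENNReal.le_tsum (f := fun j => treeSum ch
    (fun a => (S a).indicator (fun _ => φ a) x) d (ch a j)) j

lemma treeFun_le (hsub : ∀ a j, S (ch a j) ⊆ S a)
    (hdis : ∀ a, Pairwise (Function.onFun Disjoint fun j => S (ch a j))) {φ : α → ℝ≥0∞}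
    {G : X → ℝ≥0∞} (hG : ∀ a, ∀ x ∈ S a, φ a ≤ G x) (d : ℕ) (a : α) {x : X} (hx : x ∈ S a) :
    treeFun ch S φ d a x ≤ (d + 1 : ℕ) * G x := by
  induction d generalizing a with
  | zero =>
    simp only [treeFun, treeSum, Set.indicator_of_mem hx]
    simpa using hG a x hx
  | succ d ih =>
    have h1 := hG a x hx
    rcases treeFun_succ_cases hsub hdis φ d a hx with h | ⟨j, hj, h⟩
    · rw [h]
      calc φ a ≤ 1 * G x := by simpa using h1
        _ ≤ _ := by
          gcongr
          exact_mod_cast Nat.succ_le_succ (Nat.zero_le _)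
    · rw [h]
      calc φ a + treeFun ch S φ d (ch a j) x ≤ G x + (d + 1 : ℕ) * G x := add_le_add h1 (ih _ hj)
        _ = _ := by push_cast; ring

lemma add_rpow_le_rpow_add_real {p : ℝ} (hp : 1 ≤ p) {v a : ℝ} (hv : 0 ≤ v) (ha : 0 ≤ a) :
    (v + a) ^ p ≤ v ^ p + p * (a * (v + a) ^ (p - 1)) := by
  have hp0 : 0 < p := by linarith
  rcases eq_or_lt_of_le (add_nonneg hv ha) with h0 | h0
  · have hv : v = 0 := by linarith
    have ha : a = 0 := by linarith
    rw [hv, ha]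
    simp [Real.zero_rpow hp0.ne']
  · -- Bernoulli's inequality for `v / (v + a) = 1 - a / (v + a)`
    have hle : -1 ≤ -(a / (v + a)) := by
      rw [neg_le_neg_iff, div_le_one h0]
      linarith
    have hb := one_add_mul_self_le_rpow_one_add hle hp
    have e : 1 + -(a / (v + a)) = v / (v + a) := by field_simp; ring
    rw [e, Real.div_rpow hv h0.le, le_div_iff₀ (by positivity)] at hb
    have e2 : (v + a) ^ p = (v + a) * (v + a) ^ (p - 1) := by
      rw [← Real.rpow_one_add' h0.le (by linarith)]
      ring_nf
    have e3 : (1 + p * -(a / (v + a))) * (v + a) ^ p =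
        (v + a) ^ p - p * (a * (v + a) ^ (p - 1)) := by
      rw [e2]; field_simp; ring
    linarith

/-- Comparison of increments of `u ↦ u ^ p` with the derivative at the right end. -/
lemma add_rpow_le_rpow_add {p : ℝ} (hp : 1 ≤ p) (v a : ℝ≥0∞) :
    (v + a) ^ p ≤ v ^ p + ENNReal.ofReal p * (a * (v + a) ^ (p - 1)) := by
  have hp0 : 0 < p := by linarith
  rcases eq_or_ne v ∞ with rfl | hv
  · simp [ENNReal.top_rpow_of_pos hp0]
  rcases eq_or_ne a ∞ with rfl | ha
  · rcases hp.eq_or_lt with rfl | hp1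
    · simp
    · simp [ENNReal.top_rpow_of_pos hp0, ENNReal.top_rpow_of_pos (sub_pos.2 hp1), hp0]
  rw [← ENNReal.ofReal_toReal hv, ← ENNReal.ofReal_toReal ha]
  have hv0 : 0 ≤ v.toReal := ENNReal.toReal_nonneg
  have ha0 : 0 ≤ a.toReal := ENNReal.toReal_nonneg
  have := ENNReal.ofReal_le_ofReal (add_rpow_le_rpow_add_real hp hv0 ha0)
  rwa [ENNReal.ofReal_add (by positivity) (by positivity), ENNReal.ofReal_mul hp0.le,
    ENNReal.ofReal_mul ha0, ← ENNReal.ofReal_rpow_of_nonneg (by positivity) hp0.le,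
    ← ENNReal.ofReal_rpow_of_nonneg (by positivity) hp0.le,
    ← ENNReal.ofReal_rpow_of_nonneg (by positivity) (by linarith),
    ENNReal.ofReal_add hv0 ha0] at this

/-- The tree whose nodes also record the sum of `φ` over the strict ancestors. -/
def accChild (ch : α → ι → α) (φ : α → ℝ≥0∞) (u : α × ℝ≥0∞) (j : ι) : α × ℝ≥0∞ :=
  (ch u.1 j, u.2 + φ u.1)

lemma treeSum_accChild (φ ψ : α → ℝ≥0∞) (d : ℕ) (u : α × ℝ≥0∞) :
    treeSum (accChild ch φ) (fun u => ψ u.1) d u = treeSum ch ψ d u.1 := by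
  induction d generalizing u with
  | zero => rfl
  | succ d ih => simp only [treeSum, ih, accChild]

/-- Summation by parts along the branch of nodes that contain `x`: the power of a sum is controlled
by the sum over the nodes of `p` times the value there times the `(p - 1)`-st power of the partial sum
down to that node. -/
lemma rpow_treeFun_le (hsub : ∀ a j, S (ch a j) ⊆ S a)
    (hdis : ∀ a, Pairwise (Function.onFun Disjoint fun j => S (ch a j))) {φ : α → ℝ≥0∞}
    {p : ℝ} (hp : 1 ≤ p) (d : ℕ) (a : α) (v : ℝ≥0∞) {x : X} (hx : x ∈ S a) :
    (v + treeFun ch S φ d a x) ^ p ≤ v ^ p + ENNReal.ofReal p *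
      treeFun (accChild ch φ) (fun u => S u.1) (fun u => φ u.1 * (u.2 + φ u.1) ^ (p - 1)) d
        (a, v) x := by
  induction d generalizing a v with
  | zero =>
    simp only [treeFun, treeSum, Set.indicator_of_mem hx]
    exact add_rpow_le_rpow_add hp v (φ a)
  | succ d ih =>
    rcases treeFun_succ_cases hsub hdis φ d a hx with h | ⟨j, hj, h⟩
    · rw [h]
      refine (add_rpow_le_rpow_add hp v (φ a)).trans ?_
      gcongr
      simp only [treeFun, treeSum, Set.indicator_of_mem hx]
      exact le_self_add
    · rw [h, ← add_assoc]
      refine (ih (ch a j) (v + φ a) hj).trans ?_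
      refine (add_le_add_left (add_rpow_le_rpow_add hp v (φ a)) _).trans ?_
      rw [add_assoc, ← mul_add]
      gcongr
      exact treeFun_of_mem_child (ch := accChild ch φ) (S := fun u => S u.1)
        (φ := fun u => φ u.1 * (u.2 + φ u.1) ^ (p - 1)) (fun u j => hsub u.1 j) d (a, v) hj

/-- The terms in the summation by parts are bounded on their sets by `G * B ^ (p - 1)` whenever `B`
bounds the tree sum. -/
lemma treeLE_accChild (hsub : ∀ a j, S (ch a j) ⊆ S a) {φ : α → ℝ≥0∞}
    {G B : X → ℝ≥0∞} (hG : ∀ a, ∀ x ∈ S a, φ a ≤ G x) {p : ℝ} (hp : 1 ≤ p) (d : ℕ)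
    (a : α) (v : ℝ≥0∞) (hB : ∀ x ∈ S a, v + treeFun ch S φ d a x ≤ B x) :
    TreeLE (accChild ch φ) (fun u => S u.1) (fun u => φ u.1 * (u.2 + φ u.1) ^ (p - 1))
      (fun x => G x * B x ^ (p - 1)) d (a, v) := by
  have hroot : ∀ x ∈ S a, v + φ a ≤ B x := by
    intro x hx
    refine le_trans ?_ (hB x hx)
    gcongr
    cases d with
    | zero => simp only [treeFun, treeSum, Set.indicator_of_mem hx]; exact le_rfl
    | succ d => simp only [treeFun, treeSum, Set.indicator_of_mem hx]; exact le_self_add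
  have hr : ∀ x ∈ S a, φ a * (v + φ a) ^ (p - 1) ≤ G x * B x ^ (p - 1) := by
    intro x hx
    exact mul_le_mul' (hG a x hx) (ENNReal.rpow_le_rpow (hroot x hx) (by linarith))
  induction d generalizing a v with
  | zero => exact hr
  | succ d ih =>
    have hB' : ∀ j, ∀ x ∈ S (ch a j), v + φ a + treeFun ch S φ d (ch a j) x ≤ B x := by
      intro j x hx
      rw [add_assoc]
      exact (add_le_add_right (treeFun_of_mem_child hsub φ d a hx) v).trans (hB x (hsub a j hx))
    have hroot' : ∀ j, ∀ x ∈ S (ch a j), v + φ a + φ (ch a j) ≤ B x := by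
      intro j x hx
      refine le_trans ?_ (hB' j x hx)
      gcongr
      cases d with
      | zero => simp only [treeFun, treeSum, Set.indicator_of_mem hx]; exact le_rfl
      | succ d => simp only [treeFun, treeSum, Set.indicator_of_mem hx]; exact le_self_add
    refine ⟨hr, fun j => ih (ch a j) (v + φ a) (hB' j) (hroot' j) ?_⟩
    intro x hx
    exact mul_le_mul' (hG _ x hx) (ENNReal.rpow_le_rpow (hroot' j x hx) (by linarith))

/-- The `L^p` inequality for tree sums, `p ≤ 1`. Since `φ ≤ G` on the sets, the embedding theorem
applied to `φ ^ p ≤ G ^ p` bounds `∫ A * G ^ (p - 1)`, and Hölder's inequality removes the weight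
`G ^ (p - 1)` without loss as `p → 0`. -/
lemma lintegral_treeFun_rpow_le_of_le_one [Countable ι] [MeasurableSpace X] {ν : Measure X}
    {Λ : ℝ≥0∞} (hS : ∀ a, MeasurableSet (S a)) (hsub : ∀ a j, S (ch a j) ⊆ S a)
    (hdis : ∀ a, Pairwise (Function.onFun Disjoint fun j => S (ch a j)))
    (hC : ∀ d a, treeSum ch (fun a => ν (S a)) d a ≤ Λ * ν (S a))
    {φ : α → ℝ≥0∞} {G : X → ℝ≥0∞} (hGm : Measurable G) (hG : ∀ a, ∀ x ∈ S a, φ a ≤ G x)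
    {p : ℝ} (hp : 0 < p) (hp1 : p ≤ 1) (d : ℕ) (a : α)
    (hX0 : ∫⁻ x in S a, G x ^ p ∂ν ≠ 0) (hX : ∫⁻ x in S a, G x ^ p ∂ν ≠ ∞) :
    ∫⁻ x in S a, treeFun ch S φ d a x ^ p ∂ν ≤ Λ ^ p * ∫⁻ x in S a, G x ^ p ∂ν := by
  set A := treeFun ch S φ d a with hA
  have hAm : Measurable A := measurable_treeFun hS φ d a
  have hbound : ∫⁻ x in S a, A x * G x ^ (p - 1) ∂ν ≤ Λ * ∫⁻ x in S a, G x ^ p ∂ν := by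
    calc ∫⁻ x in S a, A x * G x ^ (p - 1) ∂ν ≤ ∫⁻ x, A x * G x ^ (p - 1) ∂ν :=
          setLIntegral_le_lintegral _ _
      _ = ∫⁻ x, treeSum ch (fun a => (S a).indicator (fun x => φ a * G x ^ (p - 1)) x) d a ∂ν := by
          refine lintegral_congr fun x => ?_
          simp only [hA, treeFun]
          rw [mul_comm, ← treeSum_const_mul]
          congr 1
          ext a'
          by_cases hx : x ∈ S a'
          · simp only [Set.indicator_of_mem hx, mul_comm]
          · simp only [Set.indicator_of_notMem hx, mul_zero]
      _ = treeSum ch (fun a => ∫⁻ x in S a, φ a * G x ^ (p - 1) ∂ν) d a := by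
          rw [lintegral_treeSum fun a => ((hGm.pow_const _).const_mul _).indicator (hS a)]
          simp only [lintegral_indicator (hS _)]
      _ ≤ treeSum ch (fun a => φ a ^ p * ν (S a)) d a := by
          refine treeSum_mono (fun a => ?_) d a
          rw [← setLIntegral_const]
          refine setLIntegral_mono' (hS a) fun x hx => ?_
          have hle := hG a x hx
          rcases eq_or_ne (φ a) 0 with h0 | h0
          · simp [h0]
          rcases hp1.eq_or_lt with rfl | hp1'
          · simp
          rcases eq_or_ne (φ a) ∞ with h1 | h1
          · have : G x = ∞ := by rw [h1] at hle; exact top_le_iff.1 hle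
            simp [this, ENNReal.top_rpow_of_neg (show p - 1 < 0 by linarith)]
          calc φ a * G x ^ (p - 1) ≤ φ a * φ a ^ (p - 1) := by
                gcongr 1
                rw [show p - 1 = -(1 - p) by ring, ENNReal.rpow_neg, ENNReal.rpow_neg,
                  ENNReal.inv_le_inv]
                exact ENNReal.rpow_le_rpow hle (by linarith)
            _ = φ a ^ p := by
                conv_lhs => enter [1]; rw [← ENNReal.rpow_one (φ a)]
                rw [← ENNReal.rpow_add _ _ h0 h1]
                ring_nf
      _ ≤ Λ * ∫⁻ x in S a, G x ^ p ∂ν :=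
          treeSum_mul_measure_le hS hsub hdis hC d a (treeLE_of_forall (fun a x hx =>
            ENNReal.rpow_le_rpow (hG a x hx) hp.le) d a)
  have hGfin : ∀ᵐ x ∂ν.restrict (S a), G x ≠ ∞ := by
    filter_upwards [ae_lt_top (hGm.pow_const p) hX] with x hx h
    simp [h, ENNReal.top_rpow_of_pos hp] at hx
  calc ∫⁻ x in S a, A x ^ p ∂ν
      ≤ ∫⁻ x in S a, (A x * G x ^ (p - 1)) ^ p * (G x ^ p) ^ (1 - p) ∂ν := by
        refine lintegral_mono_ae ?_
        filter_upwards [hGfin, ae_restrict_mem (hS a)] with x hx hxa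
        rcases eq_or_ne (G x) 0 with h0 | h0
        · have := treeFun_le hsub hdis hG d a hxa
          rw [h0, mul_zero] at this
          rw [hA, le_zero_iff.1 this, ENNReal.zero_rpow_of_pos hp]
          exact zero_le
        · rw [ENNReal.mul_rpow_of_nonneg _ _ hp.le, mul_assoc, ← ENNReal.rpow_mul,
            ← ENNReal.rpow_mul, ← ENNReal.rpow_add _ _ h0 hx,
            show (p - 1) * p + p * (1 - p) = 0 by ring]
          simp
    _ ≤ (∫⁻ x in S a, A x * G x ^ (p - 1) ∂ν) ^ p * (∫⁻ x in S a, G x ^ p ∂ν) ^ (1 - p) :=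
        ENNReal.lintegral_mul_norm_pow_le (hAm.mul (hGm.pow_const _)).aemeasurable
          (hGm.pow_const _).aemeasurable hp.le (by linarith) (by ring)
    _ ≤ (Λ * ∫⁻ x in S a, G x ^ p ∂ν) ^ p * (∫⁻ x in S a, G x ^ p ∂ν) ^ (1 - p) := by gcongr
    _ = Λ ^ p * ∫⁻ x in S a, G x ^ p ∂ν := by
        rw [ENNReal.mul_rpow_of_nonneg _ _ hp.le, mul_assoc, ← ENNReal.rpow_add _ _ hX0 hX]
        simp

/-- The `L^p` inequality for tree sums, `1 ≤ p`: summation by parts, the embedding theorem and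
Hölder's inequality give `∫ A ^ p ≤ p * Λ * ∫ G * A ^ (p - 1) ≤ p * Λ * ‖G‖ * ‖A‖ ^ (p - 1)`. -/
lemma lintegral_treeFun_rpow_le_of_one_le [Countable ι] [MeasurableSpace X] {ν : Measure X}
    {Λ : ℝ≥0∞} (hS : ∀ a, MeasurableSet (S a)) (hsub : ∀ a j, S (ch a j) ⊆ S a)
    (hdis : ∀ a, Pairwise (Function.onFun Disjoint fun j => S (ch a j)))
    (hC : ∀ d a, treeSum ch (fun a => ν (S a)) d a ≤ Λ * ν (S a))
    {φ : α → ℝ≥0∞} {G : X → ℝ≥0∞} (hGm : Measurable G) (hG : ∀ a, ∀ x ∈ S a, φ a ≤ G x)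
    {p : ℝ} (hp : 1 ≤ p) (d : ℕ) (a : α) (hX : ∫⁻ x in S a, G x ^ p ∂ν ≠ ∞) :
    ∫⁻ x in S a, treeFun ch S φ d a x ^ p ∂ν ≤
      (ENNReal.ofReal p * Λ) ^ p * ∫⁻ x in S a, G x ^ p ∂ν := by
  have hp0 : 0 < p := by linarith
  set A := treeFun ch S φ d a with hA
  have hAm : Measurable A := measurable_treeFun hS φ d a
  set Y := ∫⁻ x in S a, A x ^ p ∂ν with hY
  -- finiteness of `Y` allows the division by `Y ^ (1 - 1 / p)` below
  have hYtop : Y ≠ ∞ := by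
    refine ne_top_of_le_ne_top (b := ((d + 1 : ℕ) : ℝ≥0∞) ^ p * ∫⁻ x in S a, G x ^ p ∂ν) ?_ ?_
    · exact ENNReal.mul_ne_top (ENNReal.rpow_ne_top_of_nonneg hp0.le (ENNReal.natCast_ne_top _)) hX
    · rw [← lintegral_const_mul _ (hGm.pow_const p)]
      refine setLIntegral_mono' (hS a) fun x hx => ?_
      rw [← ENNReal.mul_rpow_of_nonneg _ _ hp0.le]
      exact ENNReal.rpow_le_rpow (treeFun_le hsub hdis hG d a hx) hp0.le
  have h1 : Y ≤ ENNReal.ofReal p * (Λ * ∫⁻ x in S a, G x * A x ^ (p - 1) ∂ν) := by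
    calc Y ≤ ∫⁻ x in S a, ENNReal.ofReal p * treeFun (accChild ch φ) (fun u => S u.1)
            (fun u => φ u.1 * (u.2 + φ u.1) ^ (p - 1)) d (a, 0) x ∂ν := by
          refine setLIntegral_mono' (hS a) fun x hx => ?_
          have := rpow_treeFun_le hsub hdis (φ := φ) hp d a 0 hx
          simpa [ENNReal.zero_rpow_of_pos hp0] using this
      _ ≤ ENNReal.ofReal p * ∫⁻ x, treeFun (accChild ch φ) (fun u => S u.1)
            (fun u => φ u.1 * (u.2 + φ u.1) ^ (p - 1)) d (a, 0) x ∂ν := by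
          rw [lintegral_const_mul _ (measurable_treeFun (S := fun u : α × ℝ≥0∞ => S u.1)
            (fun u => hS u.1) _ d _)]
          gcongr
          exact Measure.restrict_le_self
      _ = ENNReal.ofReal p * treeSum (accChild ch φ)
            (fun u => φ u.1 * (u.2 + φ u.1) ^ (p - 1) * ν (S u.1)) d (a, 0) := by
          congr 1
          simp only [treeFun]
          rw [lintegral_treeSum (F := fun u : α × ℝ≥0∞ => (S u.1).indicator
            fun _ => φ u.1 * (u.2 + φ u.1) ^ (p - 1))
            fun u => measurable_const.indicator (hS u.1)]
          simp only [lintegral_indicator (hS _), setLIntegral_const]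
      _ ≤ _ := by
          gcongr
          refine treeSum_mul_measure_le (S := fun u : α × ℝ≥0∞ => S u.1) (fun u => hS u.1)
            (fun u j => hsub u.1 j) (fun u => hdis u.1) ?_ d (a, 0) ?_
          · intro d u
            rw [treeSum_accChild φ (fun a => ν (S a))]
            exact hC d u.1
          · exact treeLE_accChild hsub hG hp d a 0 fun x _ => by simp [hA]
  have h2 : ∫⁻ x in S a, G x * A x ^ (p - 1) ∂ν ≤
      (∫⁻ x in S a, G x ^ p ∂ν) ^ (1 / p) * Y ^ (1 - 1 / p) := by
    have h3 : 1 / p ≤ 1 := by rw [div_le_one hp0]; exact hp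
    calc ∫⁻ x in S a, G x * A x ^ (p - 1) ∂ν
        = ∫⁻ x in S a, (G x ^ p) ^ (1 / p) * (A x ^ p) ^ (1 - 1 / p) ∂ν := by
          refine lintegral_congr fun x => ?_
          rw [← ENNReal.rpow_mul, ← ENNReal.rpow_mul, mul_one_div_cancel hp0.ne',
            ENNReal.rpow_one, mul_sub, mul_one_div_cancel hp0.ne', mul_one]
      _ ≤ _ := ENNReal.lintegral_mul_norm_pow_le (hGm.pow_const p).aemeasurable
          (hAm.pow_const p).aemeasurable (by positivity) (by linarith) (by ring)
  rcases eq_or_ne Y 0 with hY0 | hY0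
  · rw [hY0]; exact zero_le
  have h4 : Y ^ (1 / p) ≤ ENNReal.ofReal p * Λ * (∫⁻ x in S a, G x ^ p ∂ν) ^ (1 / p) := by
    have hne : Y ^ (1 - 1 / p) ≠ 0 := by
      simp [ENNReal.rpow_eq_zero_iff, hY0, hYtop]
    have hnt : Y ^ (1 - 1 / p) ≠ ∞ := by
      simp [ENNReal.rpow_eq_top_iff, hY0, hYtop]
    rw [← ENNReal.mul_le_mul_iff_left hne hnt, ← ENNReal.rpow_add _ _ hY0 hYtop]
    rw [show 1 / p + (1 - 1 / p) = 1 by ring, ENNReal.rpow_one]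
    calc Y ≤ _ := h1
      _ ≤ ENNReal.ofReal p * (Λ * ((∫⁻ x in S a, G x ^ p ∂ν) ^ (1 / p) * Y ^ (1 - 1 / p))) := by
          gcongr
      _ = _ := by ring
  calc Y = (Y ^ (1 / p)) ^ p := by
        rw [← ENNReal.rpow_mul, one_div_mul_cancel hp0.ne', ENNReal.rpow_one]
    _ ≤ (ENNReal.ofReal p * Λ * (∫⁻ x in S a, G x ^ p ∂ν) ^ (1 / p)) ^ p := by gcongr
    _ = _ := by
        rw [ENNReal.mul_rpow_of_nonneg _ _ hp0.le, ← ENNReal.rpow_mul,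
          one_div_mul_cancel hp0.ne', ENNReal.rpow_one]

/-- The `L^p` inequality for sums over a tree with Carleson constant `Λ`: the constant is
`max 1 p * Λ` for all `0 < p < ∞`. -/
lemma lintegral_treeFun_rpow_le [Countable ι] [MeasurableSpace X] {ν : Measure X} {Λ : ℝ≥0∞}
    (hS : ∀ a, MeasurableSet (S a)) (hsub : ∀ a j, S (ch a j) ⊆ S a)
    (hdis : ∀ a, Pairwise (Function.onFun Disjoint fun j => S (ch a j)))
    (hC : ∀ d a, treeSum ch (fun a => ν (S a)) d a ≤ Λ * ν (S a))
    {φ : α → ℝ≥0∞} {G : X → ℝ≥0∞} (hGm : Measurable G) (hG : ∀ a, ∀ x ∈ S a, φ a ≤ G x)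
    {p : ℝ} (hp : 0 < p) (d : ℕ) (a : α) :
    ∫⁻ x in S a, treeFun ch S φ d a x ^ p ∂ν ≤
      (ENNReal.ofReal (max 1 p) * Λ) ^ p * ∫⁻ x in S a, G x ^ p ∂ν := by
  rcases eq_or_ne (ν (S a)) 0 with h0 | h0
  · rw [setLIntegral_measure_zero _ _ h0]; exact zero_le
  have hΛ : Λ ≠ 0 := by
    rintro rfl
    have := hC 0 a
    simp only [treeSum, zero_mul, nonpos_iff_eq_zero] at this
    exact h0 this
  rcases eq_or_ne (∫⁻ x in S a, G x ^ p ∂ν) ∞ with hX | hX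
  · rw [hX, ENNReal.mul_top]
    · exact le_top
    · simp [ENNReal.rpow_eq_zero_iff, hΛ, hp, not_lt.2 hp.le]
  rcases eq_or_ne (∫⁻ x in S a, G x ^ p ∂ν) 0 with hX0 | hX0
  · rw [hX0, mul_zero, nonpos_iff_eq_zero]
    rw [lintegral_eq_zero_iff (hGm.pow_const p)] at hX0
    rw [lintegral_eq_zero_iff ((measurable_treeFun hS φ d a).pow_const p)]
    filter_upwards [hX0, ae_restrict_mem (hS a)] with x hx hxa
    have hGx : G x = 0 := by
      simpa [ENNReal.rpow_eq_zero_iff, hp, not_lt.2 hp.le] using hx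
    have := treeFun_le hsub hdis hG d a hxa
    rw [hGx, mul_zero, nonpos_iff_eq_zero] at this
    simp [this, hp]
  rcases le_total p 1 with hp1 | hp1
  · rw [max_eq_left hp1]
    simpa using lintegral_treeFun_rpow_le_of_le_one hS hsub hdis hC hGm hG hp hp1 d a hX0 hX
  · rw [max_eq_right hp1]
    exact lintegral_treeFun_rpow_le_of_one_le hS hsub hdis hC hGm hG hp1 d a hX

end Tree

/-! ### The maximal function -/

lemma cubeAvg_le_maximal {n : ℕ} (g : EuclideanSpace ℝ (Fin n) → ℝ≥0∞)
    {a x : EuclideanSpace ℝ (Fin n)} {r : ℝ} (hr : 0 < r) (hx : x ∈ cube a r) :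
    cubeAvg g a r ≤ maximal g x :=
  le_iSup_of_le a (le_iSup_of_le r (le_iSup_of_le hr (le_iSup_of_le hx le_rfl)))

lemma lt_maximal_iff {n : ℕ} {g : EuclideanSpace ℝ (Fin n) → ℝ≥0∞}
    {x : EuclideanSpace ℝ (Fin n)} {t : ℝ≥0∞} :
    t < maximal g x ↔ ∃ a r, 0 < r ∧ x ∈ cube a r ∧ t < cubeAvg g a r := by
  simp only [maximal, lt_iSup_iff, exists_prop]

lemma maximal_le_iff {n : ℕ} {g : EuclideanSpace ℝ (Fin n) → ℝ≥0∞}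
    {x : EuclideanSpace ℝ (Fin n)} {t : ℝ≥0∞} :
    maximal g x ≤ t ↔ ∀ a r, 0 < r → x ∈ cube a r → cubeAvg g a r ≤ t := by
  simp only [maximal, iSup_le_iff]

lemma maximal_mono {n : ℕ} {g h : EuclideanSpace ℝ (Fin n) → ℝ≥0∞} (hgh : ∀ x, g x ≤ h x)
    (x : EuclideanSpace ℝ (Fin n)) : maximal g x ≤ maximal h x := by
  rw [maximal_le_iff]
  intro a r hr hx
  refine le_trans ?_ (cubeAvg_le_maximal h hr hx)
  exact ENNReal.div_le_div_right (lintegral_mono hgh) _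

lemma lt_cubeAvg_iff {n : ℕ} {g : EuclideanSpace ℝ (Fin n) → ℝ≥0∞}
    {a : EuclideanSpace ℝ (Fin n)} {r : ℝ} (hr : 0 < r) {t : ℝ≥0∞} :
    t < cubeAvg g a r ↔ t * volume (cube a r) < ∫⁻ y in cube a r, g y := by
  rw [cubeAvg, ENNReal.lt_div_iff_mul_lt (Or.inl (volume_cube_ne_zero a hr))
    (Or.inl (volume_cube_ne_top a r))]

lemma cubeAvg_le_iff {n : ℕ} {g : EuclideanSpace ℝ (Fin n) → ℝ≥0∞}
    {a : EuclideanSpace ℝ (Fin n)} {r : ℝ} (hr : 0 < r) {t : ℝ≥0∞} :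
    cubeAvg g a r ≤ t ↔ ∫⁻ y in cube a r, g y ≤ t * volume (cube a r) := by
  rw [← not_lt, lt_cubeAvg_iff hr, not_lt]

lemma cube_mono {n : ℕ} (a : EuclideanSpace ℝ (Fin n)) {r s : ℝ} (h : r ≤ s) :
    cube a r ⊆ cube a s := fun _ hx i => (hx i).trans h

/-- A cube can be enlarged slightly without spoiling a lower bound for the average, so the maximal
function over closed cubes is lower semicontinuous. -/
lemma lowerSemicontinuous_maximal {n : ℕ} (g : EuclideanSpace ℝ (Fin n) → ℝ≥0∞) :
    LowerSemicontinuous (maximal g) := by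
  intro x t ht
  obtain ⟨a, r, hr, hx, hlt⟩ := lt_maximal_iff.1 ht
  rw [lt_cubeAvg_iff hr] at hlt
  have hcont : Tendsto (fun s : ℝ => t * volume (cube a s)) (𝓝[>] r)
      (𝓝 (t * volume (cube a r))) := by
    refine ENNReal.Tendsto.const_mul ?_ (Or.inl (volume_cube_ne_zero a hr))
    simp only [volume_cube]
    refine Tendsto.mono_left ?_ nhdsWithin_le_nhds
    exact ((ENNReal.continuous_pow n).comp
      (ENNReal.continuous_ofReal.comp (continuous_const.mul continuous_id))).tendsto r
  obtain ⟨s, hs, hrs⟩ := ((hcont.eventually (gt_mem_nhds hlt)).and self_mem_nhdsWithin).exists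
  have hrs : r < s := hrs
  filter_upwards [Metric.ball_mem_nhds x (sub_pos.2 hrs)] with y hy
  refine lt_maximal_iff.2 ⟨a, s, hr.trans hrs, fun i => ?_, ?_⟩
  · have h1 := closedBall_subset_cube x _ (Metric.ball_subset_closedBall hy) i
    have h2 := hx i
    calc |y i - a i| = |(y i - x i) + (x i - a i)| := by ring_nf
      _ ≤ |y i - x i| + |x i - a i| := abs_add_le _ _
      _ ≤ s := by linarith
  · rw [lt_cubeAvg_iff (hr.trans hrs)]
    exact hs.trans_le (lintegral_mono_set (cube_mono a hrs.le))

lemma measurable_maximal {n : ℕ} (g : EuclideanSpace ℝ (Fin n) → ℝ≥0∞) :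
    Measurable (maximal g) := (lowerSemicontinuous_maximal g).measurable

lemma cube_eq_preimage_closedBall {n : ℕ} (a : EuclideanSpace ℝ (Fin n)) {r : ℝ} (hr : 0 ≤ r) :
    cube a r = (WithLp.ofLp : EuclideanSpace ℝ (Fin n) → (Fin n → ℝ)) ⁻¹'
      Metric.closedBall (WithLp.ofLp a) r := by
  ext x
  simp only [cube, Set.mem_ofPred_eq, Set.mem_preimage, Metric.mem_closedBall,
    dist_pi_le_iff hr, Real.dist_eq]

/-- The weak type `(1, 1)` inequality for the maximal function, from the Vitali covering lemma in
the supremum metric, whose balls are the cubes. -/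
lemma mul_volume_maximal_le {n : ℕ} (hn : 0 < n) (g : EuclideanSpace ℝ (Fin n) → ℝ≥0∞)
    (t : ℝ≥0∞) : t * volume {x | t < maximal g x} ≤ 5 ^ n * ∫⁻ x, g x := by
  rcases eq_or_ne t 0 with rfl | ht0
  · simp
  rcases eq_or_ne t ∞ with rfl | ht
  · simp
  rcases eq_or_ne (∫⁻ x, g x) ∞ with hg | hg
  · rw [hg, ENNReal.mul_top (by simp)]; exact le_top
  let I : Set (EuclideanSpace ℝ (Fin n) × ℝ) :=
    {j | 0 < j.2 ∧ t * volume (cube j.1 j.2) < ∫⁻ y in cube j.1 j.2, g y}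
  have hR : ∀ j ∈ I, j.2 ≤ ((∫⁻ x, g x) / t).toReal + 1 := by
    intro j hj
    have h1 : volume (cube j.1 j.2) ≤ (∫⁻ x, g x) / t := by
      rw [ENNReal.le_div_iff_mul_le (Or.inl ht0) (Or.inl ht), mul_comm]
      exact hj.2.le.trans (setLIntegral_le_lintegral _ _)
    rw [volume_cube, ← ENNReal.ofReal_pow (by linarith [hj.1]),
      ENNReal.ofReal_le_iff_le_toReal (ENNReal.div_ne_top hg ht0)] at h1
    by_contra! h
    have h0 : 0 ≤ ((∫⁻ x, g x) / t).toReal := ENNReal.toReal_nonneg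
    have h2 : 2 * j.2 ≤ (2 * j.2) ^ n := le_self_pow₀ (by linarith) hn.ne'
    linarith
  obtain ⟨u, huI, hdis, hcov⟩ := Vitali.exists_disjoint_subfamily_covering_enlargement_closedBall
    I (fun j => WithLp.ofLp j.1) (fun j => j.2) _ hR 5 (by norm_num)
  have hdis' : u.PairwiseDisjoint fun j => cube j.1 j.2 := by
    intro j hj l hl hjl
    simp only [Function.onFun]
    rw [cube_eq_preimage_closedBall _ (huI hj).1.le, cube_eq_preimage_closedBall _ (huI hl).1.le]
    exact (hdis hj hl hjl).preimage _
  have hcount : u.Countable := by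
    refine hdis'.countable_of_nonempty_interior fun j hj => ?_
    exact (Metric.nonempty_ball.2 (huI hj).1).mono (ball_subset_interior_cube _ _)
  calc t * volume {x | t < maximal g x} ≤ t * volume (⋃ j ∈ u, cube j.1 (5 * j.2)) := by
        gcongr
        intro x hx
        obtain ⟨a, r, hr, hxa, hlt⟩ := lt_maximal_iff.1 hx
        rw [lt_cubeAvg_iff hr] at hlt
        obtain ⟨b, hb, hsub⟩ := hcov (a, r) ⟨hr, hlt⟩
        refine Set.mem_biUnion hb ?_
        rw [cube_eq_preimage_closedBall _ hr.le] at hxa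
        rw [cube_eq_preimage_closedBall _ (by linarith [(huI hb).1])]
        exact hsub hxa
    _ ≤ t * ∑' j : u, volume (cube j.1.1 (5 * j.1.2)) := by
        gcongr
        exact measure_biUnion_le _ hcount _
    _ = 5 ^ n * ∑' j : u, t * volume (cube j.1.1 j.1.2) := by
        rw [← ENNReal.tsum_mul_left, ← ENNReal.tsum_mul_left]
        refine tsum_congr fun j => ?_
        rw [volume_cube, volume_cube, show 2 * (5 * j.1.2) = 5 * (2 * j.1.2) by ring,
          ENNReal.ofReal_mul (by norm_num), mul_pow]
        simp only [ENNReal.ofReal_ofNat]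
        ring
    _ ≤ 5 ^ n * ∑' j : u, ∫⁻ y in cube j.1.1 j.1.2, g y := by
        gcongr with j
        exact (huI j.2).2.le
    _ = 5 ^ n * ∫⁻ y in ⋃ j ∈ u, cube j.1 j.2, g y := by
        rw [lintegral_biUnion hcount (fun j _ => measurableSet_cube _ _) hdis']
    _ ≤ _ := by gcongr; exact Measure.restrict_le_self

lemma maximal_le_of_le {n : ℕ} {g : EuclideanSpace ℝ (Fin n) → ℝ≥0∞} {R : ℝ≥0∞}
    (hg : ∀ x, g x ≤ R) (x : EuclideanSpace ℝ (Fin n)) : maximal g x ≤ R := by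
  rw [maximal_le_iff]
  intro a r hr _
  rw [cubeAvg_le_iff hr, ← setLIntegral_const]
  exact lintegral_mono hg

/-- The strong type `(q, q)` inequality for the maximal function of a bounded function. -/
lemma lintegral_maximal_rpow_le {n : ℕ} (hn : 0 < n) {q : ℝ} (hq : 1 < q)
    {g : EuclideanSpace ℝ (Fin n) → ℝ} (hgm : Measurable g) (hg0 : ∀ x, 0 ≤ g x) {R : ℝ}
    (hgR : ∀ x, g x ≤ R) :
    ∫⁻ x, maximal (fun y => ENNReal.ofReal (g y)) x ^ q ≤
      ENNReal.ofReal (2 * 5 ^ n * q / (q - 1) * 2 ^ (q - 1)) * ∫⁻ x, ENNReal.ofReal (g x) ^ q := by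
  have hq0 : 0 < q := by linarith
  have hq1 : 0 < q - 1 := by linarith
  set M := maximal fun y => ENNReal.ofReal (g y) with hM
  have hMm : Measurable M := measurable_maximal _
  have hMtop : ∀ x, M x ≠ ∞ := fun x => ne_top_of_le_ne_top ENNReal.ofReal_ne_top
    (maximal_le_of_le (fun y => ENNReal.ofReal_le_ofReal (hgR y)) x)
  let ν : Measure (EuclideanSpace ℝ (Fin n)) := volume.withDensity fun x => ENNReal.ofReal (g x)
  -- only the part of `g` above `t / 2` matters for the level set at height `t`
  have hlevel : ∀ t : ℝ, 0 < t → ENNReal.ofReal t * volume {x | t < (M x).toReal} ≤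
      ENNReal.ofReal (2 * 5 ^ n) * ν {x | t < 2 * g x} := by
    intro t ht
    have hset : MeasurableSet {x | t < 2 * g x} :=
      measurableSet_lt measurable_const (hgm.const_mul 2)
    let g1 : EuclideanSpace ℝ (Fin n) → ℝ≥0∞ :=
      {x | t < 2 * g x}.indicator fun x => ENNReal.ofReal (g x)
    have hsub : {x | t < (M x).toReal} ⊆ {x | ENNReal.ofReal (t / 2) < maximal g1 x} := by
      intro x hx
      have hx : ENNReal.ofReal t < M x := (ENNReal.ofReal_lt_iff_lt_toReal ht.le (hMtop x)).2 hx
      by_contra hcon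
      simp only [Set.mem_ofPred_eq, not_lt] at hcon
      refine absurd hx (not_lt.2 ?_)
      rw [hM, maximal_le_iff]
      intro a r hr hxa
      rw [cubeAvg_le_iff hr]
      have h1 := (cubeAvg_le_iff hr).1 ((cubeAvg_le_maximal g1 hr hxa).trans hcon)
      calc ∫⁻ y in cube a r, ENNReal.ofReal (g y)
          ≤ ∫⁻ y in cube a r, (g1 y + ENNReal.ofReal (t / 2)) := by
            refine lintegral_mono fun y => ?_
            by_cases hy : t < 2 * g y
            · simp only [g1]
              rw [Set.indicator_of_mem (by exact hy)]
              exact le_self_add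
            · refine le_trans ?_ le_add_self
              exact ENNReal.ofReal_le_ofReal (by linarith)
        _ = (∫⁻ y in cube a r, g1 y) + ENNReal.ofReal (t / 2) * volume (cube a r) := by
            rw [lintegral_add_right _ measurable_const, setLIntegral_const]
        _ ≤ ENNReal.ofReal (t / 2) * volume (cube a r) +
            ENNReal.ofReal (t / 2) * volume (cube a r) := add_le_add h1 le_rfl
        _ = ENNReal.ofReal t * volume (cube a r) := by
            rw [← add_mul, ← ENNReal.ofReal_add (by positivity) (by positivity), add_halves]
    calc ENNReal.ofReal t * volume {x | t < (M x).toReal}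
        ≤ ENNReal.ofReal t * volume {x | ENNReal.ofReal (t / 2) < maximal g1 x} := by gcongr
      _ = 2 * (ENNReal.ofReal (t / 2) * volume {x | ENNReal.ofReal (t / 2) < maximal g1 x}) := by
          rw [← mul_assoc]
          congr 1
          rw [show (2 : ℝ≥0∞) = ENNReal.ofReal 2 by simp, ← ENNReal.ofReal_mul (by norm_num)]
          congr 1; ring
      _ ≤ 2 * (5 ^ n * ∫⁻ x, g1 x) := mul_le_mul_right (mul_volume_maximal_le hn g1 _) 2
      _ = _ := by
          rw [lintegral_indicator hset, withDensity_apply _ hset, ← mul_assoc,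
            ENNReal.ofReal_mul (by norm_num), ENNReal.ofReal_pow (by norm_num)]
          simp
  have h1 : ∫⁻ x, M x ^ q = ENNReal.ofReal q *
      ∫⁻ t in Set.Ioi (0 : ℝ), volume {x | t < (M x).toReal} * ENNReal.ofReal (t ^ (q - 1)) := by
    rw [← lintegral_rpow_eq_lintegral_meas_lt_mul volume
      (Eventually.of_forall fun x => ENNReal.toReal_nonneg) hMm.ennreal_toReal.aemeasurable hq0]
    refine lintegral_congr fun x => ?_
    rw [← ENNReal.ofReal_rpow_of_nonneg ENNReal.toReal_nonneg hq0.le,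
      ENNReal.ofReal_toReal (hMtop x)]
  have h2 := lintegral_rpow_eq_lintegral_meas_lt_mul ν (f := fun x => 2 * g x)
      (Eventually.of_forall fun x => mul_nonneg zero_le_two (hg0 x))
      (hgm.const_mul 2).aemeasurable hq1
  have h3 : ∫⁻ x, ENNReal.ofReal ((2 * g x) ^ (q - 1)) ∂ν =
      ENNReal.ofReal (2 ^ (q - 1)) * ∫⁻ x, ENNReal.ofReal (g x) ^ q := by
    rw [lintegral_withDensity_eq_lintegral_mul _ hgm.ennreal_ofReal
      ((hgm.const_mul 2).pow_const _).ennreal_ofReal,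
      ← lintegral_const_mul _ (hgm.ennreal_ofReal.pow_const q)]
    refine lintegral_congr fun x => ?_
    simp only [Pi.mul_apply]
    rw [Real.mul_rpow zero_le_two (hg0 x), ENNReal.ofReal_mul (by positivity),
      ENNReal.ofReal_rpow_of_nonneg (hg0 x) hq0.le, mul_left_comm,
      ← ENNReal.ofReal_mul (hg0 x)]
    congr 2
    nth_rewrite 1 [← Real.rpow_one (g x)]
    rw [← Real.rpow_add' (hg0 x) (by linarith)]
    ring_nf
  have h4 : ∫⁻ t in Set.Ioi (0 : ℝ), volume {x | t < (M x).toReal} * ENNReal.ofReal (t ^ (q - 1)) ≤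
      ENNReal.ofReal (2 * 5 ^ n) *
        ∫⁻ t in Set.Ioi (0 : ℝ), ν {x | t < 2 * g x} * ENNReal.ofReal (t ^ (q - 1 - 1)) := by
    rw [← lintegral_const_mul' _ _ ENNReal.ofReal_ne_top]
    refine setLIntegral_mono' measurableSet_Ioi fun t ht => ?_
    have ht : 0 < t := ht
    have : t ^ (q - 1) = t * t ^ (q - 1 - 1) := by
      rw [← Real.rpow_one_add' ht.le (by linarith)]; ring_nf
    rw [this, ENNReal.ofReal_mul ht.le, ← mul_assoc, ← mul_assoc, mul_comm (volume _)]
    exact mul_le_mul_left (hlevel t ht) _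
  calc ∫⁻ x, M x ^ q ≤ ENNReal.ofReal q * (ENNReal.ofReal (2 * 5 ^ n) *
        ∫⁻ t in Set.Ioi (0 : ℝ), ν {x | t < 2 * g x} * ENNReal.ofReal (t ^ (q - 1 - 1))) := by
        rw [h1]; gcongr
    _ = ENNReal.ofReal (2 * 5 ^ n * q / (q - 1)) * (ENNReal.ofReal (q - 1) *
        ∫⁻ t in Set.Ioi (0 : ℝ), ν {x | t < 2 * g x} * ENNReal.ofReal (t ^ (q - 1 - 1))) := by
        rw [← mul_assoc, ← mul_assoc, ← ENNReal.ofReal_mul (by positivity),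
          ← ENNReal.ofReal_mul (by positivity)]
        congr 2
        field_simp
    _ = _ := by
        rw [← h2, h3, ← mul_assoc, ← ENNReal.ofReal_mul (by positivity)]

lemma wilsonConst_one {n : ℕ} : wilsonConst (fun _ : EuclideanSpace ℝ (Fin n) => 1) ≤ 1 := by
  simp only [wilsonConst, iSup_le_iff]
  intro a r hr
  refine ENNReal.div_le_of_le_mul ?_
  rw [one_mul]
  refine lintegral_mono fun x => ?_
  refine maximal_le_of_le (fun y => ?_) x
  exact Set.indicator_le_self _ _ _

/-! ### Tails of averages over dilated cubes -/

/-- The series `∑ 2 ^ (-ε m) ⟨h⟩_{2 ^ m Q}` over the dilates of the cube `Q` with centre `z` and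
side length `2 ρ`. -/
noncomputable def tailAvg {n : ℕ} (ε : ℝ) (h : EuclideanSpace ℝ (Fin n) → ℝ≥0∞)
    (z : EuclideanSpace ℝ (Fin n)) (ρ : ℝ) : ℝ≥0∞ :=
  ∑' m : ℕ, ENNReal.ofReal (2 ^ (-ε)) ^ m * cubeAvg h z (2 ^ m * ρ)

/-- The sum of the geometric series with ratio `2 ^ (-ε)`. -/
noncomputable def geomConst (ε : ℝ) : ℝ≥0∞ := (1 - ENNReal.ofReal (2 ^ (-ε)))⁻¹

lemma geomConst_ne_top {ε : ℝ} (hε : 0 < ε) : geomConst ε ≠ ∞ := by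
  rw [geomConst, ENNReal.inv_ne_top, ne_eq, tsub_eq_zero_iff_le, not_le]
  rw [← ENNReal.ofReal_one]
  exact (ENNReal.ofReal_lt_ofReal_iff one_pos).2
    (Real.rpow_lt_one_of_one_lt_of_neg one_lt_two (by linarith))

lemma tailAvg_le {n : ℕ} (ε : ℝ) {h : EuclideanSpace ℝ (Fin n) → ℝ≥0∞}
    {z : EuclideanSpace ℝ (Fin n)} {ρ : ℝ} {c : ℝ≥0∞}
    (hc : ∀ m : ℕ, cubeAvg h z (2 ^ m * ρ) ≤ c) : tailAvg ε h z ρ ≤ geomConst ε * c := by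
  rw [tailAvg, geomConst, ← ENNReal.tsum_geometric, ← ENNReal.tsum_mul_right]
  gcongr with m
  exact hc m

lemma le_two_pow_mul {ρ : ℝ} (hρ : 0 ≤ ρ) (m : ℕ) : ρ ≤ 2 ^ m * ρ :=
  le_mul_of_one_le_left hρ (one_le_pow₀ one_le_two)

lemma tailAvg_le_maximal {n : ℕ} (ε : ℝ) (h : EuclideanSpace ℝ (Fin n) → ℝ≥0∞)
    {z x : EuclideanSpace ℝ (Fin n)} {ρ : ℝ} (hρ : 0 < ρ) (hx : x ∈ cube z ρ) :
    tailAvg ε h z ρ ≤ geomConst ε * maximal h x :=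
  tailAvg_le ε fun m => cubeAvg_le_maximal h (by positivity)
    (cube_mono z (le_two_pow_mul hρ.le m) hx)

lemma cubeAvg_one_le {n : ℕ} (z : EuclideanSpace ℝ (Fin n)) (ρ : ℝ) :
    cubeAvg (fun _ => 1) z ρ ≤ 1 := by
  rw [cubeAvg, setLIntegral_one]
  exact ENNReal.div_self_le_one

lemma cubeAvg_le_tailAvg {n : ℕ} (ε : ℝ) (h : EuclideanSpace ℝ (Fin n) → ℝ≥0∞)
    (z : EuclideanSpace ℝ (Fin n)) (ρ : ℝ) : cubeAvg h z ρ ≤ tailAvg ε h z ρ := by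
  refine le_trans ?_ (ENNReal.le_tsum 0)
  simp

lemma tailAvg_add_le {n : ℕ} (ε : ℝ) {h h₁ h₂ : EuclideanSpace ℝ (Fin n) → ℝ≥0∞}
    (hm : AEMeasurable h₁) (hle : ∀ x, h x ≤ h₁ x + h₂ x) (z : EuclideanSpace ℝ (Fin n)) (ρ : ℝ) :
    tailAvg ε h z ρ ≤ tailAvg ε h₁ z ρ + tailAvg ε h₂ z ρ := by
  simp only [tailAvg]
  rw [← ENNReal.tsum_add]
  gcongr with m
  rw [← mul_add]
  gcongr
  simp only [cubeAvg]
  rw [← ENNReal.add_div, ← lintegral_add_left' hm.restrict]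
  gcongr with x
  exact hle x

/-- A function with positive integral has positive tails. -/
lemma tailAvg_ne_zero {n : ℕ} (ε : ℝ) {h : EuclideanSpace ℝ (Fin n) → ℝ≥0∞}
    (h0 : ∫⁻ x, h x ≠ 0) (z : EuclideanSpace ℝ (Fin n)) {ρ : ℝ}
    (hρ : 0 < ρ) : tailAvg ε h z ρ ≠ 0 := by
  intro hz
  apply h0
  rw [tailAvg, ENNReal.tsum_eq_zero] at hz
  have huniv : (⋃ m : ℕ, cube z (2 ^ m * ρ)) = Set.univ := by
    refine Set.eq_univ_of_forall fun x => ?_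
    obtain ⟨m, hm⟩ := pow_unbounded_of_one_lt (‖x - z‖ / ρ) (one_lt_two (α := ℝ))
    rw [div_lt_iff₀ hρ] at hm
    refine Set.mem_iUnion.2 ⟨m, closedBall_subset_cube z _ ?_⟩
    rw [mem_closedBall_iff_norm]
    exact hm.le
  rw [← setLIntegral_univ, ← huniv]
  refine le_antisymm ((lintegral_iUnion_le _ _).trans ?_) zero_le
  rw [nonpos_iff_eq_zero, ENNReal.tsum_eq_zero]
  intro m
  have h1 := hz m
  rw [mul_eq_zero, cubeAvg, ENNReal.div_eq_zero_iff] at h1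
  rcases h1 with h1 | h1 | h1
  · exact absurd h1 (pow_ne_zero _ (by simp [Real.rpow_pos_of_pos]))
  · exact h1
  · exact absurd h1 (volume_cube_ne_top _ _)

/-- The integral of `h` against a kernel with the decay of a standard kernel difference is
controlled by the tail of averages of `h`. -/
lemma lintegral_compl_cube_le_tailAvg {n : ℕ} {ε : ℝ} (hε : 0 < ε) (hε1 : ε ≤ 1)
    (h : EuclideanSpace ℝ (Fin n) → ℝ≥0∞) (z : EuclideanSpace ℝ (Fin n)) {ρ : ℝ} (hρ : 0 < ρ) :
    ∫⁻ y in (cube z ρ)ᶜ, ENNReal.ofReal (ρ ^ ε / ‖y - z‖ ^ ((n : ℝ) + ε)) * h y ≤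
      2 * 4 ^ n * tailAvg ε h z ρ := by
  let A : ℕ → Set (EuclideanSpace ℝ (Fin n)) := fun m =>
    cube z (2 ^ (m + 1) * ρ) \ cube z (2 ^ m * ρ)
  have hcov : (cube z ρ)ᶜ ⊆ ⋃ m, A m := by
    classical
    intro x hx
    have hex : ∃ m : ℕ, x ∈ cube z (2 ^ m * ρ) := by
      obtain ⟨m, hm⟩ := pow_unbounded_of_one_lt (‖x - z‖ / ρ) (one_lt_two (α := ℝ))
      rw [div_lt_iff₀ hρ] at hm
      refine ⟨m, closedBall_subset_cube z _ ?_⟩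
      rw [mem_closedBall_iff_norm]
      exact hm.le
    have h0 : Nat.find hex ≠ 0 := by
      intro h0
      have := Nat.find_spec hex
      rw [h0] at this
      simp only [pow_zero, one_mul] at this
      exact hx this
    obtain ⟨m, hm⟩ := Nat.exists_eq_succ_of_ne_zero h0
    refine Set.mem_iUnion.2 ⟨m, ?_, Nat.find_min hex (by omega)⟩
    have := Nat.find_spec hex
    rwa [hm] at this
  have hAm : ∀ m, MeasurableSet (A m) := fun m =>
    (measurableSet_cube _ _).diff (measurableSet_cube _ _)
  have hpt : ∀ m, ∀ y ∈ A m, ENNReal.ofReal (ρ ^ ε / ‖y - z‖ ^ ((n : ℝ) + ε)) ≤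
      2 * 4 ^ n * ENNReal.ofReal (2 ^ (-ε)) ^ (m + 1) / volume (cube z (2 ^ (m + 1) * ρ)) := by
    intro m y hy
    have hρm : 0 < 2 ^ m * ρ := by positivity
    have hnorm : 2 ^ m * ρ ≤ ‖y - z‖ := by
      by_contra! hcon
      exact hy.2 (closedBall_subset_cube z _ (mem_closedBall_iff_norm.2 hcon.le))
    have h2 : (0 : ℝ) < 2 * (2 ^ (m + 1) * ρ) := by positivity
    rw [volume_cube, ← ENNReal.ofReal_pow h2.le, ← ENNReal.ofReal_pow (by positivity),
      show (2 : ℝ≥0∞) * 4 ^ n = ENNReal.ofReal (2 * 4 ^ n) by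
        rw [ENNReal.ofReal_mul zero_le_two, ENNReal.ofReal_pow (by norm_num)]; simp,
      ← ENNReal.ofReal_mul (by positivity), ← ENNReal.ofReal_div_of_pos (by positivity)]
    apply ENNReal.ofReal_le_ofReal
    calc ρ ^ ε / ‖y - z‖ ^ ((n : ℝ) + ε) ≤ ρ ^ ε / (2 ^ m * ρ) ^ ((n : ℝ) + ε) := by gcongr
      _ = (2 ^ (-ε)) ^ m / (2 ^ m * ρ) ^ n := by
          have e : ((2 : ℝ) ^ m) ^ ε = (2 ^ ε) ^ m := by
            rw [← Real.rpow_natCast, ← Real.rpow_natCast, ← Real.rpow_mul zero_le_two,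
              ← Real.rpow_mul zero_le_two, mul_comm]
          rw [Real.rpow_add hρm, Real.rpow_natCast, Real.mul_rpow (by positivity) hρ.le,
            Real.rpow_neg zero_le_two, inv_pow, e]
          have : ρ ^ ε ≠ 0 := (Real.rpow_pos_of_pos hρ ε).ne'
          have : ((2 : ℝ) ^ ε) ^ m ≠ 0 := (pow_pos (Real.rpow_pos_of_pos two_pos _) _).ne'
          field_simp
      _ ≤ 2 * 4 ^ n * (2 ^ (-ε)) ^ (m + 1) / (2 * (2 ^ (m + 1) * ρ)) ^ n := by
          rw [show 2 * (2 ^ (m + 1) * ρ) = 4 * (2 ^ m * ρ) by ring, mul_pow 4,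
            show 2 * 4 ^ n * ((2 : ℝ) ^ (-ε)) ^ (m + 1) / (4 ^ n * (2 ^ m * ρ) ^ n) =
              (2 * 2 ^ (-ε)) * (2 ^ (-ε)) ^ m / (2 ^ m * ρ) ^ n by field_simp; ring]
          gcongr
          -- the shift from `m` to `m + 1` costs a factor `2 ^ ε ≤ 2`, as `ε ≤ 1`
          refine le_mul_of_one_le_left (by positivity) ?_
          have : (2 : ℝ) ^ (-1 : ℝ) ≤ 2 ^ (-ε) :=
            Real.rpow_le_rpow_of_exponent_le one_le_two (by linarith)
          rw [Real.rpow_neg_one] at this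
          linarith
  calc ∫⁻ y in (cube z ρ)ᶜ, ENNReal.ofReal (ρ ^ ε / ‖y - z‖ ^ ((n : ℝ) + ε)) * h y
      ≤ ∫⁻ y in ⋃ m, A m, ENNReal.ofReal (ρ ^ ε / ‖y - z‖ ^ ((n : ℝ) + ε)) * h y :=
        lintegral_mono_set hcov
    _ ≤ ∑' m, ∫⁻ y in A m, ENNReal.ofReal (ρ ^ ε / ‖y - z‖ ^ ((n : ℝ) + ε)) * h y :=
        lintegral_iUnion_le _ _
    _ ≤ ∑' m, 2 * 4 ^ n * (ENNReal.ofReal (2 ^ (-ε)) ^ (m + 1) *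
          cubeAvg h z (2 ^ (m + 1) * ρ)) := by
        gcongr with m
        have hv : volume (cube z (2 ^ (m + 1) * ρ)) ≠ 0 := volume_cube_ne_zero z (by positivity)
        calc ∫⁻ y in A m, ENNReal.ofReal (ρ ^ ε / ‖y - z‖ ^ ((n : ℝ) + ε)) * h y
            ≤ ∫⁻ y in A m, 2 * 4 ^ n * ENNReal.ofReal (2 ^ (-ε)) ^ (m + 1) /
                volume (cube z (2 ^ (m + 1) * ρ)) * h y :=
              setLIntegral_mono' (hAm m) fun y hy => mul_le_mul_left (hpt m y hy) _
          _ = 2 * 4 ^ n * ENNReal.ofReal (2 ^ (-ε)) ^ (m + 1) /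
                volume (cube z (2 ^ (m + 1) * ρ)) * ∫⁻ y in A m, h y := by
              rw [lintegral_const_mul']
              exact ENNReal.div_ne_top (by finiteness) hv
          _ ≤ 2 * 4 ^ n * ENNReal.ofReal (2 ^ (-ε)) ^ (m + 1) /
                volume (cube z (2 ^ (m + 1) * ρ)) * ∫⁻ y in cube z (2 ^ (m + 1) * ρ), h y := by
              gcongr
              exact Set.sdiff_subset
          _ = _ := by
              rw [cubeAvg]
              simp only [div_eq_mul_inv]
              ring
    _ ≤ 2 * 4 ^ n * tailAvg ε h z ρ := by
        rw [ENNReal.tsum_mul_left]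
        gcongr
        exact ENNReal.tsum_comp_le_tsum_of_injective (add_left_injective 1)
          (fun m => ENNReal.ofReal (2 ^ (-ε)) ^ m * cubeAvg h z (2 ^ m * ρ))

/-! ### Standard kernels -/

section Kernel

variable {n : ℕ} {𝕜 : Type*} [RCLike 𝕜] {ε C : ℝ}
  {K : EuclideanSpace ℝ (Fin n) → EuclideanSpace ℝ (Fin n) → 𝕜}

lemma IsStandardKernel.nonneg (hK : IsStandardKernel ε C K) (hn : 0 < n) : 0 ≤ C := by
  have : Nonempty (Fin n) := ⟨⟨0, hn⟩⟩
  obtain ⟨x, y, hxy⟩ := exists_pair_ne (EuclideanSpace ℝ (Fin n))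
  have h := (norm_nonneg _).trans (hK.size x y hxy)
  have h1 : 0 < ‖x - y‖ ^ n := pow_pos (norm_sub_pos_iff.2 hxy) n
  by_contra! hC
  exact absurd (div_neg_of_neg_of_pos hC h1) (not_lt.2 h)

/-- The kernel is continuous in its second variable off the diagonal, hence measurable. -/
lemma IsStandardKernel.measurable (hK : IsStandardKernel ε C K) (hε : 0 < ε)
    (x : EuclideanSpace ℝ (Fin n)) : Measurable (K x) := by
  refine measurable_of_continuousOn_compl_singleton x fun y hy => ContinuousAt.continuousWithinAt ?_
  have hy : y ≠ x := hy
  have hpos : 0 < ‖y - x‖ := norm_sub_pos_iff.2 hy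
  have hlim : Tendsto (fun y' => C * ‖y - y'‖ ^ ε / ‖y - x‖ ^ ((n : ℝ) + ε)) (𝓝 y) (𝓝 0) := by
    have h1 : Tendsto (fun y' => ‖y - y'‖) (𝓝 y) (𝓝 0) := by
      have : Continuous fun y' => ‖y - y'‖ := by fun_prop
      simpa using this.tendsto y
    have h2 : Tendsto (fun y' => ‖y - y'‖ ^ ε) (𝓝 y) (𝓝 0) := by
      have := h1.rpow_const (p := ε) (Or.inr hε.le)
      rwa [Real.zero_rpow hε.ne'] at this
    simpa using (h2.const_mul C).div_const (‖y - x‖ ^ ((n : ℝ) + ε))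
  rw [ContinuousAt, tendsto_iff_norm_sub_tendsto_zero]
  refine squeeze_zero' (Eventually.of_forall fun _ => norm_nonneg _) ?_ hlim
  filter_upwards [Metric.closedBall_mem_nhds y (half_pos hpos)] with y' hy'
  rw [mem_closedBall_iff_norm, norm_sub_rev] at hy'
  have := hK.regularity y y' x hy (by linarith)
  rw [norm_sub_rev (K x y')]
  linarith [norm_nonneg (K y x - K y' x)]

variable {V : Type*} [NormedAddCommGroup V] [NormedSpace 𝕜 V]

lemma IsStandardKernel.integrable_smul (hK : IsStandardKernel ε C K) (hn : 0 < n) (hε : 0 < ε)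
    {u : EuclideanSpace ℝ (Fin n) → V} (hu : Integrable u) {x : EuclideanSpace ℝ (Fin n)} {δ : ℝ}
    (hδ : 0 < δ) (h0 : ∀ y ∈ Metric.ball x δ, u y = 0) : Integrable fun y => K x y • u y := by
  have hC := hK.nonneg hn
  refine (hu.norm.const_mul (C / δ ^ n)).mono'
    ((hK.measurable hε x).aestronglyMeasurable.smul hu.1) (Eventually.of_forall fun y => ?_)
  by_cases hy : y ∈ Metric.ball x δ
  · simp [h0 y hy]
  · rw [norm_smul]
    rw [mem_ball_iff_norm, not_lt, norm_sub_rev] at hy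
    have hxy : x ≠ y := norm_sub_pos_iff.1 (hδ.trans_le hy)
    gcongr
    exact (hK.size x y hxy).trans (by gcongr)

variable [NormedSpace ℝ V]

/-- Smoothness of the kernel in its first variable: integrals of the kernel against a function that
vanishes on a cube oscillate little near the centre of that cube. -/
lemma IsStandardKernel.enorm_integral_sub_le (hK : IsStandardKernel ε C K) (hn : 0 < n)
    (hε : 0 < ε) (hε1 : ε ≤ 1) {u : EuclideanSpace ℝ (Fin n) → V} (hu : Integrable u)
    {x z : EuclideanSpace ℝ (Fin n)} {ρ : ℝ} (hρ : 0 < ρ) (hxz : 2 * ‖x - z‖ ≤ ρ)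
    (h0 : ∀ y ∈ cube z ρ, u y = 0) :
    ‖(∫ y, K x y • u y) - ∫ y, K z y • u y‖ₑ ≤
      ENNReal.ofReal C * (2 * 4 ^ n) * tailAvg ε (fun y => ‖u y‖ₑ) z ρ := by
  have hC := hK.nonneg hn
  have hz : Integrable fun y => K z y • u y :=
    hK.integrable_smul hn hε hu hρ fun y hy =>
      h0 y (closedBall_subset_cube z ρ (Metric.ball_subset_closedBall hy))
  have hx : Integrable fun y => K x y • u y := by
    refine hK.integrable_smul hn hε hu (half_pos hρ) fun y hy => h0 y ?_
    refine closedBall_subset_cube z ρ (mem_closedBall_iff_norm.2 ?_)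
    rw [mem_ball_iff_norm] at hy
    linarith [norm_sub_le_norm_sub_add_norm_sub y x z]
  rw [← integral_sub hx hz]
  refine (enorm_integral_le_lintegral_enorm _).trans ?_
  calc ∫⁻ y, ‖K x y • u y - K z y • u y‖ₑ
      ≤ ∫⁻ y, (cube z ρ)ᶜ.indicator (fun y => ENNReal.ofReal C *
          (ENNReal.ofReal (ρ ^ ε / ‖y - z‖ ^ ((n : ℝ) + ε)) * ‖u y‖ₑ)) y := by
        refine lintegral_mono fun y => ?_
        by_cases hy : y ∈ cube z ρ
        · simp [h0 y hy]
        · rw [Set.indicator_of_mem (by exact hy), ← sub_smul, enorm_smul, ← mul_assoc,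
            ← ENNReal.ofReal_mul hC]
          gcongr
          rw [← ofReal_norm]
          apply ENNReal.ofReal_le_ofReal
          have hyz : ρ ≤ ‖z - y‖ := by
            by_contra! hcon
            rw [norm_sub_rev] at hcon
            exact hy (closedBall_subset_cube z ρ (mem_closedBall_iff_norm.2 hcon.le))
          have hne : z ≠ y := norm_sub_pos_iff.1 (hρ.trans_le hyz)
          rw [norm_sub_rev x z] at hxz
          have := hK.regularity z x y hne (by linarith)
          rw [norm_sub_rev (K x y), norm_sub_rev y z, ← mul_div_assoc]
          refine le_trans (by linarith [norm_nonneg (K y z - K y x)]) (this.trans ?_)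
          gcongr
          linarith [norm_nonneg (z - x)]
    _ = ENNReal.ofReal C * ∫⁻ y in (cube z ρ)ᶜ,
          ENNReal.ofReal (ρ ^ ε / ‖y - z‖ ^ ((n : ℝ) + ε)) * ‖u y‖ₑ := by
        rw [lintegral_indicator (measurableSet_cube z ρ).compl,
          lintegral_const_mul' _ _ ENNReal.ofReal_ne_top]
    _ ≤ ENNReal.ofReal C * (2 * 4 ^ n * tailAvg ε (fun y => ‖u y‖ₑ) z ρ) := by
        gcongr
        exact lintegral_compl_cube_le_tailAvg hε hε1 _ z hρ
    _ = _ := by ring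

/-- Smoothness of the kernel in its second variable: integrals of the kernel against a function of
mean value zero decay away from its support. -/
lemma IsStandardKernel.enorm_integral_le (hK : IsStandardKernel ε C K) (hn : 0 < n)
    (hε : 0 < ε) [SMulCommClass ℝ 𝕜 V] [CompleteSpace V]
    {u : EuclideanSpace ℝ (Fin n) → V} (hu : Integrable u)
    {x z : EuclideanSpace ℝ (Fin n)} {s : ℝ} (hs : 0 < s) (hx : x ∉ cube z (n * s))
    (h0 : ∀ y ∉ cube z (s / 2), u y = 0) (hmean : ∫ y, u y = 0) :
    ‖∫ y, K x y • u y‖ₑ ≤ ENNReal.ofReal C *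
      ENNReal.ofReal ((n * s) ^ ε / ‖x - z‖ ^ ((n : ℝ) + ε)) * ∫⁻ y, ‖u y‖ₑ := by
  have hC := hK.nonneg hn
  have hn' : (0 : ℝ) < n := by exact_mod_cast hn
  have hxz : n * s < ‖x - z‖ := by
    by_contra! hcon
    exact hx (closedBall_subset_cube z _ (mem_closedBall_iff_norm.2 hcon))
  have hsupp : ∀ y, u y ≠ 0 → ‖z - y‖ ≤ n * (s / 2) := by
    intro y hy
    have : y ∈ cube z (s / 2) := by
      by_contra hcon
      exact hy (h0 y hcon)
    rw [norm_sub_rev, ← mem_closedBall_iff_norm]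
    exact cube_subset_closedBall z (half_pos hs).le this
  have hint : Integrable fun y => K x y • u y := by
    refine hK.integrable_smul hn hε hu (δ := n * (s / 2)) (by positivity) fun y hy => ?_
    by_contra hne
    have h1 := hsupp y hne
    rw [mem_ball_iff_norm, norm_sub_rev] at hy
    have := norm_sub_le_norm_sub_add_norm_sub x y z
    rw [norm_sub_rev y z] at this
    linarith
  -- as `u` has mean value zero, the constant `K x z` may be subtracted from the kernel
  have e : ∫ y, K x y • u y = ∫ y, (K x y - K x z) • u y := by
    have h1 : ∫ y, K x z • u y = 0 := by rw [integral_smul, hmean, smul_zero]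
    have h2 := integral_sub hint (hu.smul (K x z))
    simp only [Pi.smul_apply, h1, sub_zero] at h2
    rw [← h2]
    simp only [sub_smul]
  rw [e, ← lintegral_const_mul' _ _ (by finiteness)]
  refine (enorm_integral_le_lintegral_enorm _).trans (lintegral_mono fun y => ?_)
  rcases eq_or_ne (u y) 0 with hy | hy
  · simp [hy]
  rw [enorm_smul, ← ENNReal.ofReal_mul hC]
  gcongr
  rw [← ofReal_norm]
  apply ENNReal.ofReal_le_ofReal
  have h1 := hsupp y hy
  rw [norm_sub_rev] at hxz
  have hpos : 0 < n * s := by positivity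
  have hne : z ≠ x := norm_sub_pos_iff.1 (hpos.trans hxz)
  have := hK.regularity z y x hne (by linarith)
  rw [norm_sub_rev (K x y), norm_sub_rev x z, ← mul_div_assoc]
  refine le_trans (by linarith [norm_nonneg (K z x - K y x)]) (this.trans ?_)
  gcongr
  linarith

end Kernel

/-! ### Vector-valued singular integrals and the weak type `(1, 1)` inequality -/

/-- Bounded, boundedly supported, strongly measurable functions: the test functions on which
vector-valued singular integrals are considered. -/
def Nice {n : ℕ} {V : Type*} [NormedAddCommGroup V] (u : EuclideanSpace ℝ (Fin n) → V) : Prop :=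
  StronglyMeasurable u ∧ (∃ R : ℝ, ∀ x, ‖u x‖ ≤ R) ∧ ∃ R : ℝ, ∀ x, R < ‖x‖ → u x = 0

section Nice

variable {n : ℕ} {V : Type*} [NormedAddCommGroup V] {u v : EuclideanSpace ℝ (Fin n) → V}

lemma Nice.zero : Nice (fun _ : EuclideanSpace ℝ (Fin n) => (0 : V)) :=
  ⟨stronglyMeasurable_const, ⟨0, by simp⟩, ⟨0, by simp⟩⟩

lemma Nice.add (hu : Nice u) (hv : Nice v) : Nice (fun x => u x + v x) := by
  obtain ⟨hu1, ⟨R, hR⟩, S, hS⟩ := hu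
  obtain ⟨hv1, ⟨R', hR'⟩, S', hS'⟩ := hv
  refine ⟨hu1.add hv1, ⟨R + R', fun x => (norm_add_le _ _).trans (add_le_add (hR x) (hR' x))⟩,
    ⟨max S S', fun x hx => ?_⟩⟩
  simp only [hS x ((le_max_left _ _).trans_lt hx), hS' x ((le_max_right _ _).trans_lt hx),
    add_zero]

lemma Nice.neg (hu : Nice u) : Nice (fun x => -u x) := by
  obtain ⟨hu1, ⟨R, hR⟩, S, hS⟩ := hu
  exact ⟨hu1.neg, ⟨R, fun x => by simpa using hR x⟩, ⟨S, fun x hx => by simp [hS x hx]⟩⟩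

lemma Nice.sub (hu : Nice u) (hv : Nice v) : Nice (fun x => u x - v x) := by
  simpa only [sub_eq_add_neg] using hu.add hv.neg

lemma Nice.indicator (hu : Nice u) {A : Set (EuclideanSpace ℝ (Fin n))} (hA : MeasurableSet A) :
    Nice (A.indicator u) := by
  obtain ⟨hu1, ⟨R, hR⟩, S, hS⟩ := hu
  refine ⟨hu1.indicator hA, ⟨R, fun x => (norm_indicator_le_norm_self _ _).trans (hR x)⟩,
    ⟨S, fun x hx => ?_⟩⟩
  by_cases h : x ∈ A
  · rw [Set.indicator_of_mem h, hS x hx]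
  · rw [Set.indicator_of_notMem h]

lemma Nice.sum {ι : Type*} (F : Finset ι) {b : ι → EuclideanSpace ℝ (Fin n) → V}
    (hb : ∀ j, Nice (b j)) : Nice (fun x => ∑ j ∈ F, b j x) := by
  classical
  induction F using Finset.induction_on with
  | empty => simpa using Nice.zero
  | insert j F hj ih => simpa only [Finset.sum_insert hj] using (hb j).add ih

lemma Nice.const_indicator (c : V) {A : Set (EuclideanSpace ℝ (Fin n))} (hA : MeasurableSet A)
    {R : ℝ} (hR : A ⊆ Metric.closedBall 0 R) : Nice (A.indicator fun _ => c) := by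
  refine ⟨stronglyMeasurable_const.indicator hA,
    ⟨‖c‖, fun x => norm_indicator_le_norm_self (fun _ => c) _⟩, ⟨R, fun x hx => ?_⟩⟩
  refine Set.indicator_of_notMem (fun h => ?_) _
  have := hR h
  rw [mem_closedBall_zero_iff] at this
  linarith

lemma Nice.hasCompactSupport (hu : Nice u) : HasCompactSupport u := by
  obtain ⟨-, -, S, hS⟩ := hu
  refine HasCompactSupport.intro (isCompact_closedBall 0 S) fun x hx => hS x ?_
  rwa [mem_closedBall_zero_iff, not_le] at hx

lemma Nice.memLp (hu : Nice u) (p : ℝ≥0∞) : MemLp u p := by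
  have hc := hu.hasCompactSupport
  obtain ⟨hu1, ⟨R, hR⟩, -⟩ := hu
  exact hc.memLp_of_bound hu1.aestronglyMeasurable R (Eventually.of_forall hR)

lemma Nice.integrable (hu : Nice u) : Integrable u := memLp_one_iff_integrable.1 (hu.memLp 1)

lemma Nice.lintegral_ne_top (hu : Nice u) : ∫⁻ x, ‖u x‖ₑ ≠ ∞ := hu.integrable.2.ne

lemma Nice.lintegral_rpow_ne_top (hu : Nice u) {q : ℝ} (hq : 0 < q) : ∫⁻ x, ‖u x‖ₑ ^ q ≠ ∞ := by
  have := (hu.memLp (ENNReal.ofReal q)).2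
  rw [eLpNorm_lt_top_iff_lintegral_rpow_enorm_lt_top (by simpa using hq) ENNReal.ofReal_ne_top,
    ENNReal.toReal_ofReal hq.le] at this
  exact this.ne

end Nice

/-- `𝒯` is a singular integral operator on `V`-valued test functions: it is additive, bounded on
`L^q` (in the form `∫ ‖𝒯 u‖ ^ q ≤ B ∫ ‖u‖ ^ q`), and given by the scalar kernel `K` off the support
of its argument. -/
structure IsSIO {n : ℕ} {𝕜 V : Type*} [RCLike 𝕜] [NormedAddCommGroup V] [NormedSpace 𝕜 V]
    [NormedSpace ℝ V] (K : EuclideanSpace ℝ (Fin n) → EuclideanSpace ℝ (Fin n) → 𝕜) (q : ℝ)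
    (B : ℝ≥0∞) (𝒯 : (EuclideanSpace ℝ (Fin n) → V) → EuclideanSpace ℝ (Fin n) → V) : Prop where
  aestronglyMeasurable : ∀ u, Nice u → AEStronglyMeasurable (𝒯 u)
  add : ∀ u v, Nice u → Nice v → 𝒯 (fun x => u x + v x) =ᵐ[volume] fun x => 𝒯 u x + 𝒯 v x
  bound : ∀ u, Nice u → ∫⁻ x, ‖𝒯 u x‖ₑ ^ q ≤ B * ∫⁻ x, ‖u x‖ₑ ^ q
  kernel : ∀ u, Nice u → ∀ᵐ x, x ∉ tsupport u → 𝒯 u x = ∫ y, K x y • u y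

/-- The constant of the kernel estimates for a standard kernel. -/
noncomputable def kernelConst (n : ℕ) (C : ℝ) : ℝ≥0∞ := ENNReal.ofReal C * (2 * 4 ^ n)

lemma kernelConst_ne_top (n : ℕ) (C : ℝ) : kernelConst n C ≠ ∞ := by
  rw [kernelConst]; finiteness

/-- The constant in the weak type `(1, 1)` inequality. -/
noncomputable def weakConst (n : ℕ) (q ε C : ℝ) (B : ℝ≥0∞) : ℝ≥0∞ :=
  2 * (B * (2 ^ n) ^ (q - 1) + 2 * (kernelConst n C * geomConst ε) + (2 * n) ^ n)

lemma weakConst_ne_top {n : ℕ} {q ε C : ℝ} (hq : 1 < q) (hε : 0 < ε) {B : ℝ≥0∞} (hB : B ≠ ∞) :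
    weakConst n q ε C B ≠ ∞ := by
  have h1 := kernelConst_ne_top n C
  have h2 := geomConst_ne_top hε
  have h3 : ((2 : ℝ≥0∞) ^ n) ^ (q - 1) ≠ ∞ :=
    ENNReal.rpow_ne_top_of_nonneg (by linarith) (by finiteness)
  rw [weakConst]
  finiteness

lemma weakConst_ne_zero {n : ℕ} (hn : 0 < n) {q ε C : ℝ} {B : ℝ≥0∞} :
    weakConst n q ε C B ≠ 0 := by
  have : ((2 * n : ℝ≥0∞)) ^ n ≠ 0 := pow_ne_zero _ (by simp [hn.ne'])
  simp only [weakConst, ne_eq, mul_eq_zero, add_eq_zero, not_or, not_and]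
  exact ⟨by simp, fun _ => this⟩

lemma rpow_eq_mul_rpow_sub_one (a : ℝ≥0∞) {q : ℝ} (hq : 1 < q) : a ^ q = a * a ^ (q - 1) := by
  have := ENNReal.rpow_add_of_nonneg (x := a) 1 (q - 1) zero_le_one (by linarith)
  rwa [ENNReal.rpow_one, add_sub_cancel] at this

/-- The good part in a Calderón–Zygmund decomposition, when only the stopping sets with index in
`F` are modified. -/
lemma lintegral_good_le {n : ℕ} {V : Type*} [NormedAddCommGroup V] {q : ℝ} (hq : 1 < q)
    {u : EuclideanSpace ℝ (Fin n) → V}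
    (hu : StronglyMeasurable u) {t : ℝ≥0∞}
    {ι : Type*} [Countable ι] {D : ι → Set (EuclideanSpace ℝ (Fin n))}
    (hD : ∀ j, MeasurableSet (D j)) (hdis : Pairwise (Function.onFun Disjoint D))
    {T : ℝ≥0∞} (htT : t ≤ T) {m : ι → V} (hmT : ∀ j, volume (D j) ≠ 0 → ‖m j‖ₑ ≤ T)
    (hm : ∀ j, ‖m j‖ₑ * volume (D j) ≤ ∫⁻ x in D j, ‖u x‖ₑ)
    (hae : ∀ᵐ x, (∀ j, x ∉ D j) → ‖u x‖ₑ ≤ t) (F : Finset ι)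
    {g : EuclideanSpace ℝ (Fin n) → V} (hgF : ∀ j ∈ F, ∀ x ∈ D j, g x = m j)
    (hg : ∀ x, (∀ j ∈ F, x ∉ D j) → g x = u x) :
    ∫⁻ x, ‖g x‖ₑ ^ q ≤ T ^ (q - 1) * (∫⁻ x, ‖u x‖ₑ) +
      ∫⁻ x in ⋃ j : {j // j ∉ F}, D j, ‖u x‖ₑ ^ q := by
  classical
  have hq1 : 0 ≤ q - 1 := by linarith
  set Ω := ⋃ j, D j with hΩ
  have hΩm : MeasurableSet Ω := MeasurableSet.iUnion hD
  set Ω' := ⋃ j : {j // j ∉ F}, D j with hΩ'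
  have hΩm' : MeasurableSet Ω' := MeasurableSet.iUnion fun j => hD _
  have hpt : ∀ᵐ x, ‖g x‖ₑ ^ q ≤ ∑ j ∈ F, (D j).indicator (fun _ => ‖m j‖ₑ ^ q) x +
      Ωᶜ.indicator (fun x => T ^ (q - 1) * ‖u x‖ₑ) x +
      Ω'.indicator (fun x => ‖u x‖ₑ ^ q) x := by
    filter_upwards [hae] with x hx
    by_cases h1 : ∃ j ∈ F, x ∈ D j
    · obtain ⟨j, hj, hxj⟩ := h1
      rw [hgF j hj x hxj, add_assoc]
      refine le_trans ?_ le_self_add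
      have := Finset.single_le_sum (f := fun j => (D j).indicator (fun _ => ‖m j‖ₑ ^ q) x)
        (fun _ _ => zero_le) hj
      simpa only [Set.indicator_of_mem hxj] using this
    · push Not at h1
      rw [hg x h1]
      by_cases h2 : ∃ j, x ∈ D j
      · obtain ⟨j, hj⟩ := h2
        have hjF : j ∉ F := fun h => h1 j h hj
        have : x ∈ Ω' := Set.mem_iUnion.2 ⟨⟨j, hjF⟩, hj⟩
        rw [Set.indicator_of_mem this]
        exact le_add_self
      · push Not at h2
        have : x ∈ Ωᶜ := by simpa [hΩ] using h2
        rw [Set.indicator_of_mem this, rpow_eq_mul_rpow_sub_one _ hq, mul_comm]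
        refine le_trans ?_ le_self_add
        refine le_trans ?_ le_add_self
        gcongr
        exact (hx h2).trans htT
  have hmq : ∀ j, ‖m j‖ₑ ^ q * volume (D j) ≤ T ^ (q - 1) * ∫⁻ x in D j, ‖u x‖ₑ := by
    intro j
    rcases eq_or_ne (volume (D j)) 0 with h0 | h0
    · simp [h0]
    rw [rpow_eq_mul_rpow_sub_one _ hq, mul_comm ‖m j‖ₑ, mul_assoc]
    gcongr
    · exact hmT j h0
    · exact hm j
  calc ∫⁻ x, ‖g x‖ₑ ^ q
      ≤ ∫⁻ x, (∑ j ∈ F, (D j).indicator (fun _ => ‖m j‖ₑ ^ q) x +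
          Ωᶜ.indicator (fun x => T ^ (q - 1) * ‖u x‖ₑ) x +
          Ω'.indicator (fun x => ‖u x‖ₑ ^ q) x) := lintegral_mono_ae hpt
    _ = ∑ j ∈ F, ‖m j‖ₑ ^ q * volume (D j) + T ^ (q - 1) * (∫⁻ x in Ωᶜ, ‖u x‖ₑ) +
          ∫⁻ x in Ω', ‖u x‖ₑ ^ q := by
        rw [lintegral_add_right _ ((hu.enorm.pow_const q).indicator hΩm'),
          lintegral_add_right _ ((hu.enorm.const_mul _).indicator hΩm.compl),
          lintegral_finsetSum _ fun j _ => measurable_const.indicator (hD j),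
          lintegral_indicator hΩm', lintegral_indicator hΩm.compl, lintegral_const_mul _ hu.enorm]
        congr 2
        refine Finset.sum_congr rfl fun j _ => ?_
        rw [lintegral_indicator (hD j), setLIntegral_const]
    _ ≤ T ^ (q - 1) * (∫⁻ x in Ω, ‖u x‖ₑ) + T ^ (q - 1) * (∫⁻ x in Ωᶜ, ‖u x‖ₑ) +
          ∫⁻ x in Ω', ‖u x‖ₑ ^ q := by
        gcongr
        rw [hΩ, lintegral_iUnion hD hdis, ← ENNReal.tsum_mul_left]
        exact (Finset.sum_le_sum fun j _ => hmq j).trans (ENNReal.sum_le_tsum F)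
    _ = _ := by rw [← mul_add, lintegral_add_compl _ hΩm]

section SingularIntegral

variable {n : ℕ} {𝕜 V : Type*} [RCLike 𝕜] [NormedAddCommGroup V] [NormedSpace 𝕜 V]
    [NormedSpace ℝ V] {K : EuclideanSpace ℝ (Fin n) → EuclideanSpace ℝ (Fin n) → 𝕜} {q : ℝ}
    {B : ℝ≥0∞} {𝒯 : (EuclideanSpace ℝ (Fin n) → V) → EuclideanSpace ℝ (Fin n) → V} {ε C : ℝ}

lemma IsSIO.zero (hT : IsSIO K q B 𝒯) : 𝒯 (fun _ => 0) =ᵐ[volume] fun _ => 0 := by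
  have := hT.add _ _ Nice.zero Nice.zero
  simp only [add_zero] at this
  filter_upwards [this] with x hx
  simpa using hx

lemma IsSIO.enorm_sum_le (hT : IsSIO K q B 𝒯) {ι : Type*} (F : Finset ι)
    {b : ι → EuclideanSpace ℝ (Fin n) → V} (hb : ∀ j, Nice (b j)) :
    ∀ᵐ x, ‖𝒯 (fun x => ∑ j ∈ F, b j x) x‖ₑ ≤ ∑ j ∈ F, ‖𝒯 (b j) x‖ₑ := by
  classical
  induction F using Finset.induction_on with
  | empty =>
    filter_upwards [hT.zero] with x hx
    simp [hx]
  | insert j F hj ih =>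
    simp only [Finset.sum_insert hj]
    filter_upwards [ih, hT.add _ _ (hb j) (Nice.sum F hb)] with x h1 h2
    rw [h2]
    exact (enorm_add_le _ _).trans (add_le_add le_rfl h1)

/-- A singular integral of a function of mean value zero on a cube is integrable off a dilate. -/
lemma IsSIO.lintegral_compl_le (hT : IsSIO K q B 𝒯) (hK : IsStandardKernel ε C K) (hn : 0 < n)
    (hε : 0 < ε) (hε1 : ε ≤ 1) [SMulCommClass ℝ 𝕜 V] [CompleteSpace V]
    {u : EuclideanSpace ℝ (Fin n) → V} (hu : Nice u)
    {z : EuclideanSpace ℝ (Fin n)} {s : ℝ} (hs : 0 < s)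
    (h0 : ∀ y ∉ cube z (s / 2), u y = 0) (hmean : ∫ y, u y = 0) :
    ∫⁻ x in (cube z (n * s))ᶜ, ‖𝒯 u x‖ₑ ≤ kernelConst n C * geomConst ε * ∫⁻ y, ‖u y‖ₑ := by
  have hn' : (1 : ℝ) ≤ n := by exact_mod_cast hn
  have hsupp : tsupport u ⊆ cube z (n * s) := by
    refine (closure_minimal ?_ (isClosed_cube z (s / 2))).trans (cube_mono z (by nlinarith))
    intro y hy
    by_contra h
    exact hy (h0 y h)
  calc ∫⁻ x in (cube z (n * s))ᶜ, ‖𝒯 u x‖ₑ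
      ≤ ∫⁻ x in (cube z (n * s))ᶜ, ENNReal.ofReal C *
          ENNReal.ofReal ((n * s) ^ ε / ‖x - z‖ ^ ((n : ℝ) + ε)) * ∫⁻ y, ‖u y‖ₑ := by
        refine setLIntegral_mono_ae' (measurableSet_cube _ _).compl ?_
        filter_upwards [hT.kernel u hu] with x hx hxc
        rw [hx fun h => hxc (hsupp h)]
        exact hK.enorm_integral_le hn hε hu.integrable hs hxc h0 hmean
    _ = ENNReal.ofReal C * (∫⁻ x in (cube z (n * s))ᶜ,
          ENNReal.ofReal ((n * s) ^ ε / ‖x - z‖ ^ ((n : ℝ) + ε)) * 1) * ∫⁻ y, ‖u y‖ₑ := by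
        rw [lintegral_mul_const' _ _ hu.lintegral_ne_top,
          lintegral_const_mul' _ _ ENNReal.ofReal_ne_top]
        simp only [mul_one]
    _ ≤ ENNReal.ofReal C * (2 * 4 ^ n * (geomConst ε * 1)) * ∫⁻ y, ‖u y‖ₑ := by
        gcongr
        refine (lintegral_compl_cube_le_tailAvg hε hε1 (fun _ => 1) z (by positivity)).trans ?_
        gcongr
        exact tailAvg_le ε fun m => cubeAvg_one_le _ _
    _ = _ := by rw [kernelConst]; ring

/-- The Calderón–Zygmund estimate for a given family of stopping cubes. Only finitely many bad
parts are split off; the remaining stopping cubes enter through the last term, which tends to zero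
along finite sets because `u` is bounded. -/
lemma IsSIO.weak_type_aux (hT : IsSIO K q B 𝒯) (hK : IsStandardKernel ε C K) (hn : 0 < n)
    (hε : 0 < ε) (hε1 : ε ≤ 1) (hq : 1 < q) [SMulCommClass ℝ 𝕜 V] [CompleteSpace V]
    {u : EuclideanSpace ℝ (Fin n) → V} (hu : Nice u) {t : ℝ≥0∞} (ht0 : t ≠ 0) (ht : t ≠ ∞)
    {ι : Type*} [Countable ι] (P : ι → EuclideanSpace ℝ (Fin n) × ℝ) (hP0 : ∀ j, 0 ≤ (P j).2)
    (hdis : Pairwise (Function.onFun Disjoint fun j => icube (P j).1 (P j).2))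
    (hlow : ∀ j, t * volume (icube (P j).1 (P j).2) ≤ ∫⁻ x in icube (P j).1 (P j).2, ‖u x‖ₑ)
    (hup : ∀ j, ∫⁻ x in icube (P j).1 (P j).2, ‖u x‖ₑ ≤
      2 ^ n * t * volume (icube (P j).1 (P j).2))
    (hae : ∀ᵐ x, (∀ j, x ∉ icube (P j).1 (P j).2) → ‖u x‖ₑ ≤ t) (F : Finset ι) :
    2 * t * volume {x | 2 * t < ‖𝒯 u x‖ₑ} ≤ weakConst n q ε C B * (∫⁻ x, ‖u x‖ₑ) +
      2 * (t * (t ^ q)⁻¹ * B *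
        ∫⁻ x in ⋃ j : {j // j ∉ F}, icube (P j).1 (P j).2, ‖u x‖ₑ ^ q) := by
  classical
  have hn' : (0 : ℝ) < n := by exact_mod_cast hn
  set D : ι → Set (EuclideanSpace ℝ (Fin n)) := fun j => icube (P j).1 (P j).2 with hDdef
  have hD : ∀ j, MeasurableSet (D j) := fun j => measurableSet_icube _ _
  have hDtop : ∀ j, volume (D j) ≠ ∞ := fun j => volume_icube_ne_top _ _
  have hDempty : ∀ j, (P j).2 = 0 → D j = ∅ := by
    intro j hj
    simp only [hDdef, hj, icube_zero hn]
  -- the mean value of `u` over the `j`-th cube, and the corresponding bad part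
  let m : ι → V := fun j => (volume (D j)).toReal⁻¹ • ∫ x in D j, u x
  have hm : ∀ j, ‖m j‖ₑ * volume (D j) ≤ ∫⁻ x in D j, ‖u x‖ₑ := by
    intro j
    rcases eq_or_ne (volume (D j)) 0 with h0 | h0
    · simp [h0]
    simp only [m]
    rw [enorm_smul, Real.enorm_eq_ofReal (by positivity), ENNReal.ofReal_inv_of_pos
      (ENNReal.toReal_pos h0 (hDtop j)), ENNReal.ofReal_toReal (hDtop j), mul_right_comm,
      ENNReal.inv_mul_cancel h0 (hDtop j), one_mul]
    exact enorm_integral_le_lintegral_enorm _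
  let b : ι → EuclideanSpace ℝ (Fin n) → V := fun j x =>
    (D j).indicator u x - (D j).indicator (fun _ => m j) x
  have hbN : ∀ j, Nice (b j) := by
    intro j
    refine (hu.indicator (hD j)).sub (Nice.const_indicator (m j) (hD j)
      (R := ‖icenter (P j).1 (P j).2‖ + n * ((P j).2 / 2)) ?_)
    intro x hx
    have h1 := cube_subset_closedBall _ (by linarith [hP0 j]) (icube_subset_cube _ _ hx)
    rw [mem_closedBall_iff_norm] at h1
    rw [mem_closedBall_zero_iff]
    have := norm_add_le (icenter (P j).1 (P j).2) (x - icenter (P j).1 (P j).2)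
    rw [add_sub_cancel] at this
    linarith
  have hb0 : ∀ j, ∀ x ∉ D j, b j x = 0 := by
    intro j x hx
    simp only [b, Set.indicator_of_notMem hx, sub_zero]
  have hmean : ∀ j, ∫ x, b j x = 0 := by
    intro j
    have hi : Integrable ((D j).indicator fun _ => m j) :=
      (integrable_indicator_iff (hD j)).2 (integrableOn_const (hDtop j))
    simp only [b]
    rw [integral_sub (hu.integrable.indicator (hD j)) hi, integral_indicator (hD j),
      integral_indicator (hD j), setIntegral_const, sub_eq_zero]
    rcases eq_or_ne (volume (D j)) 0 with h0 | h0
    · rw [Measure.restrict_eq_zero.2 h0]; simp [Measure.real, h0]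
    · simp only [m, Measure.real]
      rw [smul_inv_smul₀ (ENNReal.toReal_ne_zero.2 ⟨h0, hDtop j⟩)]
  have hb1 : ∀ j, ∫⁻ x, ‖b j x‖ₑ ≤ 2 * ∫⁻ x in D j, ‖u x‖ₑ := by
    intro j
    calc ∫⁻ x, ‖b j x‖ₑ
        ≤ ∫⁻ x, (‖(D j).indicator u x‖ₑ + ‖(D j).indicator (fun _ => m j) x‖ₑ) :=
          lintegral_mono fun x => enorm_sub_le
      _ = (∫⁻ x in D j, ‖u x‖ₑ) + ‖m j‖ₑ * volume (D j) := by
          rw [lintegral_add_left (hu.indicator (hD j)).1.enorm]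
          simp only [enorm_indicator_eq_indicator_enorm]
          rw [lintegral_indicator (hD j), lintegral_indicator (hD j), setLIntegral_const]
      _ ≤ _ := by rw [two_mul]; gcongr; exact hm j
  set κ := kernelConst n C * geomConst ε with hκ
  let Q : ι → Set (EuclideanSpace ℝ (Fin n)) := fun j =>
    cube (icenter (P j).1 (P j).2) (n * (P j).2)
  have hbT : ∀ j, ∫⁻ x in (Q j)ᶜ, ‖𝒯 (b j) x‖ₑ ≤ κ * (2 * ∫⁻ x in D j, ‖u x‖ₑ) := by
    intro j
    rcases (hP0 j).eq_or_lt with h0 | h0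
    · have : b j = fun _ => 0 := by
        ext x
        exact hb0 j x (by rw [hDempty j h0.symm]; exact Set.notMem_empty x)
      rw [this]
      refine le_trans (setLIntegral_le_lintegral _ _) ?_
      rw [lintegral_congr_ae (g := fun _ => 0) (by filter_upwards [hT.zero] with x hx; simp [hx])]
      simp
    · refine (hT.lintegral_compl_le hK hn hε hε1 (hbN j) h0 (fun y hy => hb0 j y fun h => ?_)
        (hmean j)).trans ?_
      · exact hy (icube_subset_cube _ _ h)
      · gcongr; exact hb1 j
  -- the function with the bad parts indexed by `F` removed
  let g : EuclideanSpace ℝ (Fin n) → V := fun x => u x - ∑ j ∈ F, b j x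
  have hgN : Nice g := hu.sub (Nice.sum F hbN)
  have hgF : ∀ j ∈ F, ∀ x ∈ D j, g x = m j := by
    intro j hj x hx
    simp only [g]
    rw [Finset.sum_eq_single_of_mem j hj fun i _ hij => hb0 i x fun hi =>
      Set.disjoint_left.1 (hdis hij) hi hx]
    simp only [b, Set.indicator_of_mem hx, sub_sub_cancel]
  have hg : ∀ x, (∀ j ∈ F, x ∉ D j) → g x = u x := by
    intro x hx
    simp only [g]
    rw [Finset.sum_eq_zero fun j hj => hb0 j x (hx j hj), sub_zero]
  have hgood := lintegral_good_le hq hu.1 hD hdis (T := 2 ^ n * t)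
    (le_mul_of_one_le_left zero_le (one_le_pow₀ one_le_two)) (m := m) (fun j h0 => by
      have h1 := (hm j).trans (hup j)
      rwa [ENNReal.mul_le_mul_iff_left h0 (hDtop j)] at h1) hm hae F hgF hg
  have hTu : ∀ᵐ x, ‖𝒯 u x‖ₑ ≤ ‖𝒯 g x‖ₑ + ∑ j ∈ F, ‖𝒯 (b j) x‖ₑ := by
    have e : u = fun x => g x + ∑ j ∈ F, b j x := by
      ext x; simp only [g, sub_add_cancel]
    filter_upwards [hT.add g _ hgN (Nice.sum F hbN), hT.enorm_sum_le F hbN] with x h1 h2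
    rw [← e] at h1
    rw [h1]
    exact (enorm_add_le _ _).trans (add_le_add le_rfl h2)
  have hDsum : ∑ j ∈ F, ∫⁻ x in D j, ‖u x‖ₑ ≤ ∫⁻ x, ‖u x‖ₑ := by
    refine (ENNReal.sum_le_tsum F).trans ?_
    rw [← lintegral_iUnion hD hdis]
    exact setLIntegral_le_lintegral _ _
  -- off the dilated cubes the bad parts are controlled in `L¹`
  set Ω := ⋃ j ∈ F, Q j with hΩ
  have hΩm : MeasurableSet Ω := F.measurableSet_biUnion fun j _ => measurableSet_cube _ _
  have hcover : volume {x | 2 * t < ‖𝒯 u x‖ₑ} ≤ volume {x | t ≤ ‖𝒯 g x‖ₑ} + (volume Ω +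
      volume ({x | t ≤ ∑ j ∈ F, ‖𝒯 (b j) x‖ₑ} ∩ Ωᶜ)) := by
    refine le_trans (measure_mono_ae ?_)
      ((measure_union_le _ _).trans (add_le_add le_rfl (measure_union_le _ _)))
    filter_upwards [hTu] with x hx hx2
    change 2 * t < ‖𝒯 u x‖ₑ at hx2
    by_contra hcon
    change ¬ (x ∈ {x | t ≤ ‖𝒯 g x‖ₑ} ∪ (Ω ∪ ({x | t ≤ ∑ j ∈ F, ‖𝒯 (b j) x‖ₑ} ∩ Ωᶜ))) at hcon
    simp only [Set.mem_union, Set.mem_inter_iff, Set.mem_compl_iff, Set.mem_ofPred_eq, not_or,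
      not_and, not_le, not_not] at hcon
    obtain ⟨h1, h2, h3⟩ := hcon
    have h4 : ∑ j ∈ F, ‖𝒯 (b j) x‖ₑ < t := by
      by_contra! h
      exact h2 (h3 h)
    have := ENNReal.add_lt_add h1 h4
    rw [← two_mul] at this
    exact absurd (hx2.trans_le hx) (not_lt.2 this.le)
  have hv1 : t * volume {x | t ≤ ‖𝒯 g x‖ₑ} ≤ t * (t ^ q)⁻¹ * B *
      ((2 ^ n * t) ^ (q - 1) * (∫⁻ x, ‖u x‖ₑ) + ∫⁻ x in ⋃ j : {j // j ∉ F}, D j, ‖u x‖ₑ ^ q) := by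
    have htq0 : t ^ q ≠ 0 := by simp [ENNReal.rpow_eq_zero_iff, ht0, ht]
    have htq : t ^ q ≠ ∞ := by simp [ENNReal.rpow_eq_top_iff, ht0, ht]
    have h1 : t ^ q * volume {x | t ≤ ‖𝒯 g x‖ₑ} ≤ B * ∫⁻ x, ‖g x‖ₑ ^ q := by
      refine le_trans ?_ (hT.bound g hgN)
      refine le_trans ?_ (mul_meas_ge_le_lintegral₀
        ((hT.aestronglyMeasurable g hgN).enorm.pow_const q) (t ^ q))
      refine mul_le_mul_right (measure_mono fun x hx => ?_) _
      exact ENNReal.rpow_le_rpow hx (by linarith)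
    calc t * volume {x | t ≤ ‖𝒯 g x‖ₑ}
        = t * (t ^ q)⁻¹ * (t ^ q * volume {x | t ≤ ‖𝒯 g x‖ₑ}) := by
          rw [mul_assoc t, ← mul_assoc (t ^ q)⁻¹, ENNReal.inv_mul_cancel htq0 htq, one_mul]
      _ ≤ t * (t ^ q)⁻¹ * (B * ((2 ^ n * t) ^ (q - 1) * (∫⁻ x, ‖u x‖ₑ) +
            ∫⁻ x in ⋃ j : {j // j ∉ F}, D j, ‖u x‖ₑ ^ q)) := by
          exact mul_le_mul_right (h1.trans (mul_le_mul_right hgood _)) _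
      _ = _ := by ring
  have hpow : t * (t ^ q)⁻¹ * (2 ^ n * t) ^ (q - 1) = (2 ^ n) ^ (q - 1) := by
    rw [ENNReal.mul_rpow_of_nonneg _ _ (by linarith), rpow_eq_mul_rpow_sub_one t hq,
      ENNReal.mul_inv (Or.inl ht0) (Or.inl ht)]
    have h1 : t ^ (q - 1) ≠ 0 := by simp [ENNReal.rpow_eq_zero_iff, ht0, ht]
    have h2 : t ^ (q - 1) ≠ ∞ := by simp [ENNReal.rpow_eq_top_iff, ht0, ht]
    calc t * (t⁻¹ * (t ^ (q - 1))⁻¹) * ((2 ^ n) ^ (q - 1) * t ^ (q - 1))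
        = (t * t⁻¹) * ((t ^ (q - 1))⁻¹ * t ^ (q - 1)) * (2 ^ n) ^ (q - 1) := by ring
      _ = _ := by rw [ENNReal.mul_inv_cancel ht0 ht, ENNReal.inv_mul_cancel h1 h2]; simp
  have hv2 : t * volume Ω ≤ (2 * n) ^ n * ∫⁻ x, ‖u x‖ₑ := by
    calc t * volume Ω ≤ t * ∑ j ∈ F, volume (Q j) := by
          gcongr; exact measure_biUnion_finset_le F Q
      _ = (2 * n) ^ n * ∑ j ∈ F, t * volume (D j) := by
          rw [Finset.mul_sum, Finset.mul_sum]
          refine Finset.sum_congr rfl fun j _ => ?_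
          simp only [Q, hDdef]
          rw [volume_cube, volume_icube, ← mul_assoc 2, ENNReal.ofReal_mul (by positivity),
            ENNReal.ofReal_mul zero_le_two, mul_pow]
          simp only [ENNReal.ofReal_ofNat, ENNReal.ofReal_natCast]
          ring
      _ ≤ (2 * n) ^ n * ∑ j ∈ F, ∫⁻ x in D j, ‖u x‖ₑ := by
          gcongr with j
          exact hlow j
      _ ≤ _ := by gcongr
  have hv3 : t * volume ({x | t ≤ ∑ j ∈ F, ‖𝒯 (b j) x‖ₑ} ∩ Ωᶜ) ≤ 2 * κ * ∫⁻ x, ‖u x‖ₑ := by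
    have hmeas : ∀ j ∈ F, AEMeasurable (fun x => ‖𝒯 (b j) x‖ₑ) (volume.restrict Ωᶜ) := fun j _ =>
      (hT.aestronglyMeasurable _ (hbN j)).enorm.restrict
    calc t * volume ({x | t ≤ ∑ j ∈ F, ‖𝒯 (b j) x‖ₑ} ∩ Ωᶜ)
        ≤ t * volume.restrict Ωᶜ {x | t ≤ ∑ j ∈ F, ‖𝒯 (b j) x‖ₑ} := by
          exact mul_le_mul_right (Measure.le_restrict_apply _ _) _
      _ ≤ ∫⁻ x in Ωᶜ, ∑ j ∈ F, ‖𝒯 (b j) x‖ₑ :=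
          mul_meas_ge_le_lintegral₀ (F.aemeasurable_fun_sum hmeas) t
      _ = ∑ j ∈ F, ∫⁻ x in Ωᶜ, ‖𝒯 (b j) x‖ₑ := lintegral_finsetSum' F hmeas
      _ ≤ ∑ j ∈ F, κ * (2 * ∫⁻ x in D j, ‖u x‖ₑ) := by
          refine Finset.sum_le_sum fun j hj => le_trans (lintegral_mono_set ?_) (hbT j)
          exact Set.compl_subset_compl.2 (Set.subset_biUnion_of_mem (u := Q) hj)
      _ = 2 * κ * ∑ j ∈ F, ∫⁻ x in D j, ‖u x‖ₑ := by
          rw [Finset.mul_sum]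
          exact Finset.sum_congr rfl fun j _ => by ring
      _ ≤ _ := by gcongr
  calc 2 * t * volume {x | 2 * t < ‖𝒯 u x‖ₑ}
      ≤ 2 * (t * volume {x | t ≤ ‖𝒯 g x‖ₑ} + (t * volume Ω +
          t * volume ({x | t ≤ ∑ j ∈ F, ‖𝒯 (b j) x‖ₑ} ∩ Ωᶜ))) := by
        rw [← mul_add, ← mul_add, ← mul_assoc]; gcongr
    _ ≤ 2 * (t * (t ^ q)⁻¹ * B * ((2 ^ n * t) ^ (q - 1) * (∫⁻ x, ‖u x‖ₑ) +
          ∫⁻ x in ⋃ j : {j // j ∉ F}, D j, ‖u x‖ₑ ^ q) +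
          ((2 * n) ^ n * (∫⁻ x, ‖u x‖ₑ) + 2 * κ * ∫⁻ x, ‖u x‖ₑ)) := by gcongr
    _ = 2 * (B * (t * (t ^ q)⁻¹ * (2 ^ n * t) ^ (q - 1)) * (∫⁻ x, ‖u x‖ₑ) +
          ((2 * n) ^ n * (∫⁻ x, ‖u x‖ₑ) + 2 * κ * ∫⁻ x, ‖u x‖ₑ)) +
          2 * (t * (t ^ q)⁻¹ * B * ∫⁻ x in ⋃ j : {j // j ∉ F}, D j, ‖u x‖ₑ ^ q) := by ring
    _ = _ := by rw [hpow, weakConst]; ring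

/-- The **weak type `(1, 1)` inequality** for test functions. -/
theorem IsSIO.weak_type (hT : IsSIO K q B 𝒯) (hK : IsStandardKernel ε C K) (hn : 0 < n)
    (hε : 0 < ε) (hε1 : ε ≤ 1) (hq : 1 < q) (hB : B ≠ ∞) [SMulCommClass ℝ 𝕜 V] [CompleteSpace V]
    {u : EuclideanSpace ℝ (Fin n) → V} (hu : Nice u) (t : ℝ≥0∞) :
    t * volume {x | t < ‖𝒯 u x‖ₑ} ≤ weakConst n q ε C B * ∫⁻ x, ‖u x‖ₑ := by
  rcases eq_or_ne t 0 with rfl | ht0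
  · simp
  rcases eq_or_ne t ∞ with rfl | ht
  · simp
  obtain ⟨t, rfl⟩ : ∃ t', t = 2 * t' :=
    ⟨t / 2, (ENNReal.mul_div_cancel (a := 2) two_ne_zero (by simp)).symm⟩
  have ht0' : t ≠ 0 := by rintro rfl; simp at ht0
  have ht' : t ≠ ∞ := by rintro rfl; simp at ht
  -- a cube that contains the support of `u` and over which the average of `‖u‖` is at most `t`
  obtain ⟨S, hS⟩ := hu.2.2
  set s : ℝ := max 1 (max (2 * S + 2) ((∫⁻ x, ‖u x‖ₑ) / t).toReal) with hs
  have hs1 : 1 ≤ s := le_max_left _ _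
  have hs2 : 2 * S + 2 ≤ s := (le_max_left _ _).trans (le_max_right _ _)
  have hs3 : ((∫⁻ x, ‖u x‖ₑ) / t).toReal ≤ s := (le_max_right _ _).trans (le_max_right _ _)
  let c : EuclideanSpace ℝ (Fin n) := WithLp.toLp 2 fun _ => -s / 2
  have hroot : ∀ x, u x ≠ 0 → x ∈ icube c s := by
    intro x hx i
    have h1 : ‖x‖ ≤ S := by
      by_contra! h
      exact hx (hS x h)
    have h2 := abs_le.1 ((PiLp.norm_apply_le x i).trans h1)
    simp only [c]
    constructor <;> linarith [h2.1, h2.2]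
  have havg : ∫⁻ x in icube c s, ‖u x‖ₑ ≤ t * volume (icube c s) := by
    refine (setLIntegral_le_lintegral _ _).trans ?_
    have h1 : (∫⁻ x, ‖u x‖ₑ) / t ≤ volume (icube c s) := by
      rw [← ENNReal.ofReal_toReal (ENNReal.div_ne_top hu.lintegral_ne_top ht0'), volume_icube,
        ← ENNReal.ofReal_pow (by linarith)]
      exact ENNReal.ofReal_le_ofReal (hs3.trans (le_self_pow₀ hs1 hn.ne'))
    rwa [ENNReal.div_le_iff_le_mul (Or.inl ht0') (Or.inl ht'), mul_comm] at h1
  obtain ⟨P, hP0, -, hdis, hlow, hup, hae⟩ := exists_stopping hn c (by linarith)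
    hu.1.enorm (ne_top_of_le_ne_top hu.lintegral_ne_top (setLIntegral_le_lintegral _ _)) t havg
  have hae' : ∀ᵐ x, (∀ j, x ∉ icube (P j).1 (P j).2) → ‖u x‖ₑ ≤ t := by
    filter_upwards [hae] with x hx hxP
    by_cases h : u x = 0
    · simp [h]
    · exact hx (hroot x h) hxP
  have hmain := fun F => hT.weak_type_aux hK hn hε hε1 hq hu ht0' ht' P hP0 hdis hlow hup hae' F
  have hsum : ∑' j, volume (icube (P j).1 (P j).2) ≠ ∞ := by
    have h1 : t * ∑' j, volume (icube (P j).1 (P j).2) ≤ ∫⁻ x, ‖u x‖ₑ := by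
      rw [← ENNReal.tsum_mul_left]
      calc ∑' j, t * volume (icube (P j).1 (P j).2)
          ≤ ∑' j, ∫⁻ x in icube (P j).1 (P j).2, ‖u x‖ₑ := ENNReal.tsum_le_tsum hlow
        _ = ∫⁻ x in ⋃ j, icube (P j).1 (P j).2, ‖u x‖ₑ :=
          (lintegral_iUnion (fun j => measurableSet_icube _ _) hdis _).symm
        _ ≤ _ := setLIntegral_le_lintegral _ _
    intro h
    rw [h, ENNReal.mul_top ht0'] at h1
    exact hu.lintegral_ne_top (top_le_iff.1 h1)
  have hlim : Tendsto (fun F : Finset (ℕ × (Fin n → ℤ)) =>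
      ∫⁻ x in ⋃ j : {j // j ∉ F}, icube (P j).1 (P j).2, ‖u x‖ₑ ^ q) atTop (𝓝 0) := by
    refine tendsto_setLIntegral_zero (hu.lintegral_rpow_ne_top (by linarith)) ?_
    refine tendsto_of_tendsto_of_tendsto_of_le_of_le tendsto_const_nhds
      (ENNReal.tendsto_tsum_compl_atTop_zero hsum) (fun _ => zero_le) fun F => ?_
    exact measure_iUnion_le _
  have hlim2 : Tendsto (fun F : Finset (ℕ × (Fin n → ℤ)) =>
      weakConst n q ε C B * (∫⁻ x, ‖u x‖ₑ) + 2 * (t * (t ^ q)⁻¹ * B *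
      ∫⁻ x in ⋃ j : {j // j ∉ F}, icube (P j).1 (P j).2, ‖u x‖ₑ ^ q)) atTop
      (𝓝 (weakConst n q ε C B * (∫⁻ x, ‖u x‖ₑ) + 2 * (t * (t ^ q)⁻¹ * B * 0))) := by
    refine tendsto_const_nhds.add (ENNReal.Tendsto.const_mul (ENNReal.Tendsto.const_mul hlim
      (Or.inr ?_)) (Or.inr ENNReal.ofNat_ne_top))
    have : (t ^ q)⁻¹ ≠ ∞ := by
      rw [ENNReal.inv_ne_top, ne_eq, ENNReal.rpow_eq_zero_iff]
      simp [ht0', ht']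
    finiteness
  simp only [mul_zero, add_zero] at hlim2
  exact ge_of_tendsto' hlim2 hmain

end SingularIntegral

/-! ### Oscillation of singular integrals -/

section Oscillation

lemma enorm_le_add_enorm_sub {V : Type*} [NormedAddCommGroup V] (a b : V) : ‖a‖ₑ ≤ ‖b‖ₑ + ‖a - b‖ₑ := by
  calc ‖a‖ₑ = ‖b + (a - b)‖ₑ := by rw [add_sub_cancel]
    _ ≤ _ := enorm_add_le _ _

variable {n : ℕ} {𝕜 V : Type*} [RCLike 𝕜] [NormedAddCommGroup V] [NormedSpace 𝕜 V]
    [NormedSpace ℝ V] {K : EuclideanSpace ℝ (Fin n) → EuclideanSpace ℝ (Fin n) → 𝕜} {q : ℝ}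
    {B : ℝ≥0∞} {𝒯 : (EuclideanSpace ℝ (Fin n) → V) → EuclideanSpace ℝ (Fin n) → V} {ε C : ℝ}

/-- On a cube, `𝒯 u` differs from a constant vector by a multiple of the tail of averages of `‖u‖`,
outside a set of controlled measure: the part of `u` near the cube is handled by the weak type
inequality and the part away from the cube by the smoothness of the kernel. -/
lemma IsSIO.oscillation (hT : IsSIO K q B 𝒯) (hK : IsStandardKernel ε C K) (hn : 0 < n)
    (hε : 0 < ε) (hε1 : ε ≤ 1) (hq : 1 < q) (hB : B ≠ ∞) [SMulCommClass ℝ 𝕜 V] [CompleteSpace V]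
    {u : EuclideanSpace ℝ (Fin n) → V} (hu : Nice u) (c : EuclideanSpace ℝ (Fin n)) {s : ℝ}
    (hs : 0 < s) :
    ∃ v : V, ∀ t : ℝ≥0∞, t * volume {x | x ∈ icube c s ∧
        kernelConst n C * tailAvg ε (fun y => ‖u y‖ₑ) (icenter c s) (n * s) + t < ‖𝒯 u x - v‖ₑ} ≤
      weakConst n q ε C B * (2 * n) ^ n * tailAvg ε (fun y => ‖u y‖ₑ) (icenter c s) (n * s) *
        volume (icube c s) := by
  have hn' : (1 : ℝ) ≤ n := by exact_mod_cast hn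
  set z := icenter c s with hz
  set τ := tailAvg ε (fun y => ‖u y‖ₑ) z (n * s) with hτ
  have hms : MeasurableSet (cube z (n * s)) := measurableSet_cube _ _
  have hρ : 0 < n * s := by positivity
  let u1 := (cube z (n * s)).indicator u
  let u2 := (cube z (n * s))ᶜ.indicator u
  have hu1 : Nice u1 := hu.indicator hms
  have hu2 : Nice u2 := hu.indicator hms.compl
  have h20 : ∀ y ∈ cube z (n * s), u2 y = 0 := fun y hy =>
    Set.indicator_of_notMem (s := (cube z (n * s))ᶜ) (fun h => h hy) _
  have hadd : ∀ᵐ x, 𝒯 u x = 𝒯 u1 x + 𝒯 u2 x := by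
    have := hT.add u1 u2 hu1 hu2
    have e : (fun x => u1 x + u2 x) = u :=
      funext fun x => congrFun (Set.indicator_self_add_compl _ u) x
    rwa [e] at this
  refine ⟨∫ y, K z y • u2 y, fun t => ?_⟩
  have hfar : ∀ᵐ x, x ∈ icube c s → ‖𝒯 u2 x - ∫ y, K z y • u2 y‖ₑ ≤ kernelConst n C * τ := by
    filter_upwards [hT.kernel u2 hu2] with x hx hxQ
    have hxz : x ∈ cube z (s / 2) := icube_subset_cube _ _ hxQ
    rw [hx]
    · refine (hK.enorm_integral_sub_le hn hε hε1 hu2.integrable hρ ?_ h20).trans ?_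
      · have := cube_subset_closedBall z (half_pos hs).le hxz
        rw [mem_closedBall_iff_norm] at this
        linarith
      · rw [kernelConst]
        gcongr
        refine ENNReal.tsum_le_tsum fun m => ?_
        gcongr
        refine ENNReal.div_le_div_right (lintegral_mono fun y => ?_) _
        simp only [u2, enorm_indicator_eq_indicator_enorm]
        exact Set.indicator_le_self _ _ _
    · rw [notMem_tsupport_iff_eventuallyEq]
      filter_upwards [Metric.ball_mem_nhds x (half_pos hs)] with y hy
      refine h20 y fun i => ?_
      have h1 := closedBall_subset_cube x _ (Metric.ball_subset_closedBall hy) i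
      have h2 := hxz i
      calc |y i - z i| = |(y i - x i) + (x i - z i)| := by ring_nf
        _ ≤ |y i - x i| + |x i - z i| := abs_add_le _ _
        _ ≤ n * s := by nlinarith
  calc t * volume {x | x ∈ icube c s ∧
        kernelConst n C * τ + t < ‖𝒯 u x - ∫ y, K z y • u2 y‖ₑ}
      ≤ t * volume {x | t < ‖𝒯 u1 x‖ₑ} := by
        refine mul_le_mul_right (measure_mono_ae ?_) _
        filter_upwards [hfar, hadd] with x h1 h2 h3
        obtain ⟨h3, h4⟩ : x ∈ icube c s ∧
          kernelConst n C * τ + t < ‖𝒯 u x - ∫ y, K z y • u2 y‖ₑ := h3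
        change t < ‖𝒯 u1 x‖ₑ
        by_contra! hcon
        refine absurd h4 (not_lt.2 ?_)
        rw [h2, add_sub_assoc]
        refine (enorm_add_le _ _).trans ?_
        rw [add_comm]
        exact add_le_add (h1 h3) hcon
    _ ≤ weakConst n q ε C B * ∫⁻ x, ‖u1 x‖ₑ := hT.weak_type hK hn hε hε1 hq hB hu1 t
    _ = weakConst n q ε C B * (cubeAvg (fun y => ‖u y‖ₑ) z (n * s) * volume (cube z (n * s))) := by
        simp only [u1, enorm_indicator_eq_indicator_enorm]
        rw [lintegral_indicator hms, cubeAvg,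
          ENNReal.div_mul_cancel (volume_cube_ne_zero z hρ) (volume_cube_ne_top _ _)]
    _ ≤ weakConst n q ε C B * (τ * volume (cube z (n * s))) := by
        gcongr
        exact cubeAvg_le_tailAvg _ _ _ _
    _ = _ := by
        rw [volume_cube, volume_icube, ← mul_assoc 2, ENNReal.ofReal_mul (by positivity),
          ENNReal.ofReal_mul zero_le_two, mul_pow]
        simp only [ENNReal.ofReal_ofNat, ENNReal.ofReal_natCast]
        ring

/-- `g` is a value of `𝒯` at the (not necessarily bounded) function `f`: there are test functions
`u` close to `f` in `L¹` with `𝒯 u` close to `g` in measure. -/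
def Approximable (𝒯 : (EuclideanSpace ℝ (Fin n) → V) → EuclideanSpace ℝ (Fin n) → V)
    (f g : EuclideanSpace ℝ (Fin n) → V) : Prop :=
  ∀ δ : ℝ≥0∞, δ ≠ 0 → ∃ u, Nice u ∧ ∫⁻ x, ‖u x - f x‖ₑ ≤ δ ∧
    volume {x | δ < ‖𝒯 u x - g x‖ₑ} ≤ δ

/-- The weak type `(1, 1)` inequality passes to limits of test functions. -/
lemma IsSIO.weak_type_of_approximable (hT : IsSIO K q B 𝒯) (hK : IsStandardKernel ε C K)
    (hn : 0 < n) (hε : 0 < ε) (hε1 : ε ≤ 1) (hq : 1 < q) (hB : B ≠ ∞) [SMulCommClass ℝ 𝕜 V]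
    [CompleteSpace V] {f g : EuclideanSpace ℝ (Fin n) → V} (hf : AEStronglyMeasurable f)
    (hfg : Approximable 𝒯 f g) (t : ℝ≥0∞) :
    t * volume {x | t < ‖g x‖ₑ} ≤ 2 * weakConst n q ε C B * ∫⁻ x, ‖f x‖ₑ := by
  rcases eq_or_ne t 0 with rfl | ht0
  · simp
  rcases eq_or_ne t ∞ with rfl | ht
  · simp
  set A := weakConst n q ε C B with hA
  have hAtop : A ≠ ∞ := weakConst_ne_top hq hε hB
  have key : ∀ δ : ℝ≥0∞, δ ≠ 0 → δ ≤ t / 2 →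
      t * volume {x | t < ‖g x‖ₑ} ≤ 2 * A * ((∫⁻ x, ‖f x‖ₑ) + δ) + t * δ := by
    intro δ hδ hδt
    obtain ⟨u, hu, h1, h2⟩ := hfg δ hδ
    have h3 : volume {x | t < ‖g x‖ₑ} ≤ volume {x | t / 2 < ‖𝒯 u x‖ₑ} +
        volume {x | δ < ‖𝒯 u x - g x‖ₑ} := by
      refine le_trans (measure_mono fun x hx => ?_) (measure_union_le _ _)
      change t < ‖g x‖ₑ at hx
      change t / 2 < ‖𝒯 u x‖ₑ ∨ δ < ‖𝒯 u x - g x‖ₑ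
      by_contra! hcon
      refine absurd hx (not_lt.2 ((enorm_le_add_enorm_sub (g x) (𝒯 u x)).trans ?_))
      rw [enorm_sub_rev, ← ENNReal.add_halves t]
      exact add_le_add hcon.1 (hcon.2.trans hδt)
    have h4 : ∫⁻ x, ‖u x‖ₑ ≤ (∫⁻ x, ‖f x‖ₑ) + δ := by
      refine le_trans (lintegral_mono fun x => enorm_le_add_enorm_sub (u x) (f x)) ?_
      rw [lintegral_add_left' hf.enorm]
      gcongr
    calc t * volume {x | t < ‖g x‖ₑ}
        ≤ t * (volume {x | t / 2 < ‖𝒯 u x‖ₑ} + volume {x | δ < ‖𝒯 u x - g x‖ₑ}) := by gcongr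
      _ ≤ 2 * (t / 2 * volume {x | t / 2 < ‖𝒯 u x‖ₑ}) + t * δ := by
          rw [mul_add, ← mul_assoc 2, ENNReal.mul_div_cancel two_ne_zero (by simp)]
          gcongr
      _ ≤ 2 * (A * ((∫⁻ x, ‖f x‖ₑ) + δ)) + t * δ := by
          exact add_le_add (mul_le_mul_right ((hT.weak_type hK hn hε hε1 hq hB hu (t / 2)).trans
            (mul_le_mul_right h4 _)) 2) le_rfl
      _ = _ := by rw [← mul_assoc]
  have hlim : Tendsto (fun δ : ℝ≥0∞ => 2 * A * ((∫⁻ x, ‖f x‖ₑ) + δ) + t * δ) (𝓝[>] 0)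
      (𝓝 (2 * A * ((∫⁻ x, ‖f x‖ₑ) + 0) + t * 0)) := by
    have hid : Tendsto (fun δ : ℝ≥0∞ => δ) (𝓝[>] 0) (𝓝 0) := nhdsWithin_le_nhds
    exact (ENNReal.Tendsto.const_mul (tendsto_const_nhds.add hid) (Or.inr (by finiteness))).add
      (ENNReal.Tendsto.const_mul hid (Or.inr ht))
  simp only [add_zero, mul_zero] at hlim
  refine ge_of_tendsto hlim ?_
  have ht2 : 0 < t / 2 := ENNReal.half_pos ht0
  filter_upwards [self_mem_nhdsWithin, nhdsWithin_le_nhds (Iic_mem_nhds ht2)] with δ h1 h2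
  exact key δ (ne_of_gt h1) h2

/-- The constant in the oscillation estimate for values of singular integrals. -/
noncomputable def oscConst (n : ℕ) (q ε C : ℝ) (B : ℝ≥0∞) : ℝ≥0∞ :=
  2 * kernelConst n C + 2 ^ (n + 4) * (weakConst n q ε C B * (2 * n) ^ n) + 1

lemma oscConst_ne_top {n : ℕ} {q ε C : ℝ} (hq : 1 < q) (hε : 0 < ε) {B : ℝ≥0∞} (hB : B ≠ ∞) :
    oscConst n q ε C B ≠ ∞ := by
  have h1 := kernelConst_ne_top n C
  have h2 := weakConst_ne_top (n := n) (C := C) hq hε hB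
  rw [oscConst]
  finiteness

/-- The oscillation estimate for values of singular integrals at integrable functions. -/
lemma IsSIO.oscillation_of_approximable (hT : IsSIO K q B 𝒯) (hK : IsStandardKernel ε C K)
    (hn : 0 < n) (hε : 0 < ε) (hε1 : ε ≤ 1) (hq : 1 < q) (hB : B ≠ ∞) [SMulCommClass ℝ 𝕜 V]
    [CompleteSpace V] {f g : EuclideanSpace ℝ (Fin n) → V} (hf : AEStronglyMeasurable f)
    (hfg : Approximable 𝒯 f g) (c : EuclideanSpace ℝ (Fin n)) {s : ℝ} (hs : 0 < s)
    (h0 : tailAvg ε (fun y => ‖f y‖ₑ) (icenter c s) (n * s) ≠ 0)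
    (htop : tailAvg ε (fun y => ‖f y‖ₑ) (icenter c s) (n * s) ≠ ∞) :
    ∃ v : V, volume {x | x ∈ icube c s ∧ oscConst n q ε C B *
        tailAvg ε (fun y => ‖f y‖ₑ) (icenter c s) (n * s) < ‖g x - v‖ₑ} ≤
      (2 ^ (n + 2))⁻¹ * volume (icube c s) := by
  have hn' : (1 : ℝ) ≤ n := by exact_mod_cast hn
  set z := icenter c s with hz
  set a := tailAvg ε (fun y => ‖f y‖ₑ) z (n * s) with ha
  set A := weakConst n q ε C B * (2 * n) ^ n with hA
  have hAtop : A ≠ ∞ := by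
    have := weakConst_ne_top (n := n) (C := C) hq hε hB
    rw [hA]; finiteness
  have hA0 : A ≠ 0 := mul_ne_zero (weakConst_ne_zero hn) (pow_ne_zero _ (by simp [hn.ne']))
  have hQ0 : volume (icube c s) ≠ 0 := volume_icube_ne_zero c hs
  have hQ : volume (icube c s) ≠ ∞ := volume_icube_ne_top c s
  have hg0 : geomConst ε ≠ 0 := by simp [geomConst]
  have hg := geomConst_ne_top hε
  -- `δ` is so small that the error is negligible in the tail, in the size and in measure
  set δ := min a (min ((2 ^ (n + 3))⁻¹ * volume (icube c s)) (a * volume (icube c s) / geomConst ε))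
    with hδ
  have hδ0 : δ ≠ 0 := by
    have h1 : 0 < (2 ^ (n + 3) : ℝ≥0∞)⁻¹ * volume (icube c s) :=
      ENNReal.mul_pos (by simp) hQ0
    have h2 : 0 < a * volume (icube c s) / geomConst ε :=
      ENNReal.div_pos (mul_ne_zero h0 hQ0) hg
    exact (lt_min (pos_iff_ne_zero.2 h0) (lt_min h1 h2)).ne'
  obtain ⟨u, hu, h1, h2⟩ := hfg δ hδ0
  -- the tail of `‖u‖` is at most twice the tail of `‖f‖`
  have htail : tailAvg ε (fun y => ‖u y‖ₑ) z (n * s) ≤ 2 * a := by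
    refine (tailAvg_add_le ε (h₁ := fun y => ‖f y‖ₑ) (h₂ := fun y => ‖u y - f y‖ₑ) hf.enorm
      (fun y => enorm_le_add_enorm_sub _ _) z _).trans ?_
    rw [two_mul]
    gcongr
    have h3 : ∀ m : ℕ, cubeAvg (fun y => ‖u y - f y‖ₑ) z (2 ^ m * (n * s)) ≤
        δ / volume (icube c s) := by
      intro m
      rw [cubeAvg]
      gcongr
      · exact (setLIntegral_le_lintegral _ _).trans h1
      · refine (icube_subset_cube c s).trans (cube_mono z ?_)
        refine le_trans ?_ (le_two_pow_mul (by positivity) m)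
        nlinarith
    refine (tailAvg_le ε h3).trans ?_
    calc geomConst ε * (δ / volume (icube c s))
        ≤ geomConst ε * (a * volume (icube c s) / geomConst ε / volume (icube c s)) := by
          gcongr
          exact (min_le_right _ _).trans (min_le_right _ _)
      _ = a := by
          simp only [div_eq_mul_inv]
          calc geomConst ε * (a * volume (icube c s) * (geomConst ε)⁻¹ * (volume (icube c s))⁻¹)
              = a * (geomConst ε * (geomConst ε)⁻¹) *
                (volume (icube c s) * (volume (icube c s))⁻¹) := by ring
            _ = a := by
              rw [ENNReal.mul_inv_cancel hg0 hg, ENNReal.mul_inv_cancel hQ0 hQ, mul_one, mul_one]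
  obtain ⟨v, hv⟩ := hT.oscillation hK hn hε hε1 hq hB hu c hs
  refine ⟨v, ?_⟩
  -- the height at which the weak type inequality leaves a set of measure `2 ^ (-n - 3) * |Q|`
  set t := 2 ^ (n + 3) * (A * (2 * a)) with ht
  have ht0 : t ≠ 0 := by
    rw [ht]
    exact mul_ne_zero (by simp) (mul_ne_zero hA0 (mul_ne_zero two_ne_zero h0))
  have httop : t ≠ ∞ := by rw [ht]; finiteness
  have hvt : volume {x | x ∈ icube c s ∧
      kernelConst n C * tailAvg ε (fun y => ‖u y‖ₑ) z (n * s) + t < ‖𝒯 u x - v‖ₑ} ≤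
      (2 ^ (n + 3))⁻¹ * volume (icube c s) := by
    rw [← ENNReal.mul_le_mul_iff_right ht0 httop]
    refine (hv t).trans ?_
    calc A * tailAvg ε (fun y => ‖u y‖ₑ) z (n * s) * volume (icube c s)
        ≤ A * (2 * a) * volume (icube c s) := by gcongr
      _ = (2 ^ (n + 3) * (2 ^ (n + 3))⁻¹) * (A * (2 * a) * volume (icube c s)) := by
          rw [ENNReal.mul_inv_cancel (by simp) (by simp), one_mul]
      _ = _ := by rw [ht]; ring
  calc volume {x | x ∈ icube c s ∧ oscConst n q ε C B * a < ‖g x - v‖ₑ}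
      ≤ volume {x | x ∈ icube c s ∧
          kernelConst n C * tailAvg ε (fun y => ‖u y‖ₑ) z (n * s) + t < ‖𝒯 u x - v‖ₑ} +
        volume {x | δ < ‖𝒯 u x - g x‖ₑ} := by
        refine le_trans (measure_mono fun x hx => ?_) (measure_union_le _ _)
        obtain ⟨hxQ, hx⟩ : x ∈ icube c s ∧ oscConst n q ε C B * a < ‖g x - v‖ₑ := hx
        by_contra hcon
        simp only [Set.mem_union, Set.mem_ofPred_eq, not_or, not_and, not_lt] at hcon
        refine absurd hx (not_lt.2 ?_)
        calc ‖g x - v‖ₑ ≤ ‖𝒯 u x - v‖ₑ + ‖g x - v - (𝒯 u x - v)‖ₑ := enorm_le_add_enorm_sub _ _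
          _ = ‖𝒯 u x - v‖ₑ + ‖𝒯 u x - g x‖ₑ := by
              rw [sub_sub_sub_cancel_right, enorm_sub_rev (g x)]
          _ ≤ (kernelConst n C * (2 * a) + t) + a := by
              gcongr
              · exact (hcon.1 hxQ).trans (by gcongr)
              · exact hcon.2.trans (min_le_left _ _)
          _ = oscConst n q ε C B * a := by
              rw [oscConst, ht, hA, show n + 4 = n + 3 + 1 by rfl, pow_succ 2 (n + 3)]
              ring
    _ ≤ (2 ^ (n + 3))⁻¹ * volume (icube c s) + (2 ^ (n + 3))⁻¹ * volume (icube c s) := by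
        gcongr
        exact h2.trans ((min_le_right _ _).trans (min_le_left _ _))
    _ = (2 ^ (n + 2))⁻¹ * volume (icube c s) := by
        rw [← two_mul, ← mul_assoc]
        congr 1
        rw [show n + 3 = n + 2 + 1 by rfl, pow_succ 2 (n + 2),
          ENNReal.mul_inv (by simp) (by simp), mul_left_comm,
          ENNReal.mul_inv_cancel two_ne_zero (by simp), mul_one]

end Oscillation

/-! ### Sparse domination -/

lemma icube_eq_empty {n : ℕ} (hn : 0 < n) (c : EuclideanSpace ℝ (Fin n)) {s : ℝ} (hs : s ≤ 0) :
    icube c s = ∅ := by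
  rw [Set.eq_empty_iff_forall_notMem]
  intro x hx
  linarith [(hx ⟨0, hn⟩).1, (hx ⟨0, hn⟩).2]

lemma pos_of_mem_icube {n : ℕ} (hn : 0 < n) {c x : EuclideanSpace ℝ (Fin n)} {s : ℝ}
    (hx : x ∈ icube c s) : 0 < s := by
  by_contra! h
  rw [icube_eq_empty hn c h] at hx
  exact hx

/-- The half-open cube given by a pair (corner, side length). -/
def nodeSet {n : ℕ} (Q : EuclideanSpace ℝ (Fin n) × ℝ) : Set (EuclideanSpace ℝ (Fin n)) :=
  icube Q.1 Q.2

lemma measurableSet_nodeSet {n : ℕ} (Q : EuclideanSpace ℝ (Fin n) × ℝ) :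
    MeasurableSet (nodeSet Q) := measurableSet_icube _ _

/-- A tree of cubes in which the children of each cube are disjoint subcubes covering at most half
of it. -/
structure IsSparse {n : ℕ} {ι : Type*}
    (ch : EuclideanSpace ℝ (Fin n) × ℝ → ι → EuclideanSpace ℝ (Fin n) × ℝ) : Prop where
  subset : ∀ Q j, nodeSet (ch Q j) ⊆ nodeSet Q
  disjoint : ∀ Q, Pairwise (Function.onFun Disjoint fun j => nodeSet (ch Q j))
  half : ∀ Q, ∑' j, volume (nodeSet (ch Q j)) ≤ 2⁻¹ * volume (nodeSet Q)

section Sparse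

variable {n : ℕ} {ι : Type*} {ch : EuclideanSpace ℝ (Fin n) × ℝ → ι → EuclideanSpace ℝ (Fin n) × ℝ}

lemma IsSparse.treeSum_volume_le (h : IsSparse ch) (d : ℕ) (Q : EuclideanSpace ℝ (Fin n) × ℝ) :
    treeSum ch (fun Q => volume (nodeSet Q)) d Q ≤ 2 * volume (nodeSet Q) := by
  induction d generalizing Q with
  | zero =>
    rw [two_mul]
    exact le_self_add
  | succ d ih =>
    calc volume (nodeSet Q) + ∑' j, treeSum ch (fun Q => volume (nodeSet Q)) d (ch Q j)
        ≤ volume (nodeSet Q) + ∑' j, 2 * volume (nodeSet (ch Q j)) :=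
          add_le_add le_rfl (ENNReal.tsum_le_tsum fun j => ih _)
      _ ≤ volume (nodeSet Q) + 2 * (2⁻¹ * volume (nodeSet Q)) := by
          rw [ENNReal.tsum_mul_left]
          exact add_le_add le_rfl (mul_le_mul_right (h.half Q) 2)
      _ = 2 * volume (nodeSet Q) := by
          rw [← mul_assoc, ENNReal.mul_inv_cancel two_ne_zero (by simp), one_mul, two_mul]

lemma treeFun_monotone {α X : Type*} {ch : α → ι → α} (S : α → Set X) (φ : α → ℝ≥0∞) (a : α)
    (x : X) : Monotone fun d => treeFun ch S φ d a x :=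
  monotone_nat_of_le_succ fun d => treeSum_mono_depth _ d a

lemma le_treeFun {α X : Type*} {ch : α → ι → α} {S : α → Set X} (φ : α → ℝ≥0∞) (d : ℕ) {a : α}
    {x : X} (hx : x ∈ S a) : φ a ≤ treeFun ch S φ d a x := by
  refine le_trans ?_ (treeFun_monotone S φ a x (Nat.zero_le d))
  simp [treeFun, treeSum, Set.indicator_of_mem hx]

/-- Almost every point belongs to finitely many cubes of a sparse tree. -/
lemma IsSparse.ae_treeFun_lt_top [Countable ι] (h : IsSparse ch)
    (Q : EuclideanSpace ℝ (Fin n) × ℝ) :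
    ∀ᵐ x, ⨆ d, treeFun ch nodeSet (fun _ => 1) d Q x < ∞ := by
  have hm := fun d => measurable_treeFun (ch := ch) (measurableSet_nodeSet (n := n)) (fun _ => 1) d Q
  refine ae_lt_top (Measurable.iSup hm) (ne_top_of_le_ne_top (b := 2 * volume (nodeSet Q)) ?_ ?_)
  · exact ENNReal.mul_ne_top (by simp) (volume_icube_ne_top _ _)
  · rw [lintegral_iSup hm fun d e hde x => treeFun_monotone _ _ _ _ hde]
    refine iSup_le fun d => le_trans (le_of_eq ?_) (h.treeSum_volume_le d Q)
    simp only [treeFun]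
    rw [lintegral_treeSum (F := fun a => (nodeSet a).indicator fun _ => 1)
      fun a => measurable_const.indicator (measurableSet_nodeSet a)]
    congr 1
    funext a
    rw [lintegral_indicator (measurableSet_nodeSet a), setLIntegral_const, one_mul]

/-- One step of the stopping time construction: cubes that cover the exceptional set `A` of a cube,
contain a fixed proportion of it, and are not filled by it. -/
lemma exists_subcubes (hn : 0 < n) (Q : EuclideanSpace ℝ (Fin n) × ℝ)
    {A : Set (EuclideanSpace ℝ (Fin n))} (hA : MeasurableSet A)
    (hvol : volume A ≤ (2 ^ (n + 2))⁻¹ * volume (nodeSet Q)) :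
    ∃ P : ℕ × (Fin n → ℤ) → EuclideanSpace ℝ (Fin n) × ℝ,
      (∀ j, nodeSet (P j) ⊆ nodeSet Q) ∧
      Pairwise (Function.onFun Disjoint fun j => nodeSet (P j)) ∧
      (∑' j, volume (nodeSet (P j)) ≤ 2⁻¹ * volume (nodeSet Q)) ∧
      (∀ j, volume (A ∩ nodeSet (P j)) ≤ 2⁻¹ * volume (nodeSet (P j))) ∧
      ∀ᵐ x, x ∈ nodeSet Q → (∀ j, x ∉ nodeSet (P j)) → x ∉ A := by
  rcases le_or_gt Q.2 0 with hQ | hQ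
  · have he : nodeSet Q = ∅ := icube_eq_empty hn _ hQ
    exact ⟨fun _ => Q, by simp [he, Pairwise]⟩
  have hind : ∀ B : Set (EuclideanSpace ℝ (Fin n)),
      ∫⁻ x in B, A.indicator (fun _ => 1) x = volume (A ∩ B) := fun B => by
    rw [lintegral_indicator hA, setLIntegral_const, one_mul, Measure.restrict_apply hA]
  have h2 : (2 ^ n : ℝ≥0∞) * (2 ^ (n + 1))⁻¹ = 2⁻¹ := by
    rw [pow_succ, ENNReal.mul_inv (by simp) (by simp), ← mul_assoc,
      ENNReal.mul_inv_cancel (by simp) (by simp), one_mul]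
  have hpow : (2 ^ (n + 2) : ℝ≥0∞)⁻¹ = (2 ^ (n + 1))⁻¹ * 2⁻¹ := by
    rw [show n + 2 = n + 1 + 1 by rfl, pow_succ 2 (n + 1), ENNReal.mul_inv (by simp) (by simp)]
  obtain ⟨P, -, hsub, hdis, hlow, hup, hae⟩ := exists_stopping hn Q.1 hQ.le
    (h := A.indicator fun _ => 1) (measurable_const.indicator hA)
    (by
      rw [hind]
      exact measure_ne_top_of_subset Set.inter_subset_right (volume_icube_ne_top _ _))
    (2 ^ (n + 1))⁻¹ (by
      rw [hind]
      refine (measure_mono Set.inter_subset_left).trans (hvol.trans ?_)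
      rw [hpow]
      refine mul_le_mul_left ?_ _
      exact mul_le_of_le_one_right' (by simp))
  refine ⟨P, hsub, hdis, ?_, fun j => ?_, ?_⟩
  · have h3 : (2 ^ (n + 1))⁻¹ * ∑' j, volume (nodeSet (P j)) ≤
        (2 ^ (n + 1))⁻¹ * (2⁻¹ * volume (nodeSet Q)) := by
      calc (2 ^ (n + 1))⁻¹ * ∑' j, volume (nodeSet (P j))
          = ∑' j, (2 ^ (n + 1))⁻¹ * volume (nodeSet (P j)) := ENNReal.tsum_mul_left.symm
        _ ≤ ∑' j, volume (A ∩ nodeSet (P j)) := by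
            refine ENNReal.tsum_le_tsum fun j => (hlow j).trans (le_of_eq (hind _))
        _ = volume (⋃ j, A ∩ nodeSet (P j)) := by
            rw [measure_iUnion]
            · exact fun i j hij => (hdis hij).mono Set.inter_subset_right Set.inter_subset_right
            · exact fun j => hA.inter (measurableSet_nodeSet _)
        _ ≤ volume A := measure_mono (Set.iUnion_subset fun j => Set.inter_subset_left)
        _ ≤ _ := by rw [← mul_assoc, ← hpow]; exact hvol
    rwa [ENNReal.mul_le_mul_iff_right (by simp) (by simp)] at h3
  · have := hup j
    rwa [hind, h2] at this
  · filter_upwards [hae] with x hx hxQ hxP hxA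
    have := hx hxQ hxP
    rw [Set.indicator_of_mem hxA] at this
    refine absurd this (not_le.2 ?_)
    rw [ENNReal.inv_lt_one]
    exact one_lt_pow₀ (by norm_num) (by omega)

/-- **Sparse domination**: a function which on each cube `Q` is within `a Q` of a constant, outside
a small part of `Q`, is controlled on every cube by the sum of the `a P` over a sparse tree. -/
lemma exists_isSparse_dominating {V : Type*} [NormedAddCommGroup V] (hn : 0 < n)
    {g : EuclideanSpace ℝ (Fin n) → V} (hg : StronglyMeasurable g)
    (a : EuclideanSpace ℝ (Fin n) × ℝ → ℝ≥0∞) (v : EuclideanSpace ℝ (Fin n) × ℝ → V)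
    (hosc : ∀ Q, 0 < Q.2 → volume {x | x ∈ nodeSet Q ∧ a Q < ‖g x - v Q‖ₑ} ≤
      (2 ^ (n + 2))⁻¹ * volume (nodeSet Q)) :
    ∃ ch : EuclideanSpace ℝ (Fin n) × ℝ → ℕ × (Fin n → ℤ) → EuclideanSpace ℝ (Fin n) × ℝ,
      IsSparse ch ∧ ∀ Q, ∀ᵐ x, x ∈ nodeSet Q →
        ‖g x - v Q‖ₑ ≤ 2 * ⨆ d, treeFun ch nodeSet a d Q x := by
  set A : EuclideanSpace ℝ (Fin n) × ℝ → Set (EuclideanSpace ℝ (Fin n)) := fun Q =>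
    {x | x ∈ nodeSet Q ∧ a Q < ‖g x - v Q‖ₑ} with hAdef
  have hAm : ∀ Q, MeasurableSet (A Q) := fun Q => (measurableSet_nodeSet Q).inter
    (measurableSet_lt measurable_const (hg.sub stronglyMeasurable_const).enorm)
  have hAvol : ∀ Q, volume (A Q) ≤ (2 ^ (n + 2))⁻¹ * volume (nodeSet Q) := by
    intro Q
    rcases le_or_gt Q.2 0 with hQ | hQ
    · have he : nodeSet Q = ∅ := icube_eq_empty hn _ hQ
      simp [A, he]
    · exact hosc Q hQ
  choose ch hsub hdis hhalf hfill hcov using fun Q =>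
    exists_subcubes hn Q (hAm Q) (hAvol Q)
  have hsp : IsSparse ch := ⟨hsub, hdis, hhalf⟩
  -- the constants of a cube and of its child differ little, as the exceptional sets do not
  -- cover the child
  have hnear : ∀ Q j, ∀ x ∈ nodeSet (ch Q j), ‖v (ch Q j) - v Q‖ₑ ≤ a (ch Q j) + a Q := by
    intro Q j x₀ hx₀
    set P := ch Q j with hP
    have hP0 : 0 < P.2 := pos_of_mem_icube hn hx₀
    have hv0 : volume (nodeSet P) ≠ 0 := volume_icube_ne_zero _ hP0
    have hv1 : volume (nodeSet P) ≠ ∞ := volume_icube_ne_top _ _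
    have hlt : volume (A Q ∩ nodeSet P ∪ A P) < volume (nodeSet P) := by
      calc volume (A Q ∩ nodeSet P ∪ A P)
          ≤ 2⁻¹ * volume (nodeSet P) + (2 ^ (n + 2))⁻¹ * volume (nodeSet P) :=
            (measure_union_le _ _).trans (add_le_add (hfill Q j) (hAvol P))
        _ < 2⁻¹ * volume (nodeSet P) + 2⁻¹ * volume (nodeSet P) := by
            refine ENNReal.add_lt_add_left (by finiteness) ?_
            refine ENNReal.mul_lt_mul_left hv0 hv1 ?_
            rw [ENNReal.inv_lt_inv]
            have h2 : 2 < 2 ^ (n + 2) := by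
              calc 2 = 2 ^ 1 := (pow_one _).symm
                _ < 2 ^ (n + 2) := Nat.pow_lt_pow_right (by norm_num) (by omega)
            exact_mod_cast h2
        _ = volume (nodeSet P) := by
            rw [← add_mul, ENNReal.inv_two_add_inv_two, one_mul]
    obtain ⟨x, hxP, hx⟩ : ∃ x ∈ nodeSet P, x ∉ A Q ∩ nodeSet P ∪ A P := by
      by_contra! hcon
      exact absurd hlt (not_lt.2 (measure_mono hcon))
    have h1 : ‖g x - v Q‖ₑ ≤ a Q := by
      by_contra! h
      exact hx (Or.inl ⟨⟨hsub Q j hxP, h⟩, hxP⟩)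
    have h2 : ‖g x - v P‖ₑ ≤ a P := by
      by_contra! h
      exact hx (Or.inr ⟨hxP, h⟩)
    calc ‖v P - v Q‖ₑ = ‖(g x - v Q) - (g x - v P)‖ₑ := by rw [sub_sub_sub_cancel_left]
      _ ≤ ‖g x - v Q‖ₑ + ‖g x - v P‖ₑ := enorm_sub_le
      _ ≤ a P + a Q := by rw [add_comm]; exact add_le_add h2 h1
  refine ⟨ch, hsp, fun Q => ?_⟩
  -- either `x` lies in cubes of each depth up to `d + 1`, or the first `d` generations control `g`
  have claim : ∀ (d : ℕ) Q, ∀ᵐ x, x ∈ nodeSet Q →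
      ((d + 2 : ℕ) : ℝ≥0∞) ≤ treeFun ch nodeSet (fun _ => 1) (d + 1) Q x ∨
      ‖g x - v Q‖ₑ + a Q ≤ 2 * treeFun ch nodeSet a d Q x := by
    have hout : ∀ (d : ℕ) Q x, x ∈ nodeSet Q → x ∉ A Q →
        ‖g x - v Q‖ₑ + a Q ≤ 2 * treeFun ch nodeSet a d Q x := by
      intro d Q x hxQ hxA
      have h1 : ‖g x - v Q‖ₑ ≤ a Q := by
        by_contra! h
        exact hxA ⟨hxQ, h⟩
      rw [two_mul]
      exact add_le_add (h1.trans (le_treeFun a d hxQ)) (le_treeFun a d hxQ)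
    intro d
    induction d with
    | zero =>
      intro Q
      filter_upwards [hcov Q] with x hx hxQ
      by_cases hj : ∃ j, x ∈ nodeSet (ch Q j)
      · obtain ⟨j, hj⟩ := hj
        left
        refine le_trans ?_ (treeFun_of_mem_child hsub _ 0 Q hj)
        refine le_trans (le_of_eq ?_) (add_le_add le_rfl (le_treeFun (fun _ => 1) 0 hj))
        norm_num
      · push Not at hj
        exact Or.inr (hout 0 Q x hxQ (hx hxQ hj))
    | succ d ih =>
      intro Q
      filter_upwards [hcov Q, ae_all_iff.2 fun j => ih (ch Q j)] with x hx hih hxQ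
      by_cases hj : ∃ j, x ∈ nodeSet (ch Q j)
      · obtain ⟨j, hj⟩ := hj
        rcases hih j hj with h | h
        · left
          refine le_trans ?_ (treeFun_of_mem_child hsub _ (d + 1) Q hj)
          refine le_trans (le_of_eq ?_) (add_le_add le_rfl h)
          push_cast
          ring
        · right
          calc ‖g x - v Q‖ₑ + a Q
              ≤ (‖g x - v (ch Q j)‖ₑ + ‖v (ch Q j) - v Q‖ₑ) + a Q := by
                gcongr
                rw [← sub_add_sub_cancel (g x) (v (ch Q j))]
                exact enorm_add_le _ _
            _ ≤ (‖g x - v (ch Q j)‖ₑ + (a (ch Q j) + a Q)) + a Q := by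
                gcongr
                exact hnear Q j x hj
            _ = (‖g x - v (ch Q j)‖ₑ + a (ch Q j)) + 2 * a Q := by ring
            _ ≤ 2 * treeFun ch nodeSet a d (ch Q j) x + 2 * a Q := by gcongr
            _ = 2 * (a Q + treeFun ch nodeSet a d (ch Q j) x) := by ring
            _ ≤ _ := mul_le_mul_right (treeFun_of_mem_child hsub a d Q hj) 2
      · push Not at hj
        exact Or.inr (hout (d + 1) Q x hxQ (hx hxQ hj))
  filter_upwards [ae_all_iff.2 fun d => claim d Q, hsp.ae_treeFun_lt_top Q] with x hx hfin hxQ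
  obtain ⟨N, hN⟩ := ENNReal.exists_nat_gt hfin.ne
  rcases hx N hxQ with h | h
  · refine absurd (h.trans (le_iSup (fun d => treeFun ch nodeSet (fun _ => 1) d Q x) (N + 1)))
      (not_le.2 (hN.trans ?_))
    exact_mod_cast (by omega : N < N + 2)
  · calc ‖g x - v Q‖ₑ ≤ ‖g x - v Q‖ₑ + a Q := le_self_add
      _ ≤ 2 * treeFun ch nodeSet a N Q x := h
      _ ≤ _ := mul_le_mul_right (le_iSup (fun d => treeFun ch nodeSet a d Q x) N) 2

/-! ### Wilson's constant and the Carleson condition -/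

lemma volume_nodeSet_eq_cube (Q : EuclideanSpace ℝ (Fin n) × ℝ) :
    volume (nodeSet Q) = volume (cube (icenter Q.1 Q.2) (Q.2 / 2)) :=
  measure_congr (icube_ae_eq_cube _ _)

/-- The parts of the cubes not covered by their children are disjoint and not too small, so the sum
of the measures of the cubes is controlled by the integral of a maximal function. -/
lemma IsSparse.treeSum_measure_le [Countable ι] (h : IsSparse ch)
    {ν : Measure (EuclideanSpace ℝ (Fin n))} (hn : 0 < n)
    {m : EuclideanSpace ℝ (Fin n) → ℝ≥0∞}
    (R : Set (EuclideanSpace ℝ (Fin n)))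
    (hR : ∀ Q, nodeSet Q ⊆ R → ∀ x ∈ nodeSet Q, ν (nodeSet Q) / volume (nodeSet Q) ≤ m x)
    (d : ℕ) (Q : EuclideanSpace ℝ (Fin n) × ℝ) (hQ : nodeSet Q ⊆ R) :
    treeSum ch (fun Q => ν (nodeSet Q)) d Q ≤ 2 * ∫⁻ x in nodeSet Q, m x := by
  have hU : ∀ Q, MeasurableSet (⋃ j, nodeSet (ch Q j)) := fun Q =>
    MeasurableSet.iUnion fun j => measurableSet_nodeSet _
  have key : ∀ Q, nodeSet Q ⊆ R →
      ν (nodeSet Q) ≤ 2 * ∫⁻ x in nodeSet Q \ ⋃ j, nodeSet (ch Q j), m x := by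
    intro Q hQ
    rcases le_or_gt Q.2 0 with h0 | h0
    · have he : nodeSet Q = ∅ := icube_eq_empty hn _ h0
      simp [he]
    have hv0 : volume (nodeSet Q) ≠ 0 := volume_icube_ne_zero _ h0
    have hv1 : volume (nodeSet Q) ≠ ∞ := volume_icube_ne_top _ _
    have hhalf : volume (nodeSet Q) ≤ 2 * volume (nodeSet Q \ ⋃ j, nodeSet (ch Q j)) := by
      have h1 : volume (nodeSet Q) ≤
          volume (nodeSet Q \ ⋃ j, nodeSet (ch Q j)) + 2⁻¹ * volume (nodeSet Q) := by
        calc volume (nodeSet Q) ≤ volume ((nodeSet Q \ ⋃ j, nodeSet (ch Q j)) ∪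
              ⋃ j, nodeSet (ch Q j)) := measure_mono (by simp)
          _ ≤ _ := (measure_union_le _ _).trans
            (add_le_add le_rfl ((measure_iUnion_le _).trans (h.half Q)))
      have h2 : 2⁻¹ * volume (nodeSet Q) + 2⁻¹ * volume (nodeSet Q) = volume (nodeSet Q) := by
        rw [← add_mul, ENNReal.inv_two_add_inv_two, one_mul]
      have h3 : 2⁻¹ * volume (nodeSet Q) ≤ volume (nodeSet Q \ ⋃ j, nodeSet (ch Q j)) := by
        nth_rewrite 1 [← h2] at h1
        exact (ENNReal.add_le_add_iff_right (by finiteness)).1 h1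
      calc volume (nodeSet Q) = 2 * (2⁻¹ * volume (nodeSet Q)) := by
            rw [← mul_assoc, ENNReal.mul_inv_cancel two_ne_zero (by simp), one_mul]
        _ ≤ _ := mul_le_mul_right h3 2
    calc ν (nodeSet Q) = ν (nodeSet Q) / volume (nodeSet Q) * volume (nodeSet Q) :=
          (ENNReal.div_mul_cancel hv0 hv1).symm
      _ ≤ ν (nodeSet Q) / volume (nodeSet Q) *
          (2 * volume (nodeSet Q \ ⋃ j, nodeSet (ch Q j))) := mul_le_mul_right hhalf _
      _ = 2 * ∫⁻ x in nodeSet Q \ ⋃ j, nodeSet (ch Q j),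
          ν (nodeSet Q) / volume (nodeSet Q) := by rw [setLIntegral_const]; ring
      _ ≤ _ := by
          refine mul_le_mul_right (setLIntegral_mono' ((measurableSet_nodeSet Q).diff (hU Q))
            fun x hx => hR Q hQ x hx.1) 2
  induction d generalizing Q with
  | zero =>
    exact (key Q hQ).trans (mul_le_mul_right (lintegral_mono_set Set.sdiff_subset) 2)
  | succ d ih =>
    calc ν (nodeSet Q) + ∑' j, treeSum ch (fun Q => ν (nodeSet Q)) d (ch Q j)
        ≤ (2 * ∫⁻ x in nodeSet Q \ ⋃ j, nodeSet (ch Q j), m x) +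
          ∑' j, 2 * ∫⁻ x in nodeSet (ch Q j), m x :=
          add_le_add (key Q hQ) (ENNReal.tsum_le_tsum fun j => ih _ ((h.subset Q j).trans hQ))
      _ = 2 * ((∫⁻ x in nodeSet Q \ ⋃ j, nodeSet (ch Q j), m x) +
          ∫⁻ x in ⋃ j, nodeSet (ch Q j), m x) := by
          rw [ENNReal.tsum_mul_left, lintegral_iUnion (fun j => measurableSet_nodeSet _)
            (h.disjoint Q), mul_add]
      _ = 2 * ∫⁻ x in nodeSet Q, m x := by
          rw [← lintegral_union (hU Q) Set.disjoint_sdiff_left,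
            Set.sdiff_union_of_subset (Set.iUnion_subset (h.subset Q))]

/-- A sparse tree satisfies the Carleson condition with respect to a weight, with a constant
proportional to Wilson's constant. -/
lemma IsSparse.treeSum_withDensity_le [Countable ι] (h : IsSparse ch) (hn : 0 < n)
    {w : EuclideanSpace ℝ (Fin n) → ℝ≥0}
    (hloc : ∀ a r, ∫⁻ x in cube a r, (w x : ℝ≥0∞) ≠ ∞) (d : ℕ)
    (Q : EuclideanSpace ℝ (Fin n) × ℝ) :
    treeSum ch (fun Q => (volume.withDensity fun x => (w x : ℝ≥0∞)) (nodeSet Q)) d Q ≤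
      2 * wilsonConst w * (volume.withDensity fun x => (w x : ℝ≥0∞)) (nodeSet Q) := by
  have hν : ∀ P : EuclideanSpace ℝ (Fin n) × ℝ,
      (volume.withDensity fun x => (w x : ℝ≥0∞)) (nodeSet P) =
        ∫⁻ x in cube (icenter P.1 P.2) (P.2 / 2), (w x : ℝ≥0∞) := fun P => by
    rw [withDensity_apply _ (measurableSet_nodeSet P)]
    exact setLIntegral_congr (icube_ae_eq_cube _ _)
  set R := cube (icenter Q.1 Q.2) (Q.2 / 2) with hRdef
  have hRm : MeasurableSet R := measurableSet_cube _ _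
  have hQR : nodeSet Q ⊆ R := icube_subset_cube _ _
  have h1 := h.treeSum_measure_le (ν := volume.withDensity fun x => (w x : ℝ≥0∞)) hn
    (m := maximal (R.indicator fun y => (w y : ℝ≥0∞))) R
    (by
      intro P hP x hx
      have hP0 : 0 < P.2 := pos_of_mem_icube hn hx
      refine le_trans ?_ (cubeAvg_le_maximal _ (half_pos hP0) (icube_subset_cube _ _ hx))
      rw [cubeAvg, volume_nodeSet_eq_cube, withDensity_apply _ (measurableSet_nodeSet P)]
      refine ENNReal.div_le_div_right ?_ _
      calc ∫⁻ x in nodeSet P, (w x : ℝ≥0∞)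
          = ∫⁻ x in nodeSet P, R.indicator (fun y => (w y : ℝ≥0∞)) x :=
            setLIntegral_congr_fun (measurableSet_nodeSet P) fun x hx =>
              (Set.indicator_of_mem (f := fun y => (w y : ℝ≥0∞)) (hP hx)).symm
        _ ≤ _ := lintegral_mono_set (icube_subset_cube _ _)) d Q hQR
  refine h1.trans ?_
  rw [mul_assoc, hν Q]
  refine mul_le_mul_right ?_ 2
  rcases le_or_gt Q.2 0 with h0 | h0
  · have he : nodeSet Q = ∅ := icube_eq_empty hn _ h0
    simp [he]
  refine (lintegral_mono_set hQR).trans ?_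
  rcases eq_or_ne (∫⁻ x in R, (w x : ℝ≥0∞)) 0 with hz | hz
  · have : ∀ x, maximal (R.indicator fun y => (w y : ℝ≥0∞)) x ≤ 0 := by
      intro x
      rw [maximal_le_iff]
      intro b r hr _
      rw [cubeAvg_le_iff hr, zero_mul, ← hz, ← lintegral_indicator hRm]
      exact setLIntegral_le_lintegral _ _
    calc ∫⁻ x in R, maximal (R.indicator fun y => (w y : ℝ≥0∞)) x
        ≤ ∫⁻ _ in R, 0 := lintegral_mono this
      _ ≤ _ := by simp
  · rw [← ENNReal.div_le_iff hz (hloc _ _)]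
    exact le_iSup_of_le (icenter Q.1 Q.2) (le_iSup_of_le (Q.2 / 2)
      (le_iSup_of_le (half_pos h0) le_rfl))

end Sparse

/-! ### Weighted estimates for vector-valued singular integrals -/

section Weighted

lemma rpow_iSup {ι : Sort*} {p : ℝ} (hp : 0 < p) (f : ι → ℝ≥0∞) :
    (⨆ i, f i) ^ p = ⨆ i, f i ^ p :=
  (ENNReal.orderIsoRpow p hp).map_iSup f

lemma tailAvg_ne_top {n : ℕ} {ε : ℝ} (hε : 0 < ε) {h : EuclideanSpace ℝ (Fin n) → ℝ≥0∞}
    (hh : ∫⁻ x, h x ≠ ∞) (z : EuclideanSpace ℝ (Fin n)) {ρ : ℝ} (hρ : 0 < ρ) :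
    tailAvg ε h z ρ ≠ ∞ := by
  have h1 : ∀ m : ℕ, cubeAvg h z (2 ^ m * ρ) ≤ (∫⁻ x, h x) / volume (cube z ρ) := by
    intro m
    rw [cubeAvg]
    exact ENNReal.div_le_div (setLIntegral_le_lintegral _ _)
      (measure_mono (cube_mono z (le_two_pow_mul hρ.le m)))
  refine ne_top_of_le_ne_top ?_ (tailAvg_le ε h1)
  exact ENNReal.mul_ne_top (geomConst_ne_top hε) (ENNReal.div_ne_top hh (volume_cube_ne_zero z hρ))

/-- The cube `[-k, k)ⁿ`. -/
noncomputable def topCube (n k : ℕ) : EuclideanSpace ℝ (Fin n) × ℝ :=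
  (WithLp.toLp 2 fun _ => -(k : ℝ), 2 * k)

lemma monotone_topCube (n : ℕ) : Monotone fun k => nodeSet (topCube n k) := by
  intro k l hkl x hx i
  have h1 := hx i
  have h2 : (k : ℝ) ≤ l := by exact_mod_cast hkl
  simp only [topCube] at h1 ⊢
  constructor <;> linarith

lemma iUnion_topCube (n : ℕ) : ⋃ k, nodeSet (topCube n k) = Set.univ := by
  rw [Set.eq_univ_iff_forall]
  intro x
  obtain ⟨k, hk⟩ := exists_nat_gt ‖x‖
  refine Set.mem_iUnion.2 ⟨k, fun i => ?_⟩
  have h1 := PiLp.norm_apply_le x i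
  rw [Real.norm_eq_abs] at h1
  have h2 := abs_lt.1 (h1.trans_lt hk)
  simp only [topCube]
  constructor <;> linarith

lemma tendsto_setLIntegral_topCube {n : ℕ} (ν : Measure (EuclideanSpace ℝ (Fin n)))
    (F : EuclideanSpace ℝ (Fin n) → ℝ≥0∞) :
    Tendsto (fun k => ∫⁻ x in nodeSet (topCube n k), F x ∂ν) atTop (𝓝 (∫⁻ x, F x ∂ν)) := by
  have hm : Monotone fun k => ∫⁻ x in nodeSet (topCube n k), F x ∂ν := fun k l hkl =>
    lintegral_mono_set (monotone_topCube n hkl)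
  have h2 : ∫⁻ x, F x ∂ν = ⨆ k, ∫⁻ x in nodeSet (topCube n k), F x ∂ν := by
    rw [← setLIntegral_univ, ← iUnion_topCube n,
      setLIntegral_iUnion_of_directed _ (monotone_topCube n).directed_le]
  rw [h2]
  exact tendsto_atTop_iSup hm

lemma Approximable.congr_right {n : ℕ} {V : Type*} [NormedAddCommGroup V]
    {𝒯 : (EuclideanSpace ℝ (Fin n) → V) → EuclideanSpace ℝ (Fin n) → V}
    {f g g' : EuclideanSpace ℝ (Fin n) → V}
    (h : Approximable 𝒯 f g)
    (hg : g =ᵐ[volume] g') : Approximable 𝒯 f g' := by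
  intro δ hδ
  obtain ⟨u, hu, h1, h2⟩ := h δ hδ
  refine ⟨u, hu, h1, le_trans (measure_mono_ae ?_) h2⟩
  filter_upwards [hg] with x hx hx2
  change δ < ‖𝒯 u x - g x‖ₑ
  rw [hx]
  exact hx2

variable {n : ℕ} {𝕜 V : Type*} [RCLike 𝕜] [NormedAddCommGroup V] [NormedSpace 𝕜 V]
    [NormedSpace ℝ V] {K : EuclideanSpace ℝ (Fin n) → EuclideanSpace ℝ (Fin n) → 𝕜} {q : ℝ}
    {B : ℝ≥0∞} {𝒯 : (EuclideanSpace ℝ (Fin n) → V) → EuclideanSpace ℝ (Fin n) → V} {ε C : ℝ}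

/-- Sparse domination of values of singular integrals, on all sufficiently large cubes. -/
lemma IsSIO.exists_isSparse (hT : IsSIO K q B 𝒯) (hK : IsStandardKernel ε C K)
    (hn : 0 < n) (hε : 0 < ε) (hε1 : ε ≤ 1) (hq : 1 < q) (hB : B ≠ ∞) [SMulCommClass ℝ 𝕜 V]
    [CompleteSpace V] {f g : EuclideanSpace ℝ (Fin n) → V} (hf : AEStronglyMeasurable f)
    (hf0 : ∫⁻ x, ‖f x‖ₑ ≠ 0) (hf1 : ∫⁻ x, ‖f x‖ₑ ≠ ∞) (hg : StronglyMeasurable g)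
    (hfg : Approximable 𝒯 f g) :
    ∃ ch : EuclideanSpace ℝ (Fin n) × ℝ → ℕ × (Fin n → ℤ) → EuclideanSpace ℝ (Fin n) × ℝ,
      IsSparse ch ∧ ∀ᶠ k in atTop, ∀ᵐ x, x ∈ nodeSet (topCube n k) →
        ‖g x‖ₑ ≤ 4 * ⨆ d, treeFun ch nodeSet (fun Q => oscConst n q ε C B *
          tailAvg ε (fun y => ‖f y‖ₑ) (icenter Q.1 Q.2) (n * Q.2)) d (topCube n k) x := by
  have hnpos : (0 : ℝ) < n := by exact_mod_cast hn
  set a : EuclideanSpace ℝ (Fin n) × ℝ → ℝ≥0∞ := fun Q => oscConst n q ε C B *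
    tailAvg ε (fun y => ‖f y‖ₑ) (icenter Q.1 Q.2) (n * Q.2) with hadef
  have hex : ∀ Q : EuclideanSpace ℝ (Fin n) × ℝ, ∃ v : V, 0 < Q.2 →
      volume {x | x ∈ nodeSet Q ∧ a Q < ‖g x - v‖ₑ} ≤ (2 ^ (n + 2))⁻¹ * volume (nodeSet Q) := by
    intro Q
    by_cases hQ : 0 < Q.2
    · obtain ⟨v, hv⟩ := hT.oscillation_of_approximable hK hn hε hε1 hq hB hf hfg Q.1 hQ
        (tailAvg_ne_zero ε hf0 _ (by positivity)) (tailAvg_ne_top hε hf1 _ (by positivity))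
      exact ⟨v, fun _ => hv⟩
    · exact ⟨0, fun h => absurd h hQ⟩
  choose v hv using hex
  obtain ⟨ch, hch, hdom⟩ := exists_isSparse_dominating hn hg a v hv
  refine ⟨ch, hch, ?_⟩
  set I := ∫⁻ x, ‖f x‖ₑ with hI
  -- large cubes contain at least half of the mass of `f`
  have hhalf : ∀ᶠ k in atTop, I / 2 < ∫⁻ x in nodeSet (topCube n k), ‖f x‖ₑ :=
    (tendsto_setLIntegral_topCube volume fun x => ‖f x‖ₑ).eventually_const_lt
      (ENNReal.half_lt_self hf0 hf1)
  filter_upwards [hhalf, eventually_gt_atTop 0] with k hk hk0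
  set Q := topCube n k with hQdef
  have hQ2 : 0 < Q.2 := by simp only [Q, topCube]; positivity
  have hv0 : volume (nodeSet Q) ≠ 0 := volume_icube_ne_zero _ hQ2
  have hv1 : volume (nodeSet Q) ≠ ∞ := volume_icube_ne_top _ _
  have hρ : 0 < n * Q.2 := by positivity
  set A := weakConst n q ε C B with hA
  have hA0 : A ≠ 0 := weakConst_ne_zero hn
  have hA1 : A ≠ ∞ := weakConst_ne_top hq hε hB
  have hsub : nodeSet Q ⊆ cube (icenter Q.1 Q.2) (n * Q.2) := by
    refine (icube_subset_cube _ _).trans (cube_mono _ ?_)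
    have : (1 : ℝ) ≤ n := by exact_mod_cast hn
    nlinarith
  have haQ : 2 ^ (n + 3) * A * I ≤ a Q * volume (nodeSet Q) := by
    have hvol : (2 * n : ℝ≥0∞) ^ n * volume (nodeSet Q) =
        volume (cube (icenter Q.1 Q.2) (n * Q.2)) := by
      rw [volume_cube, nodeSet, volume_icube, ← mul_assoc 2, ENNReal.ofReal_mul (by positivity),
        ENNReal.ofReal_mul zero_le_two, mul_pow _ (ENNReal.ofReal Q.2)]
      simp only [ENNReal.ofReal_ofNat, ENNReal.ofReal_natCast]
    calc 2 ^ (n + 3) * A * I = 2 ^ (n + 4) * A * (I / 2) := by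
          rw [show n + 4 = n + 3 + 1 by rfl, pow_succ 2 (n + 3)]
          rw [show (2 ^ (n + 3) * 2 * A * (I / 2) : ℝ≥0∞) = 2 ^ (n + 3) * A * (2 * (I / 2)) by ring,
            ENNReal.mul_div_cancel two_ne_zero (by simp)]
      _ ≤ 2 ^ (n + 4) * A * ∫⁻ x in cube (icenter Q.1 Q.2) (n * Q.2), ‖f x‖ₑ :=
          mul_le_mul_right (hk.le.trans (lintegral_mono_set hsub)) _
      _ = 2 ^ (n + 4) * A * (cubeAvg (fun y => ‖f y‖ₑ) (icenter Q.1 Q.2) (n * Q.2) *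
            volume (cube (icenter Q.1 Q.2) (n * Q.2))) := by
          rw [cubeAvg, ENNReal.div_mul_cancel (volume_cube_ne_zero _ hρ) (volume_cube_ne_top _ _)]
      _ ≤ 2 ^ (n + 4) * A * (tailAvg ε (fun y => ‖f y‖ₑ) (icenter Q.1 Q.2) (n * Q.2) *
            volume (cube (icenter Q.1 Q.2) (n * Q.2))) :=
          mul_le_mul_right (mul_le_mul_left (cubeAvg_le_tailAvg _ _ _ _) _) _
      _ = 2 ^ (n + 4) * (A * (2 * n) ^ n) *
            tailAvg ε (fun y => ‖f y‖ₑ) (icenter Q.1 Q.2) (n * Q.2) * volume (nodeSet Q) := by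
          rw [← hvol]; ring
      _ ≤ a Q * volume (nodeSet Q) := by
          refine mul_le_mul_left (mul_le_mul_left ?_ _) _
          rw [oscConst]
          exact le_add_right le_add_self
  have hgvol : volume {x | a Q < ‖g x‖ₑ} ≤ (2 ^ (n + 2))⁻¹ * volume (nodeSet Q) := by
    have ha0 : a Q ≠ 0 := by
      intro h
      rw [h, zero_mul, nonpos_iff_eq_zero] at haQ
      simp [hA0, hf0] at haQ
    have ha1 : a Q ≠ ∞ := ENNReal.mul_ne_top (oscConst_ne_top hq hε hB)
      (tailAvg_ne_top hε hf1 _ hρ)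
    rw [← ENNReal.mul_le_mul_iff_right ha0 ha1]
    refine (hT.weak_type_of_approximable hK hn hε hε1 hq hB hf hfg (a Q)).trans ?_
    calc 2 * A * I = (2 ^ (n + 2))⁻¹ * 2 ^ (n + 2) * (2 * A * I) := by
          rw [ENNReal.inv_mul_cancel (by simp) (by simp), one_mul]
      _ = (2 ^ (n + 2))⁻¹ * (2 ^ (n + 3) * A * I) := by
          rw [show n + 3 = n + 2 + 1 by rfl, pow_succ 2 (n + 2)]; ring
      _ ≤ (2 ^ (n + 2))⁻¹ * (a Q * volume (nodeSet Q)) := mul_le_mul_right haQ _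
      _ = _ := by ring
  have hvQ : ‖v Q‖ₑ ≤ 2 * a Q := by
    have hlt : volume ({x | x ∈ nodeSet Q ∧ a Q < ‖g x - v Q‖ₑ} ∪ {x | a Q < ‖g x‖ₑ}) <
        volume (nodeSet Q) := by
      calc volume ({x | x ∈ nodeSet Q ∧ a Q < ‖g x - v Q‖ₑ} ∪ {x | a Q < ‖g x‖ₑ})
          ≤ (2 ^ (n + 2))⁻¹ * volume (nodeSet Q) + (2 ^ (n + 2))⁻¹ * volume (nodeSet Q) :=
            (measure_union_le _ _).trans (add_le_add (hv Q hQ2) hgvol)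
        _ = (2 ^ (n + 1))⁻¹ * volume (nodeSet Q) := by
            rw [← add_mul, ← two_mul, show n + 2 = n + 1 + 1 by rfl, pow_succ 2 (n + 1),
              ENNReal.mul_inv (by simp) (by simp), mul_left_comm,
              ENNReal.mul_inv_cancel two_ne_zero (by simp), mul_one]
        _ < 1 * volume (nodeSet Q) := by
            refine ENNReal.mul_lt_mul_left hv0 hv1 ?_
            rw [ENNReal.inv_lt_one]
            exact one_lt_pow₀ (by norm_num) (by omega)
        _ = _ := one_mul _
    obtain ⟨x, hxQ, hx⟩ : ∃ x ∈ nodeSet Q,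
        x ∉ {x | x ∈ nodeSet Q ∧ a Q < ‖g x - v Q‖ₑ} ∪ {x | a Q < ‖g x‖ₑ} := by
      by_contra! hcon
      exact absurd hlt (not_lt.2 (measure_mono hcon))
    simp only [Set.mem_union, Set.mem_ofPred_eq, not_or, not_and, not_lt] at hx
    calc ‖v Q‖ₑ = ‖g x - (g x - v Q)‖ₑ := by rw [sub_sub_cancel]
      _ ≤ ‖g x‖ₑ + ‖g x - v Q‖ₑ := enorm_sub_le
      _ ≤ a Q + a Q := add_le_add hx.2 (hx.1 hxQ)
      _ = 2 * a Q := (two_mul _).symm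
  filter_upwards [hdom Q] with x hx hxQ
  calc ‖g x‖ₑ ≤ ‖v Q‖ₑ + ‖g x - v Q‖ₑ := enorm_le_add_enorm_sub _ _
    _ ≤ 2 * (⨆ d, treeFun ch nodeSet a d Q x) + 2 * ⨆ d, treeFun ch nodeSet a d Q x := by
        refine add_le_add (hvQ.trans (mul_le_mul_right ?_ 2)) (hx hxQ)
        exact (le_treeFun a 0 hxQ).trans (le_iSup (fun d => treeFun ch nodeSet a d Q x) 0)
    _ = _ := by ring

/-- The constant in the weighted estimate: a factor `4` from the sparse domination and a factor `2`
from the Carleson condition. -/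
noncomputable def mainConst (n : ℕ) (q ε C : ℝ) (B : ℝ≥0∞) : ℝ≥0∞ :=
  8 * (oscConst n q ε C B * geomConst ε)

lemma mainConst_ne_top {n : ℕ} {q ε C : ℝ} (hq : 1 < q) (hε : 0 < ε) {B : ℝ≥0∞} (hB : B ≠ ∞) :
    mainConst n q ε C B ≠ ∞ :=
  ENNReal.mul_ne_top (by simp)
    (ENNReal.mul_ne_top (oscConst_ne_top hq hε hB) (geomConst_ne_top hε))

/-- The weighted inequality for values of a vector-valued singular integral. -/
theorem IsSIO.lintegral_rpow_mul_le (hT : IsSIO K q B 𝒯) (hK : IsStandardKernel ε C K)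
    (hn : 0 < n) (hε : 0 < ε) (hε1 : ε ≤ 1) (hq : 1 < q) (hB : B ≠ ∞) [SMulCommClass ℝ 𝕜 V]
    [CompleteSpace V] {f g : EuclideanSpace ℝ (Fin n) → V} (hf : AEStronglyMeasurable f)
    (hf1 : ∫⁻ x, ‖f x‖ₑ ≠ ∞) (hg : AEStronglyMeasurable g)
    (hfg : Approximable 𝒯 f g) {w : EuclideanSpace ℝ (Fin n) → ℝ≥0} (hw : Measurable w)
    (hloc : ∀ a r, ∫⁻ x in cube a r, (w x : ℝ≥0∞) ≠ ∞) {p : ℝ} (hp : 0 < p) :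
    ∫⁻ x, ‖g x‖ₑ ^ p * (w x : ℝ≥0∞) ≤
      (mainConst n q ε C B * ENNReal.ofReal (max 1 p) * wilsonConst w) ^ p *
        ∫⁻ x, maximal (fun y => ‖f y‖ₑ) x ^ p * (w x : ℝ≥0∞) := by
  have hwm : Measurable fun x => (w x : ℝ≥0∞) := hw.coe_nnreal_ennreal
  rcases eq_or_ne (∫⁻ x, ‖f x‖ₑ) 0 with hf0 | hf0
  · -- the weak type inequality shows that `g = 0`
    have hz : ∀ k : ℕ, ∀ᵐ x, ‖g x‖ₑ ≤ ((k : ℝ≥0∞) + 1)⁻¹ := by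
      intro k
      have h := hT.weak_type_of_approximable hK hn hε hε1 hq hB hf hfg ((k : ℝ≥0∞) + 1)⁻¹
      rw [hf0, mul_zero, nonpos_iff_eq_zero, mul_eq_zero] at h
      rw [ae_iff]
      simp only [not_le]
      exact h.resolve_left (ENNReal.inv_ne_zero.2 (by finiteness))
    have hz' : ∀ᵐ x, ‖g x‖ₑ ^ p * (w x : ℝ≥0∞) = 0 := by
      filter_upwards [ae_all_iff.2 hz] with x hx
      have h0 : ‖g x‖ₑ = 0 := by
        by_contra hne
        obtain ⟨k, hk⟩ := ENNReal.exists_inv_nat_lt hne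
        refine absurd ((hx k).trans ?_) (not_le.2 hk)
        exact ENNReal.inv_le_inv.2 le_self_add
      rw [h0, ENNReal.zero_rpow_of_pos hp, zero_mul]
    rw [lintegral_congr_ae hz', lintegral_zero]
    exact zero_le
  · set g' := hg.mk g with hg'
    have hgg' : g =ᵐ[volume] g' := hg.ae_eq_mk
    have hg's : StronglyMeasurable g' := hg.stronglyMeasurable_mk
    obtain ⟨ch, hch, hdom⟩ := hT.exists_isSparse hK hn hε hε1 hq hB hf hf0 hf1 hg's
      (hfg.congr_right hgg')
    set a : EuclideanSpace ℝ (Fin n) × ℝ → ℝ≥0∞ := fun Q => oscConst n q ε C B *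
      tailAvg ε (fun y => ‖f y‖ₑ) (icenter Q.1 Q.2) (n * Q.2) with hadef
    set Mf := maximal fun y => ‖f y‖ₑ with hMf
    have hMfm : Measurable Mf := measurable_maximal _
    set D := oscConst n q ε C B * geomConst ε with hD
    set ν := volume.withDensity fun x => (w x : ℝ≥0∞) with hν
    set Λ := 2 * wilsonConst w with hΛ
    have haM : ∀ Q, ∀ x ∈ nodeSet Q, a Q ≤ D * Mf x := by
      intro Q x hx
      have hQ0 : 0 < Q.2 := pos_of_mem_icube hn hx
      have hn' : (1 : ℝ) ≤ n := by exact_mod_cast hn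
      rw [hD, mul_assoc]
      refine mul_le_mul_right (tailAvg_le_maximal ε _ (by positivity) ?_) _
      exact cube_mono _ (by nlinarith) (icube_subset_cube _ _ hx)
    have hbound : ∀ᶠ k in atTop, ∫⁻ x in nodeSet (topCube n k), ‖g' x‖ₑ ^ p ∂ν ≤
        (mainConst n q ε C B * ENNReal.ofReal (max 1 p) * wilsonConst w) ^ p *
          ∫⁻ x, Mf x ^ p ∂ν := by
      filter_upwards [hdom] with k hk
      set Q := topCube n k with hQ
      have hν' : ∀ᵐ x ∂ν, x ∈ nodeSet Q → ‖g' x‖ₑ ≤ 4 * ⨆ d, treeFun ch nodeSet a d Q x :=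
        withDensity_absolutelyContinuous _ _ hk
      calc ∫⁻ x in nodeSet Q, ‖g' x‖ₑ ^ p ∂ν
          ≤ ∫⁻ x in nodeSet Q, (4 * ⨆ d, treeFun ch nodeSet a d Q x) ^ p ∂ν := by
            refine lintegral_mono_ae ?_
            rw [ae_restrict_iff' (measurableSet_nodeSet Q)]
            filter_upwards [hν'] with x hx hxQ
            exact ENNReal.rpow_le_rpow (hx hxQ) hp.le
        _ = 4 ^ p * ⨆ d, ∫⁻ x in nodeSet Q, treeFun ch nodeSet a d Q x ^ p ∂ν := by
            simp only [ENNReal.mul_rpow_of_nonneg _ _ hp.le, rpow_iSup hp]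
            have hm : ∀ d, Measurable fun x => treeFun ch nodeSet a d Q x ^ p := fun d =>
              (measurable_treeFun measurableSet_nodeSet a d Q).pow_const p
            rw [lintegral_const_mul _ (Measurable.iSup hm), lintegral_iSup hm]
            intro d e hde x
            exact ENNReal.rpow_le_rpow (treeFun_monotone _ _ _ _ hde) hp.le
        _ ≤ 4 ^ p * ((ENNReal.ofReal (max 1 p) * Λ) ^ p *
            ∫⁻ x in nodeSet Q, (D * Mf x) ^ p ∂ν) := by
            refine mul_le_mul_right (iSup_le fun d => ?_) _
            exact lintegral_treeFun_rpow_le measurableSet_nodeSet hch.subset hch.disjoint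
              (hch.treeSum_withDensity_le hn hloc) (hMfm.const_mul D) haM hp d Q
        _ ≤ 4 ^ p * ((ENNReal.ofReal (max 1 p) * Λ) ^ p * (D ^ p * ∫⁻ x, Mf x ^ p ∂ν)) := by
            refine mul_le_mul_right (mul_le_mul_right ?_ _) _
            simp only [ENNReal.mul_rpow_of_nonneg _ _ hp.le]
            rw [lintegral_const_mul _ (hMfm.pow_const p)]
            exact mul_le_mul_right (setLIntegral_le_lintegral _ _) _
        _ = _ := by
            rw [← mul_assoc, ← mul_assoc, ← ENNReal.mul_rpow_of_nonneg _ _ hp.le,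
              ← ENNReal.mul_rpow_of_nonneg _ _ hp.le]
            congr 2
            rw [hΛ, mainConst, hD]
            ring
    have hlim := le_of_tendsto (tendsto_setLIntegral_topCube ν fun x => ‖g' x‖ₑ ^ p) hbound
    have hν2 : ∀ F : EuclideanSpace ℝ (Fin n) → ℝ≥0∞, Measurable F →
        ∫⁻ x, F x ∂ν = ∫⁻ x, F x * (w x : ℝ≥0∞) := by
      intro F hF
      rw [hν, lintegral_withDensity_eq_lintegral_mul _ hwm hF]
      simp only [Pi.mul_apply, mul_comm]
    rw [hν2 _ (hg's.enorm.pow_const p), hν2 _ (hMfm.pow_const p)] at hlim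
    refine le_trans (le_of_eq (lintegral_congr_ae ?_)) hlim
    filter_upwards [hgg'] with x hx
    rw [hx]

/-- The weighted inequality in terms of norms. -/
theorem IsSIO.weightedNorm_le (hT : IsSIO K q B 𝒯) (hK : IsStandardKernel ε C K)
    (hn : 0 < n) (hε : 0 < ε) (hε1 : ε ≤ 1) (hq : 1 < q) (hB : B ≠ ∞) [SMulCommClass ℝ 𝕜 V]
    [CompleteSpace V] {f g : EuclideanSpace ℝ (Fin n) → V} (hf : AEStronglyMeasurable f)
    (hf1 : ∫⁻ x, ‖f x‖ₑ ≠ ∞) (hg : AEStronglyMeasurable g)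
    (hfg : Approximable 𝒯 f g) {w : EuclideanSpace ℝ (Fin n) → ℝ≥0} (hw : Measurable w)
    (hloc : ∀ a r, ∫⁻ x in cube a r, (w x : ℝ≥0∞) ≠ ∞) {p : ℝ} (hp : 0 < p) :
    weightedNorm p w (fun x => ‖g x‖ₑ) ≤
      mainConst n q ε C B * ENNReal.ofReal (max 1 p) * wilsonConst w *
        weightedNorm p w (maximal fun y => ‖f y‖ₑ) := by
  have h := ENNReal.rpow_le_rpow (hT.lintegral_rpow_mul_le hK hn hε hε1 hq hB hf hf1 hg hfg hw
    hloc hp) (one_div_pos.2 hp).le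
  rwa [ENNReal.mul_rpow_of_nonneg _ _ (one_div_pos.2 hp).le, ← ENNReal.rpow_mul,
    mul_one_div_cancel hp.ne', ENNReal.rpow_one] at h

end Weighted

/-! ### Change of exponent -/

lemma approximable_self {n : ℕ} {V : Type*} [NormedAddCommGroup V]
    (𝒯 : (EuclideanSpace ℝ (Fin n) → V) → EuclideanSpace ℝ (Fin n) → V)
    {u : EuclideanSpace ℝ (Fin n) → V} (hu : Nice u) : Approximable 𝒯 u (𝒯 u) := fun δ _ =>
  ⟨u, hu, by simp, by simp⟩

/-- The bound for singular integrals on `L^q` derived from the one on `L^r`. -/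
noncomputable def boundConst (n : ℕ) (q r ε C : ℝ) (B : ℝ≥0∞) : ℝ≥0∞ :=
  (mainConst n r ε C B * ENNReal.ofReal (max 1 q)) ^ q *
    ENNReal.ofReal (2 * 5 ^ n * q / (q - 1) * 2 ^ (q - 1))

lemma boundConst_ne_top {n : ℕ} {q r ε C : ℝ} (hq : 1 < q) (hr : 1 < r) (hε : 0 < ε) {B : ℝ≥0∞}
    (hB : B ≠ ∞) : boundConst n q r ε C B ≠ ∞ := by
  refine ENNReal.mul_ne_top (ENNReal.rpow_ne_top_of_nonneg (by linarith) ?_) ENNReal.ofReal_ne_top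
  exact ENNReal.mul_ne_top (mainConst_ne_top hr hε hB) ENNReal.ofReal_ne_top

/-- A singular integral operator bounded on `L^r` is bounded on `L^q`: apply the weighted
inequality with the weight `1` and the exponent `q`, and the maximal theorem. -/
theorem IsSIO.change_exponent {n : ℕ} {𝕜 V : Type*} [RCLike 𝕜] [NormedAddCommGroup V]
    [NormedSpace 𝕜 V] [NormedSpace ℝ V]
    {K : EuclideanSpace ℝ (Fin n) → EuclideanSpace ℝ (Fin n) → 𝕜} {q r : ℝ}
    {B : ℝ≥0∞} {𝒯 : (EuclideanSpace ℝ (Fin n) → V) → EuclideanSpace ℝ (Fin n) → V} {ε C : ℝ}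
    (hT : IsSIO K r B 𝒯) (hK : IsStandardKernel ε C K)
    (hn : 0 < n) (hε : 0 < ε) (hε1 : ε ≤ 1) (hr : 1 < r) (hq : 1 < q) (hB : B ≠ ∞)
    [SMulCommClass ℝ 𝕜 V] [CompleteSpace V] : IsSIO K q (boundConst n q r ε C B) 𝒯 := by
  refine ⟨hT.aestronglyMeasurable, hT.add, fun u hu => ?_, hT.kernel⟩
  have hq0 : 0 < q := by linarith
  obtain ⟨R, hR⟩ := hu.2.1
  have h1 := hT.lintegral_rpow_mul_le hK hn hε hε1 hr hB hu.1.aestronglyMeasurable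
    hu.lintegral_ne_top (hT.aestronglyMeasurable u hu) (approximable_self 𝒯 hu)
    (w := fun _ => 1) measurable_const
    (fun a ρ => by simpa using volume_cube_ne_top a ρ) hq0
  have h2 := lintegral_maximal_rpow_le hn hq hu.1.norm.measurable (fun x => norm_nonneg _) hR
  simp only [ENNReal.coe_one, mul_one] at h1
  simp only [ofReal_norm] at h2
  refine h1.trans ?_
  rw [boundConst, mul_assoc ((mainConst n r ε C B * ENNReal.ofReal (max 1 q)) ^ q)]
  refine mul_le_mul' (ENNReal.rpow_le_rpow ?_ hq0.le) h2
  calc mainConst n r ε C B * ENNReal.ofReal (max 1 q) * wilsonConst (fun _ => 1)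
      ≤ mainConst n r ε C B * ENNReal.ofReal (max 1 q) * 1 := mul_le_mul_right wilsonConst_one _
    _ = _ := mul_one _

/-! ### Calderón–Zygmund operators as singular integral operators -/

section Scalar

variable {n : ℕ} {𝕜 : Type*} [RCLike 𝕜]
    (T : Lp 𝕜 2 (volume : Measure (EuclideanSpace ℝ (Fin n))) →L[𝕜]
      Lp 𝕜 2 (volume : Measure (EuclideanSpace ℝ (Fin n))))

open Classical in
/-- An operator on `L²`, as an operator on functions (with the value `0` outside `L²`). -/
noncomputable def scalarOp (u : EuclideanSpace ℝ (Fin n) → 𝕜) : EuclideanSpace ℝ (Fin n) → 𝕜 :=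
  if h : MemLp u 2 volume then T (h.toLp u) else 0

lemma scalarOp_of_memLp {u : EuclideanSpace ℝ (Fin n) → 𝕜} (h : MemLp u 2 volume) :
    scalarOp T u = T (h.toLp u) := dif_pos h

lemma lintegral_enorm_sq_eq (u : Lp 𝕜 2 (volume : Measure (EuclideanSpace ℝ (Fin n)))) :
    ∫⁻ x, ‖u x‖ₑ ^ (2 : ℝ) = ‖u‖ₑ ^ (2 : ℝ) := by
  rw [Lp.enorm_def, eLpNorm_eq_lintegral_rpow_enorm_toReal two_ne_zero (by simp),
    ENNReal.toReal_ofNat, ← ENNReal.rpow_mul]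
  norm_num

lemma lintegral_apply_sq_le (u : Lp 𝕜 2 (volume : Measure (EuclideanSpace ℝ (Fin n)))) :
    ∫⁻ x, ‖T u x‖ₑ ^ (2 : ℝ) ≤ ‖T‖ₑ ^ (2 : ℝ) * ∫⁻ x, ‖u x‖ₑ ^ (2 : ℝ) := by
  rw [lintegral_enorm_sq_eq, lintegral_enorm_sq_eq, ← ENNReal.mul_rpow_of_nonneg _ _ zero_le_two]
  exact ENNReal.rpow_le_rpow (T.le_opENorm u) zero_le_two

lemma isSIO_scalarOp {K : EuclideanSpace ℝ (Fin n) → EuclideanSpace ℝ (Fin n) → 𝕜}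
    (hT : ∀ (f : EuclideanSpace ℝ (Fin n) → 𝕜) (hf : MemLp f 2 volume), HasCompactSupport f →
      ∀ᵐ x, x ∉ tsupport f → T (hf.toLp f) x = ∫ y, K x y * f y) :
    IsSIO K 2 (‖T‖ₑ ^ (2 : ℝ)) (scalarOp T) where
  aestronglyMeasurable u hu := by
    rw [scalarOp_of_memLp T (hu.memLp 2)]
    exact Lp.aestronglyMeasurable _
  add u v hu hv := by
    have h : (hu.add hv).memLp 2 = (hu.memLp 2).add (hv.memLp 2) := rfl
    rw [scalarOp_of_memLp T (hu.memLp 2), scalarOp_of_memLp T (hv.memLp 2),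
      scalarOp_of_memLp T ((hu.add hv).memLp 2)]
    have e : ((hu.add hv).memLp 2).toLp (fun x => u x + v x) =
        (hu.memLp 2).toLp u + (hv.memLp 2).toLp v := rfl
    rw [e, map_add]
    exact Lp.coeFn_add _ _
  bound u hu := by
    rw [scalarOp_of_memLp T (hu.memLp 2)]
    refine (lintegral_apply_sq_le T _).trans (le_of_eq ?_)
    congr 1
    refine lintegral_congr_ae ?_
    filter_upwards [(hu.memLp 2).coeFn_toLp] with x hx
    rw [hx]
  kernel u hu := by
    rw [scalarOp_of_memLp T (hu.memLp 2)]
    exact hT u (hu.memLp 2) hu.hasCompactSupport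

/-- Truncations of a function in `L^r`. -/
lemma tendsto_lintegral_truncation {u : EuclideanSpace ℝ (Fin n) → 𝕜} (hu : StronglyMeasurable u)
    {r : ℝ} (hr : 0 < r) (hfin : ∫⁻ x, ‖u x‖ₑ ^ r ≠ ∞) :
    Tendsto (fun m : ℕ => ∫⁻ x, ‖{x | ‖x‖ ≤ m ∧ ‖u x‖ ≤ m}.indicator u x - u x‖ₑ ^ r) atTop
      (𝓝 0) := by
  have hA : ∀ m : ℕ, MeasurableSet {x | ‖x‖ ≤ m ∧ ‖u x‖ ≤ m} := fun m =>
    (measurableSet_le measurable_norm measurable_const).inter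
      (measurableSet_le hu.norm.measurable measurable_const)
  have h0 : (0 : ℝ≥0∞) = ∫⁻ _ : EuclideanSpace ℝ (Fin n), 0 := by simp
  rw [h0]
  refine tendsto_lintegral_of_dominated_convergence (fun x => ‖u x‖ₑ ^ r) (fun m => ?_)
    (fun m => Eventually.of_forall fun x => ?_) hfin (Eventually.of_forall fun x => ?_)
  · exact (((hu.indicator (hA m)).sub hu).enorm).pow_const r
  · refine ENNReal.rpow_le_rpow ?_ hr.le
    by_cases h : x ∈ {x | ‖x‖ ≤ m ∧ ‖u x‖ ≤ m}
    · simp [Set.indicator_of_mem h]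
    · simp [Set.indicator_of_notMem h]
  · obtain ⟨m₀, hm₀⟩ := exists_nat_ge (max ‖x‖ ‖u x‖)
    refine tendsto_const_nhds.congr' ?_
    filter_upwards [eventually_ge_atTop m₀] with m hm
    have hm' : (m₀ : ℝ) ≤ m := by exact_mod_cast hm
    have h : x ∈ {x | ‖x‖ ≤ m ∧ ‖u x‖ ≤ m} :=
      ⟨(le_max_left _ _).trans (hm₀.trans hm'), (le_max_right _ _).trans (hm₀.trans hm')⟩
    rw [Set.indicator_of_mem h, sub_self, enorm_zero, ENNReal.zero_rpow_of_pos hr]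

lemma nice_truncation {u : EuclideanSpace ℝ (Fin n) → 𝕜} (hu : StronglyMeasurable u) (m : ℕ) :
    Nice ({x | ‖x‖ ≤ m ∧ ‖u x‖ ≤ m}.indicator u) := by
  refine ⟨hu.indicator ?_, ⟨m, fun x => ?_⟩, ⟨m, fun x hx => ?_⟩⟩
  · exact (measurableSet_le measurable_norm measurable_const).inter
      (measurableSet_le hu.norm.measurable measurable_const)
  · by_cases h : x ∈ {x | ‖x‖ ≤ m ∧ ‖u x‖ ≤ m}
    · rw [Set.indicator_of_mem h]; exact h.2
    · rw [Set.indicator_of_notMem h]; simp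
  · exact Set.indicator_of_notMem (fun h => absurd h.1 (not_le.2 hx)) _

/-- The values of the extension of `T` to `L¹` are limits in measure of values at test
functions. -/
lemma approximable_of_isValue {f g : EuclideanSpace ℝ (Fin n) → 𝕜} (h : IsValue T f g) :
    Approximable (scalarOp T) f g := by
  obtain ⟨U, hU1, hU2, hU3⟩ := h
  intro δ' hδ'
  -- it suffices to treat finite `δ`
  suffices H : ∀ δ : ℝ≥0∞, δ ≠ 0 → δ ≠ ∞ → ∃ u, Nice u ∧ ∫⁻ x, ‖u x - f x‖ₑ ≤ δ ∧
      volume {x | δ < ‖scalarOp T u x - g x‖ₑ} ≤ δ by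
    have hmin : min δ' 1 ≠ 0 := by simp [min_eq_iff, hδ']
    obtain ⟨u, hu, h1, h2⟩ := H (min δ' 1) hmin (by simp)
    refine ⟨u, hu, h1.trans (min_le_left _ _), (measure_mono fun x hx => ?_).trans
      (h2.trans (min_le_left _ _))⟩
    exact (min_le_left δ' 1).trans_lt hx
  intro δ hδ hδ1
  have hδ2 : 0 < δ / 2 := ENNReal.half_pos hδ
  obtain ⟨k, hk1, hk2⟩ := ((hU2.eventually_le_const hδ2).and
    ((hU3 (δ / 2) hδ2).eventually_le_const hδ2)).exists
  set u : EuclideanSpace ℝ (Fin n) → 𝕜 := ⇑(U k) with hu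
  have hus : StronglyMeasurable u := Lp.stronglyMeasurable _
  have hu2 : MemLp u 2 volume := Lp.memLp _
  have hfin1 : ∫⁻ x, ‖u x‖ₑ ^ (1 : ℝ) ≠ ∞ := by
    simpa only [ENNReal.rpow_one] using (hU1 k).2.ne
  have hfin2 : ∫⁻ x, ‖u x‖ₑ ^ (2 : ℝ) ≠ ∞ := by
    rw [hu, lintegral_enorm_sq_eq]
    exact ENNReal.rpow_ne_top_of_nonneg zero_le_two enorm_ne_top
  have hpos : 0 < (δ / 2) ^ (2 : ℝ) * (δ / 2) / (‖T‖ₑ ^ (2 : ℝ)) :=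
    ENNReal.div_pos (mul_ne_zero (by simp [hδ]) hδ2.ne')
      (ENNReal.rpow_ne_top_of_nonneg zero_le_two enorm_ne_top)
  obtain ⟨m, hm1, hm2⟩ := (((tendsto_lintegral_truncation hus one_pos hfin1).eventually_le_const
    hδ2).and ((tendsto_lintegral_truncation hus two_pos hfin2).eventually_le_const hpos)).exists
  set v := {x | ‖x‖ ≤ m ∧ ‖u x‖ ≤ m}.indicator u with hv
  have hvN : Nice v := nice_truncation hus m
  have hvL : MemLp v 2 volume := hvN.memLp 2
  refine ⟨v, hvN, ?_, ?_⟩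
  · simp only [ENNReal.rpow_one] at hm1
    calc ∫⁻ x, ‖v x - f x‖ₑ ≤ ∫⁻ x, ‖v x - u x‖ₑ + ‖u x - f x‖ₑ := by
          refine lintegral_mono fun x => ?_
          rw [← sub_add_sub_cancel (v x) (u x)]
          exact enorm_add_le _ _
      _ = (∫⁻ x, ‖v x - u x‖ₑ) + ∫⁻ x, ‖u x - f x‖ₑ :=
          lintegral_add_left (hvN.1.sub hus).enorm _
      _ ≤ δ / 2 + δ / 2 := add_le_add hm1 hk1
      _ = δ := ENNReal.add_halves δ
  · rw [scalarOp_of_memLp T hvL]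
    -- Chebyshev's inequality for `T (v - u)`
    have hcheb : volume {x | δ / 2 ≤ ‖T (hvL.toLp v - U k) x‖ₑ} ≤ δ / 2 := by
      have h1 : (δ / 2) ^ (2 : ℝ) * volume {x | δ / 2 ≤ ‖T (hvL.toLp v - U k) x‖ₑ} ≤
          (δ / 2) ^ (2 : ℝ) * (δ / 2) := by
        calc (δ / 2) ^ (2 : ℝ) * volume {x | δ / 2 ≤ ‖T (hvL.toLp v - U k) x‖ₑ}
            = (δ / 2) ^ (2 : ℝ) *
              volume {x | (δ / 2) ^ (2 : ℝ) ≤ ‖T (hvL.toLp v - U k) x‖ₑ ^ (2 : ℝ)} := by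
              simp only [ENNReal.rpow_le_rpow_iff (zero_lt_two (α := ℝ))]
          _ ≤ ∫⁻ x, ‖T (hvL.toLp v - U k) x‖ₑ ^ (2 : ℝ) :=
              mul_meas_ge_le_lintegral₀ ((Lp.aestronglyMeasurable _).enorm.pow_const _) _
          _ ≤ ‖T‖ₑ ^ (2 : ℝ) * ∫⁻ x, ‖(hvL.toLp v - U k) x‖ₑ ^ (2 : ℝ) :=
              lintegral_apply_sq_le T _
          _ = ‖T‖ₑ ^ (2 : ℝ) * ∫⁻ x, ‖v x - u x‖ₑ ^ (2 : ℝ) := by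
              congr 1
              refine lintegral_congr_ae ?_
              filter_upwards [hvL.coeFn_toLp, Lp.coeFn_sub (hvL.toLp v) (U k)] with x h1 h2
              rw [h2, Pi.sub_apply, h1]
          _ ≤ ‖T‖ₑ ^ (2 : ℝ) * ((δ / 2) ^ (2 : ℝ) * (δ / 2) / (‖T‖ₑ ^ (2 : ℝ))) :=
              mul_le_mul_right hm2 _
          _ ≤ _ := ENNReal.mul_div_le
      have h2 : (δ / 2) ^ (2 : ℝ) ≠ 0 := by simp [hδ]
      have h3 : (δ / 2) ^ (2 : ℝ) ≠ ∞ :=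
        ENNReal.rpow_ne_top_of_nonneg zero_le_two (ENNReal.div_ne_top hδ1 two_ne_zero)
      rwa [ENNReal.mul_le_mul_iff_right h2 h3] at h1
    calc volume {x | δ < ‖T (hvL.toLp v) x - g x‖ₑ}
        ≤ volume ({x | δ / 2 ≤ ‖T (hvL.toLp v - U k) x‖ₑ} ∪
          {x | δ / 2 ≤ edist (T (U k) x) (g x)}) := by
          refine measure_mono_ae ?_
          have e : (T (hvL.toLp v - U k) : EuclideanSpace ℝ (Fin n) → 𝕜) =ᵐ[volume]
              fun x => T (hvL.toLp v) x - T (U k) x := by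
            rw [map_sub]
            exact Lp.coeFn_sub _ _
          filter_upwards [e] with x hx hx2
          change δ < ‖T (hvL.toLp v) x - g x‖ₑ at hx2
          change δ / 2 ≤ ‖T (hvL.toLp v - U k) x‖ₑ ∨ δ / 2 ≤ edist (T (U k) x) (g x)
          by_contra! hcon
          rw [hx, edist_eq_enorm_sub] at hcon
          refine absurd hx2 (not_lt.2 ?_)
          rw [← sub_add_sub_cancel (T (hvL.toLp v) x) (T (U k) x), ← ENNReal.add_halves δ]
          exact (enorm_add_le _ _).trans (add_le_add hcon.1.le hcon.2.le)
      _ ≤ δ / 2 + δ / 2 := (measure_union_le _ _).trans (add_le_add hcheb hk2)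
      _ = δ := ENNReal.add_halves δ

lemma IsValue.aestronglyMeasurable {f g : EuclideanSpace ℝ (Fin n) → 𝕜} (h : IsValue T f g) :
    AEStronglyMeasurable g := by
  obtain ⟨U, -, -, hU3⟩ := h
  exact TendstoInMeasure.aestronglyMeasurable (fun k => Lp.aestronglyMeasurable _) hU3

end Scalar

/-! ### The extension to finite sequences -/

section Vector

variable {n : ℕ} {𝕜 : Type*} [RCLike 𝕜] {N : ℕ} {s : ℝ≥0∞}

/-- The componentwise extension of an operator to functions with values in `ℓ^s` of dimension
`N`. -/
noncomputable def vecOp (s : ℝ≥0∞) (N : ℕ)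
    (𝒯 : (EuclideanSpace ℝ (Fin n) → 𝕜) → EuclideanSpace ℝ (Fin n) → 𝕜)
    (u : EuclideanSpace ℝ (Fin n) → PiLp s fun _ : Fin N => 𝕜) (x : EuclideanSpace ℝ (Fin n)) :
    PiLp s fun _ : Fin N => 𝕜 :=
  WithLp.toLp s fun i => 𝒯 (fun y => u y i) x

lemma enorm_rpow_eq_sum {q : ℝ} (hq : 0 < q) [Fact (1 ≤ ENNReal.ofReal q)]
    (v : PiLp (ENNReal.ofReal q) fun _ : Fin N => 𝕜) : ‖v‖ₑ ^ q = ∑ i, ‖v i‖ₑ ^ q := by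
  rw [enorm_eq_nnnorm, PiLp.nnnorm_eq_sum ENNReal.ofReal_ne_top, ENNReal.toReal_ofReal hq.le,
    ENNReal.coe_rpow_of_nonneg _ (one_div_pos.2 hq).le, ← ENNReal.rpow_mul,
    one_div_mul_cancel hq.ne', ENNReal.rpow_one, ENNReal.ofNNReal_finsetSum]
  refine Finset.sum_congr rfl fun i _ => ?_
  rw [ENNReal.coe_rpow_of_nonneg _ hq.le, enorm_eq_nnnorm]

lemma aestronglyMeasurable_toLp [Fact (1 ≤ s)] {g : Fin N → EuclideanSpace ℝ (Fin n) → 𝕜}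
    (hg : ∀ i, AEStronglyMeasurable (g i)) :
    AEStronglyMeasurable fun x => (WithLp.toLp s fun i => g i x : PiLp s fun _ : Fin N => 𝕜) :=
  (PiLp.continuous_toLp s _).comp_aestronglyMeasurable
    (aemeasurable_pi_lambda _ fun i => (hg i).aemeasurable).aestronglyMeasurable

lemma Nice.apply [Fact (1 ≤ s)] {u : EuclideanSpace ℝ (Fin n) → PiLp s fun _ : Fin N => 𝕜}
    (hu : Nice u) (i : Fin N) : Nice fun x => u x i := by
  obtain ⟨h1, ⟨R, hR⟩, S, hS⟩ := hu
  refine ⟨(PiLp.continuous_apply s _ i).comp_stronglyMeasurable h1,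
    ⟨R, fun x => (PiLp.norm_apply_le (u x) i).trans (hR x)⟩, ⟨S, fun x hx => ?_⟩⟩
  change (u x) i = 0
  rw [hS x hx]
  rfl

lemma norm_le_sum [Fact (1 ≤ s)] (v : PiLp s fun _ : Fin N => 𝕜) : ‖v‖ ≤ ∑ i, ‖v i‖ := by
  have hv : v = ∑ i, PiLp.single s i (v i) := by
    change v = ∑ i, WithLp.toLp s (Pi.single i (v i))
    rw [← WithLp.toLp_sum, Finset.univ_sum_single]
  calc ‖v‖ = ‖∑ i, (PiLp.single s i (v i) : PiLp s fun _ : Fin N => 𝕜)‖ :=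
        congrArg _ hv
    _ ≤ ∑ i, ‖(PiLp.single s i (v i) : PiLp s fun _ : Fin N => 𝕜)‖ :=
        norm_sum_le _ _
    _ = ∑ i, ‖v i‖ := Finset.sum_congr rfl fun i _ => PiLp.norm_single s (fun _ => 𝕜) i (v i)

lemma enorm_le_sum [Fact (1 ≤ s)] (v : PiLp s fun _ : Fin N => 𝕜) : ‖v‖ₑ ≤ ∑ i, ‖v i‖ₑ := by
  simp only [← ofReal_norm]
  rw [← ENNReal.ofReal_sum_of_nonneg fun i _ => norm_nonneg _]
  exact ENNReal.ofReal_le_ofReal (norm_le_sum v)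

lemma Nice.toLp [Fact (1 ≤ s)] {u : Fin N → EuclideanSpace ℝ (Fin n) → 𝕜}
    (hu : ∀ i, Nice (u i)) :
    Nice fun x => (WithLp.toLp s fun i => u i x : PiLp s fun _ : Fin N => 𝕜) := by
  choose h1 h2 h3 using hu
  choose R hR using h2
  choose S hS using h3
  refine ⟨(PiLp.continuous_toLp s _).comp_stronglyMeasurable
    (measurable_pi_lambda _ fun i => (h1 i).measurable).stronglyMeasurable,
    ⟨∑ i, R i, fun x => ?_⟩, ⟨∑ i, |S i|, fun x hx => ?_⟩⟩
  · exact (norm_le_sum _).trans (Finset.sum_le_sum fun i _ => hR i x)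
  · ext i
    refine hS i x (lt_of_le_of_lt ?_ hx)
    exact (le_abs_self _).trans
      (Finset.single_le_sum (f := fun i => |S i|) (fun _ _ => abs_nonneg _) (Finset.mem_univ i))

/-- The componentwise extension of a scalar singular integral operator to `ℓ^q`-valued functions,
with a bound that does not depend on the dimension. -/
lemma IsSIO.vecOp {K : EuclideanSpace ℝ (Fin n) → EuclideanSpace ℝ (Fin n) → 𝕜} {ε C : ℝ}
    {q : ℝ} [Fact (1 ≤ ENNReal.ofReal q)] {B : ℝ≥0∞}
    {𝒯 : (EuclideanSpace ℝ (Fin n) → 𝕜) → EuclideanSpace ℝ (Fin n) → 𝕜} (hT : IsSIO K q B 𝒯)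
    (hK : IsStandardKernel ε C K) (hn : 0 < n) (hε : 0 < ε) (hq : 1 < q) :
    IsSIO K q B (vecOp (ENNReal.ofReal q) N 𝒯) where
  aestronglyMeasurable u hu :=
    aestronglyMeasurable_toLp fun i => hT.aestronglyMeasurable _ (hu.apply i)
  add u v hu hv := by
    filter_upwards [ae_all_iff.2 fun i => hT.add _ _ (hu.apply i) (hv.apply i)] with x hx
    ext i
    exact hx i
  bound u hu := by
    have hq0 : 0 < q := by linarith
    simp only [enorm_rpow_eq_sum hq0, VectorCZ.vecOp]
    rw [lintegral_finsetSum' _ fun i _ =>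
        ((hT.aestronglyMeasurable _ (hu.apply i)).enorm.pow_const q),
      lintegral_finsetSum' _ fun i _ => ((hu.apply i).1.aestronglyMeasurable.enorm.pow_const q),
      Finset.mul_sum]
    exact Finset.sum_le_sum fun i _ => hT.bound _ (hu.apply i)
  kernel u hu := by
    filter_upwards [ae_all_iff.2 fun i => hT.kernel _ (hu.apply i)] with x hx hxu
    have hxu' := hxu
    rw [notMem_tsupport_iff_eventuallyEq] at hxu'
    obtain ⟨δ, hδ, h0⟩ := Metric.eventually_nhds_iff_ball.1 hxu'
    have hint : Integrable fun y => K x y • u y :=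
      hK.integrable_smul hn hε hu.integrable hδ h0
    ext i
    have h1 : (∫ y, K x y • u y) i = ∫ y, K x y • u y i :=
      ((PiLp.proj (𝕜 := ℝ) (ENNReal.ofReal q) (fun _ : Fin N => 𝕜) i).integral_comp_comm hint).symm
    rw [h1]
    refine hx i fun h => hxu ?_
    refine closure_mono (fun y (hy : u y i ≠ 0) => ?_) h
    exact fun hy0 => hy (by rw [hy0]; rfl)

lemma Approximable.toLp [Fact (1 ≤ s)]
    {𝒯 : (EuclideanSpace ℝ (Fin n) → 𝕜) → EuclideanSpace ℝ (Fin n) → 𝕜}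
    {f g : Fin N → EuclideanSpace ℝ (Fin n) → 𝕜} (hf : ∀ i, AEStronglyMeasurable (f i))
    (h : ∀ i, Approximable 𝒯 (f i) (g i)) :
    Approximable (VectorCZ.vecOp s N 𝒯) (fun x => WithLp.toLp s fun i => f i x)
      (fun x => WithLp.toLp s fun i => g i x) := by
  intro δ hδ
  have hδN : δ / N ≠ 0 := (ENNReal.div_pos hδ (ENNReal.natCast_ne_top N)).ne'
  have hsum : ∑ _i : Fin N, δ / N ≤ δ := by
    rw [Finset.sum_const, Finset.card_univ, Fintype.card_fin, nsmul_eq_mul]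
    exact ENNReal.mul_div_le
  choose u hu h1 h2 using fun i => h i (δ / N) hδN
  refine ⟨fun x => WithLp.toLp s fun i => u i x, Nice.toLp hu, ?_, ?_⟩
  · calc ∫⁻ x, ‖(WithLp.toLp s fun i => u i x : PiLp s fun _ : Fin N => 𝕜) -
          WithLp.toLp s fun i => f i x‖ₑ
        ≤ ∫⁻ x, ∑ i, ‖u i x - f i x‖ₑ := lintegral_mono fun x => enorm_le_sum _
      _ = ∑ i, ∫⁻ x, ‖u i x - f i x‖ₑ :=
          lintegral_finsetSum' _ fun i _ => ((hu i).1.aestronglyMeasurable.sub (hf i)).enorm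
      _ ≤ ∑ _i : Fin N, δ / N := Finset.sum_le_sum fun i _ => h1 i
      _ ≤ δ := hsum
  · calc volume {x | δ < ‖VectorCZ.vecOp s N 𝒯 (fun x => WithLp.toLp s fun i => u i x) x -
          WithLp.toLp s fun i => g i x‖ₑ}
        ≤ volume (⋃ i, {x | δ / N < ‖𝒯 (u i) x - g i x‖ₑ}) := by
          refine measure_mono fun x hx => ?_
          by_contra hcon
          simp only [Set.mem_iUnion, not_exists] at hcon
          refine absurd (show δ < _ from hx) (not_lt.2 ((enorm_le_sum _).trans ?_))
          exact (Finset.sum_le_sum fun i _ => not_lt.1 (hcon i)).trans hsum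
      _ ≤ ∑ i, volume {x | δ / N < ‖𝒯 (u i) x - g i x‖ₑ} := measure_iUnion_fintype_le _ _
      _ ≤ ∑ _i : Fin N, δ / N := Finset.sum_le_sum fun i _ => h2 i
      _ ≤ δ := hsum

end Vector

/-! ### Weights of class `A_∞` and passage to infinite sequences -/

/-- Weights of class `A_∞` are locally integrable: the other factor in the `A_s` condition does not
vanish, as `w` is finite. -/
lemma MemAInfty.lintegral_cube_ne_top {n : ℕ} (hn : 0 < n) {w : EuclideanSpace ℝ (Fin n) → ℝ≥0}
    (hw : MemAInfty w) (a : EuclideanSpace ℝ (Fin n)) (r : ℝ) :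
    ∫⁻ x in cube a r, (w x : ℝ≥0∞) ≠ ∞ := by
  obtain ⟨hm, s, hs, hA⟩ := hw
  rcases le_or_gt r 0 with hr | hr
  · have : volume (cube a r) = 0 := by
      rw [volume_cube, ENNReal.ofReal_of_nonpos (by linarith), zero_pow hn.ne']
    rw [setLIntegral_measure_zero _ _ this]
    exact ENNReal.zero_ne_top
  intro htop
  have hs1 : 0 < s - 1 := by linarith
  have h1 : cubeAvg (fun y => (w y : ℝ≥0∞)) a r = ∞ := by
    rw [cubeAvg, htop, ENNReal.top_div_of_ne_top (volume_cube_ne_top a r)]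
  have h2 : cubeAvg (fun y => (w y : ℝ≥0∞) ^ (1 - s / (s - 1))) a r ≠ 0 := by
    intro h0
    rw [cubeAvg, ENNReal.div_eq_zero_iff] at h0
    have h0 := h0.resolve_right (volume_cube_ne_top a r)
    rw [lintegral_eq_zero_iff (hm.coe_nnreal_ennreal.pow_const _)] at h0
    have hneg : 1 - s / (s - 1) < 0 := by
      rw [sub_neg, lt_div_iff₀ hs1]
      linarith
    have h3 : ∀ᵐ _ ∂(volume.restrict (cube a r)), False := by
      filter_upwards [h0] with x hx
      simp only [Pi.zero_apply, ENNReal.rpow_eq_zero_iff, ENNReal.coe_ne_top, false_and,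
        or_false] at hx
      exact lt_asymm hx.2 hneg
    rw [eventually_false_iff_eq_bot, ae_eq_bot, Measure.restrict_eq_zero] at h3
    exact volume_cube_ne_zero a hr h3
  have h4 : cubeAvg (fun y => (w y : ℝ≥0∞)) a r *
      cubeAvg (fun y => (w y : ℝ≥0∞) ^ (1 - s / (s - 1))) a r ^ (s - 1) ≤ apConst s w :=
    le_iSup_of_le a (le_iSup_of_le r (le_iSup_of_le hr le_rfl))
  rw [h1, ENNReal.top_mul] at h4
  · exact absurd hA (not_lt.2 h4)
  · simp [ENNReal.rpow_eq_zero_iff, h2, not_lt.2 hs1.le]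

/-- The partial sums of `lqNorm`. -/
noncomputable def lqPartial {n : ℕ} {𝕜 : Type*} [RCLike 𝕜] (q : ℝ)
    (f : ℕ → EuclideanSpace ℝ (Fin n) → 𝕜) (N : ℕ) (x : EuclideanSpace ℝ (Fin n)) : ℝ≥0∞ :=
  (∑ j ∈ Finset.range N, ‖f j x‖ₑ ^ q) ^ (1 / q)

section Partial

variable {n : ℕ} {𝕜 : Type*} [RCLike 𝕜] {q : ℝ}

lemma lqPartial_mono (hq : 0 < q) (f : ℕ → EuclideanSpace ℝ (Fin n) → 𝕜)
    (x : EuclideanSpace ℝ (Fin n)) : Monotone fun N => lqPartial q f N x := fun _ _ h =>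
  ENNReal.rpow_le_rpow (Finset.sum_le_sum_of_subset (Finset.range_subset_range.2 h))
    (one_div_pos.2 hq).le

lemma lqNorm_eq_iSup (hq : 0 < q) (f : ℕ → EuclideanSpace ℝ (Fin n) → 𝕜)
    (x : EuclideanSpace ℝ (Fin n)) : lqNorm q f x = ⨆ N, lqPartial q f N x := by
  rw [lqNorm, ENNReal.tsum_eq_iSup_nat, rpow_iSup (one_div_pos.2 hq)]
  rfl

lemma enorm_toLp_eq_lqPartial (hq : 0 < q) [Fact (1 ≤ ENNReal.ofReal q)]
    (f : ℕ → EuclideanSpace ℝ (Fin n) → 𝕜) (N : ℕ) (x : EuclideanSpace ℝ (Fin n)) :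
    ‖(WithLp.toLp (ENNReal.ofReal q) fun i : Fin N => f i x :
      PiLp (ENNReal.ofReal q) fun _ : Fin N => 𝕜)‖ₑ = lqPartial q f N x := by
  rw [lqPartial, Finset.sum_range fun j => ‖f j x‖ₑ ^ q,
    ← enorm_rpow_eq_sum hq (WithLp.toLp (ENNReal.ofReal q) fun i : Fin N => f i x),
    ← ENNReal.rpow_mul, mul_one_div_cancel hq.ne', ENNReal.rpow_one]

/-- A bound for the weighted norm of all finite sections is a bound for the whole sequence. -/
lemma weightedNorm_lqNorm_le (hq : 0 < q) {p : ℝ} (hp : 0 < p)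
    {w : EuclideanSpace ℝ (Fin n) → ℝ≥0} (hw : Measurable w)
    {g : ℕ → EuclideanSpace ℝ (Fin n) → 𝕜} (hg : ∀ j, AEStronglyMeasurable (g j)) {M : ℝ≥0∞}
    (h : ∀ N, weightedNorm p w (lqPartial q g N) ≤ M) : weightedNorm p w (lqNorm q g) ≤ M := by
  have hm : ∀ N, AEMeasurable (fun x => lqPartial q g N x ^ p * (w x : ℝ≥0∞)) := fun N =>
    (((Finset.aemeasurable_fun_sum _ fun j _ => (hg j).enorm.pow_const q).pow_const _).pow_const
      p).mul hw.coe_nnreal_ennreal.aemeasurable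
  have h1 : ∫⁻ x, lqNorm q g x ^ p * (w x : ℝ≥0∞) =
      ⨆ N, ∫⁻ x, lqPartial q g N x ^ p * (w x : ℝ≥0∞) := by
    rw [← lintegral_iSup' hm]
    · simp only [lqNorm_eq_iSup hq, rpow_iSup hp, ENNReal.iSup_mul]
    · refine Eventually.of_forall fun x N N' hN => ?_
      exact mul_le_mul_left (ENNReal.rpow_le_rpow (lqPartial_mono hq g x hN) hp.le) _
  rw [weightedNorm, h1, rpow_iSup (one_div_pos.2 hp)]
  exact iSup_le h

lemma lintegral_lqPartial_ne_top (f : ℕ → EuclideanSpace ℝ (Fin n) → 𝕜)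
    [Fact (1 ≤ ENNReal.ofReal q)] (hf : ∀ j, Integrable (f j)) (N : ℕ) :
    ∫⁻ x, ‖(WithLp.toLp (ENNReal.ofReal q) fun i : Fin N => f i x :
      PiLp (ENNReal.ofReal q) fun _ : Fin N => 𝕜)‖ₑ ≠ ∞ := by
  refine ne_top_of_le_ne_top ?_ (lintegral_mono fun x => enorm_le_sum _)
  change ∫⁻ x, ∑ i : Fin N, ‖f i x‖ₑ ≠ ∞
  rw [lintegral_finsetSum' _ (f := fun (i : Fin N) x => ‖f i x‖ₑ) fun i _ => (hf i).1.enorm]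
  exact ENNReal.sum_ne_top.2 fun i _ => (hf i).2.ne

end Partial

end VectorCZ

theorem mainTheorem2 {𝕜 : Type*} [RCLike 𝕜] (n : ℕ) (hn : 0 < n)
    (T : Lp 𝕜 2 (volume : Measure (EuclideanSpace ℝ (Fin n))) →L[𝕜]
      Lp 𝕜 2 (volume : Measure (EuclideanSpace ℝ (Fin n))))
    (hT : VectorCZ.IsCalderonZygmund T) (q : ℝ) (hq : 1 < q) :
    ∃ c : ℝ≥0, ∀ w : EuclideanSpace ℝ (Fin n) → ℝ≥0, VectorCZ.MemAInfty w →
      ∀ p : ℝ, 0 < p → ∀ f Tf : ℕ → EuclideanSpace ℝ (Fin n) → 𝕜,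
        (∀ j, HasCompactSupport (f j)) → (∀ j, Integrable (f j) volume) →
        (∀ j, VectorCZ.IsValue T (f j) (Tf j)) →
        VectorCZ.weightedNorm p w (VectorCZ.lqNorm q Tf) ≤
          (c : ℝ≥0∞) * ENNReal.ofReal (max 1 p) * VectorCZ.wilsonConst w *
            VectorCZ.weightedNorm p w (VectorCZ.maximal (VectorCZ.lqNorm q f)) := by
  open VectorCZ in
  obtain ⟨ε, C, K, hε, hε1, hK, hker⟩ := hT
  have hq0 : 0 < q := by linarith
  have hq1 : Fact (1 ≤ ENNReal.ofReal q) := ⟨by simpa using hq.le⟩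
  have hB₀ : ‖T‖ₑ ^ (2 : ℝ) ≠ ∞ := ENNReal.rpow_ne_top_of_nonneg zero_le_two enorm_ne_top
  -- the first application of the weighted inequality: `T` is bounded on scalar `L^q`
  have hSIO := (isSIO_scalarOp T hker).change_exponent hK hn hε hε1 one_lt_two hq hB₀
  set B := boundConst n q 2 ε C (‖T‖ₑ ^ (2 : ℝ)) with hBdef
  have hB : B ≠ ∞ := boundConst_ne_top hq one_lt_two hε hB₀
  refine ⟨(mainConst n q ε C B).toNNReal, fun w hw p hp f Tf _ hfi hval => ?_⟩
  rw [ENNReal.coe_toNNReal (mainConst_ne_top hq hε hB)]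
  refine weightedNorm_lqNorm_le hq0 hp hw.1 (fun j => (hval j).aestronglyMeasurable T) fun N => ?_
  -- the second application: the extension of `T` to sequences of length `N`
  have hvec := (hSIO.vecOp (N := N) hK hn hε hq).weightedNorm_le hK hn hε hε1 hq hB
    (aestronglyMeasurable_toLp (g := fun i : Fin N => f i) fun i => (hfi i).1)
    (lintegral_lqPartial_ne_top f hfi N)
    (aestronglyMeasurable_toLp (g := fun i : Fin N => Tf i)
      fun i => (hval i).aestronglyMeasurable T)
    (Approximable.toLp (fun i => (hfi i).1) fun i => approximable_of_isValue T (hval i))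
    hw.1 (hw.lintegral_cube_ne_top hn) hp
  simp only [enorm_toLp_eq_lqPartial hq0] at hvec
  refine hvec.trans (mul_le_mul_right ?_ _)
  refine ENNReal.rpow_le_rpow (lintegral_mono fun x => ?_) (one_div_pos.2 hp).le
  refine mul_le_mul_left (ENNReal.rpow_le_rpow (maximal_mono (fun y => ?_) x) hp.le) _
  rw [lqNorm_eq_iSup hq0]
  exact le_iSup (fun N => lqPartial q f N y) N
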